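/- Let $n\ge 0$ and let $\mathcal X$ be a directed graph whose edges are coloured by $\{1,\dots,n-1\}$. Write $y=E_ix$ if there is an edge $y\to x$ of colour $i$, and $z=F_ix$ if there is an edge $x\to z$ of colour $i$. Let $\varepsilon(x,i)$ (resp. $-\delta(x,i)$) be the number of edges after (resp. before) $x$ on the maximal directed path of colour $i$ through $x$. Put $\Delta_i\delta(x,j)=\delta(E_ix,j)-\delta(x,j)$ and $\nabla_i\delta(x,j)=\delta(x,j)-\delta(F_ix,j)$, and likewise for $\varepsilon$. $\mathcal X$ is *regular* if, for all vertices $x$ and colours $i,j$: - (P1) all monochromatic directed paths have finite length (in particular there are no monochromatic directed cycles); - (P2) for every $x$ and $i$ there is at most one edge of colour $i$ into $x$ and at most one out of $x$; - (P3) if $E_ix$ is defined, then $\Delta_i\delta(x,j)+\Delta_i\varepsilon(x,j)$ is $2$ if $j=i$, $-1$ if $|i-j|=1$, and $0$ if $|i-j|\ge2$; - (P4) if $E_ix$ is defined and $j\ne i$, then $\Delta_i\delta(x,j)\le0$ and $\Delta_i\varepsilon(x,j)\le 0$; - (P5) for $i\neq j$: if $E_ix,E_jx$ are defined and $\Delta_i\delta(x,j)=0$,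 then $E_iE_jx=E_jE_ix=y$ (both sides being defined) and $\nabla_j\varepsilon(y,i)=0$; if $F_ix,F_jx$ are defined and $\nabla_i\varepsilon(x,j)=0$, then $F_iF_jx=F_jF_ix=y$ and $\Delta_j\delta(y,i)=0$; - (P6) for $i\neq j$: if $E_ix,E_jx$ are defined and $\Delta_i\delta(x,j)=\Delta_j\delta(x,i)=-1$, then $E_iE_j^2E_ix=E_jE_i^2E_jx=y$ and $\nabla_i\varepsilon(y,j)=\nabla_j\varepsilon(y,i)=-1$; if $F_ix,F_jx$ are defined and $\nabla_i\varepsilon(x,j)=\nabla_j\varepsilon(x,i)=-1$, then $F_iF_j^2F_ix=F_jF_i^2F_jx=y$ and $\Delta_i\delta(y,j)=\Delta_j\delta(y,i)=-1$. The *$0$-weight space* of $\mathcal X$ is the set of vertices $x$ with $\varepsilon(x,i)=-\delta(x,i)$ for all $i$. Let $V$ be the set of vertices $x$ with $\varepsilon(x,i)=-\delta(x,i)\in\{0,1\}$ for all $i$. Define $\mathcal G(\mathcal X)=(V,\sigma,D)$ by $\sigma(x)_i=+1$ if $\varepsilon(x,i)=1$ and $\sigma(x)_i=-1$ if $\varepsilon(x,i)=0$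 ($1\le i<n$), and, for $1<i<n$, $$D_i(x)=\begin{cases}F_{i-1}F_iE_{i-1}E_ix&\text{if }\varepsilon(x,i)=1,\ \varepsilon(x,i-1)=0,\\ F_iF_{i-1}E_iE_{i-1}x&\text{if }\varepsilon(x,i)=0,\ \varepsilon(x,i-1)=1,\end{cases}$$ with no $i$-edge from $x$ otherwise; $\{v,w\}\in D_i$ means that $D_i(v)=w$ with $v,w\in V$. **Theorem.** If $\mathcal X$ is regular and its $0$-weight space equals $V$, then $\mathcal G(\mathcal X)$ is a *dual equivalence graph*. That is, each $D_i$ is a well-defined set of unordered pairs of elements of $V$ (so $D_i(v)=w$ if and only if $D_i(w)=v$) and, all colours $i,j$ lying in $\{2,\dots,n-1\}$ and all sign indices in $\{1,\dots,n-1\}$: - (ax1) $\sigma(v)_{i-1}=-\sigma(v)_i$ if and only if there is $w\in V$ with $\{v,w\}\in D_i$, and $w$ is unique when it exists. - (ax2) If $\{v,w\}\in D_i$, then $\sigma(v)_j=-\sigma(w)_j$ for $j=i-1,i$, and $\sigma(v)_h=\sigma(w)_h$ for $h<i-2$ and for $h>i+1$. - (ax3) If $\{v,w\}\in D_i$, then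 $\sigma(v)_{i-2}=-\sigma(w)_{i-2}$ implies $\sigma(v)_{i-2}=-\sigma(v)_{i-1}$ (when $i>2$), and $\sigma(v)_{i+1}=-\sigma(w)_{i+1}$ implies $\sigma(v)_{i+1}=-\sigma(v)_i$ (when $i+1<n$). - (ax4) For $i>3$, every connected component with at least one edge of $(V,D_{i-2}\cup D_{i-1}\cup D_i)$ is isomorphic, as an edge-coloured graph, to one of the following: the path on $4$ vertices with successive colours $i-2,\ i-1,\ i$; the graph on $a,b,c,d,e$ with a double edge $ab$ of colours $i-1,i$, an edge $bc$ of colour $i-2$, an edge $cd$ of colour $i$, and a double edge $de$ of colours $i-2,i-1$; the graph on $u,v,w,x,y,z$ with edges $uv,yz$ of colour $i-1$, edges $vw,xy$ of colour $i$ and edges $vx,wy$ of colour $i-2$. Moreover, any two vertices in the same connected component of $(V,D_2\cup\dots\cup D_i)$ are joined by a path in it containing at most one $D_i$ edge. When $n=4$ the following takes the place of this axiom: for $i=3$, every connected component with at least one edge of $(V,D_{i-1}\cup D_i)$ is either a path on $3$ vertices with successive colours $i-1,\ i$ or a double edge of colours $i-1,i$ on two vertices. - (ax5) If $|i-j|\ge3$,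 $\{v,u\}\in D_i$ and $\{u,w\}\in D_j$, then there is $x\in V$ with $\{v,x\}\in D_j$ and $\{x,w\}\in D_i$. -/

import Mathlib

universe u

/-- A directed graph with vertex set `V` whose edges are coloured by `{1, …, n - 1}`.
`edge i x y` says that there is an edge `x → y` of colour `i`, i.e. `y = F_i x`, `x = E_i y`. -/
structure DirectedColoredGraph (n : ℕ) (V : Type u) where
  edge : ℕ → V → V → Prop
  color_mem : ∀ {i : ℕ} {x y : V}, edge i x y → 1 ≤ i ∧ i < n

namespace DirectedColoredGraph

variable {n : ℕ} {V : Type u} (X : DirectedColoredGraph n V)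

/-- There is a directed path of colour `i` with exactly `k` edges from `x` to `y`. -/
def MonoPath (i : ℕ) : ℕ → V → V → Prop
  | 0, x, y => x = y
  | k + 1, x, y => ∃ z, X.edge i x z ∧ MonoPath i k z y

/-- `ε(x,i)`: the number of edges of the `i`-string through `x` that come after `x`, i.e. the
largest length of a directed path of colour `i` starting at `x`.
(The lengths are bounded when the graph satisfies `P1` and `P2` below.) -/
noncomputable def eps (x : V) (i : ℕ) : ℤ :=
  ((sSup {k : ℕ | ∃ y, X.MonoPath i k x y} : ℕ) : ℤ)

/-- `δ(x,i)`: minus the number of edges of the `i`-string through `x` that come before `x`. -/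
noncomputable def del (x : V) (i : ℕ) : ℤ :=
  -((sSup {k : ℕ | ∃ y, X.MonoPath i k y x} : ℕ) : ℤ)

/-- Stembridge's axioms (type A). Since `E_i x` and `F_i x` are unique by `P2`,
"`y = E_i x`" is written `X.edge i y x` and "`y = F_i x`" is written `X.edge i x y`. -/
structure IsRegular : Prop where
  /-- No infinite directed path of a single colour (forwards or backwards). -/
  P1 : ∀ i : ℕ, (¬ ∃ s : ℕ → V, ∀ k, X.edge i (s k) (s (k + 1))) ∧
    (¬ ∃ s : ℕ → V, ∀ k, X.edge i (s (k + 1)) (s k))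
  P2 : ∀ (i : ℕ) (x y z : V), (X.edge i y x → X.edge i z x → y = z) ∧
    (X.edge i x y → X.edge i x z → y = z)
  /-- Here `a = E_i x`. -/
  P3 : ∀ (i j : ℕ) (x a : V), 1 ≤ j → j < n → X.edge i a x →
    (X.del a j - X.del x j) + (X.eps a j - X.eps x j) =
      if j = i then 2 else if j = i + 1 ∨ i = j + 1 then -1 else 0
  /-- Here `a = E_i x`. -/
  P4 : ∀ (i j : ℕ) (x a : V), 1 ≤ j → j < n → j ≠ i → X.edge i a x →
    X.del a j - X.del x j ≤ 0 ∧ X.eps a j - X.eps x j ≤ 0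
  /-- Here `a = E_i x`, `b = E_j x`, and `y = E_i E_j x = E_j E_i x`, so that `F_j y = a`. -/
  P5_E : ∀ (i j : ℕ) (x a b : V), i ≠ j → X.edge i a x → X.edge j b x →
    X.del a j - X.del x j = 0 →
    ∃ y, X.edge i y b ∧ X.edge j y a ∧ X.eps y i - X.eps a i = 0
  /-- Here `a = F_i x`, `b = F_j x`, and `y = F_i F_j x = F_j F_i x`, so that `E_j y = a`. -/
  P5_F : ∀ (i j : ℕ) (x a b : V), i ≠ j → X.edge i x a → X.edge j x b →
    X.eps x j - X.eps a j = 0 →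
    ∃ y, X.edge i b y ∧ X.edge j a y ∧ X.del a i - X.del y i = 0
  /-- Here `a = E_i x`, `b = E_j x`, `a' = E_j² E_i x`, `b' = E_i² E_j x` and
  `y = E_i a' = E_j b'`, so that `F_i y = a'` and `F_j y = b'`. -/
  P6_E : ∀ (i j : ℕ) (x a b : V), i ≠ j → X.edge i a x → X.edge j b x →
    X.del a j - X.del x j = -1 → X.del b i - X.del x i = -1 →
    ∃ a₁ a' b₁ b' y, X.edge j a₁ a ∧ X.edge j a' a₁ ∧ X.edge i y a' ∧
      X.edge i b₁ b ∧ X.edge i b' b₁ ∧ X.edge j y b' ∧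
      X.eps y j - X.eps a' j = -1 ∧ X.eps y i - X.eps b' i = -1
  /-- Here `a = F_i x`, `b = F_j x`, `a' = F_j² F_i x`, `b' = F_i² F_j x` and
  `y = F_i a' = F_j b'`, so that `E_i y = a'` and `E_j y = b'`. -/
  P6_F : ∀ (i j : ℕ) (x a b : V), i ≠ j → X.edge i x a → X.edge j x b →
    X.eps x j - X.eps a j = -1 → X.eps x i - X.eps b i = -1 →
    ∃ a₁ a' b₁ b' y, X.edge j a a₁ ∧ X.edge j a₁ a' ∧ X.edge i a' y ∧
      X.edge i b b₁ ∧ X.edge i b₁ b' ∧ X.edge j b' y ∧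
      X.del a' j - X.del y j = -1 ∧ X.del b' i - X.del y i = -1

/-- The `0`-weight space: the vertices at the centre of each of their strings. -/
def zeroWeightSpace : Set V :=
  {x | ∀ i, 1 ≤ i → i < n → X.eps x i = -X.del x i}

/-- The vertices with `ε(x,i) = -δ(x,i) ∈ {0,1}` for all colours `i`. -/
def zeroOneVertices : Set V :=
  {x | ∀ i, 1 ≤ i → i < n → X.eps x i = -X.del x i ∧ (X.eps x i = 0 ∨ X.eps x i = 1)}

/-- `w = F_j F_i E_j E_i v` (in particular, the right-hand side is defined). -/
def IsFFEE (i j : ℕ) (v w : V) : Prop :=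
  ∃ a b c, X.edge i a v ∧ X.edge j b a ∧ X.edge i b c ∧ X.edge j c w

end DirectedColoredGraph

/-- The data of a vertex-signed, edge-coloured graph on `V`: signs `σ(v)_i` for `1 ≤ i < n`
(other indices are never used) and the relations `D i v w`, "`{v, w} ∈ D_i`", for `1 < i < n`. -/
structure SignedColoredGraph (n : ℕ) (V : Type u) where
  sign : V → ℕ → ℤˣ
  D : ℕ → V → V → Prop
  color_mem : ∀ {i : ℕ} {v w : V}, D i v w → 1 < i ∧ i < n

namespace SignedColoredGraph

variable {n : ℕ} {V : Type u} (G : SignedColoredGraph n V)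

/-- `v` and `w` are joined by a path all of whose edges have a colour in `C`. -/
def Joined (C : Set ℕ) : V → V → Prop :=
  Relation.ReflTransGen fun v w => ∃ j ∈ C, G.D j v w

/-- The connected component of `v` in the subgraph of edges with colour in `C` is isomorphic,
as an edge-coloured graph, to the graph `T` on `Fin m`
(`T j a b`: there is an edge of colour `j` between `a` and `b`). -/
def ComponentIs (C : Set ℕ) (v : V) {m : ℕ} (T : ℕ → Fin m → Fin m → Prop) : Prop :=
  ∃ φ : Fin m → V, Function.Injective φ ∧ Set.range φ = {w | G.Joined C v w} ∧
    ∀ j ∈ C, ∀ a b, G.D j (φ a) (φ b) ↔ T j a b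

/-- `• -(i-1)- • -i- •` -/
def path3 (i : ℕ) (j : ℕ) (a b : Fin 3) : Prop :=
  (j = i - 1 ∧ s(a, b) = s(0, 1)) ∨ (j = i ∧ s(a, b) = s(1, 2))

/-- Two vertices joined by a double edge with colours `i-1` and `i`. -/
def double2 (i : ℕ) (j : ℕ) (a b : Fin 2) : Prop :=
  (j = i - 1 ∨ j = i) ∧ s(a, b) = s(0, 1)

/-- `• -(i-2)- • -(i-1)- • -i- •` -/
def path4 (i : ℕ) (j : ℕ) (a b : Fin 4) : Prop :=
  (j = i - 2 ∧ s(a, b) = s(0, 1)) ∨ (j = i - 1 ∧ s(a, b) = s(1, 2)) ∨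
  (j = i ∧ s(a, b) = s(2, 3))

/-- `• =(i-1, i)= • -(i-2)- • -i- • =(i-2, i-1)= •` -/
def doublePath5 (i : ℕ) (j : ℕ) (a b : Fin 5) : Prop :=
  ((j = i - 1 ∨ j = i) ∧ s(a, b) = s(0, 1)) ∨ (j = i - 2 ∧ s(a, b) = s(1, 2)) ∨
  (j = i ∧ s(a, b) = s(2, 3)) ∨ ((j = i - 2 ∨ j = i - 1) ∧ s(a, b) = s(3, 4))

/-- The vertices `u, v, w, x, y, z` are `0, …, 5`; the edges are `uv, yz` of colour `i-1`,
`vw, xy` of colour `i`, and `vx, wy` of colour `i-2`. -/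
def flower6 (i : ℕ) (j : ℕ) (a b : Fin 6) : Prop :=
  (j = i - 1 ∧ (s(a, b) = s(0, 1) ∨ s(a, b) = s(4, 5))) ∨
  (j = i ∧ (s(a, b) = s(1, 2) ∨ s(a, b) = s(3, 4))) ∨
  (j = i - 2 ∧ (s(a, b) = s(1, 3) ∨ s(a, b) = s(2, 4)))

/-- Dual equivalence graphs (of degree `n`). -/
structure IsDualEquivalenceGraph : Prop where
  /-- The edges are unordered pairs. -/
  symm : ∀ (i : ℕ) (v w : V), G.D i v w → G.D i w v
  ax1 : ∀ (i : ℕ) (v : V), 1 < i → i < n →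
    (G.sign v (i - 1) = -G.sign v i ↔ ∃ w, G.D i v w) ∧
    (∀ w w', G.D i v w → G.D i v w' → w = w')
  ax2 : ∀ (i : ℕ) (v w : V), G.D i v w →
    G.sign v (i - 1) = -G.sign w (i - 1) ∧ G.sign v i = -G.sign w i ∧
    ∀ h, 1 ≤ h → h < n → (h + 2 < i ∨ i + 1 < h) → G.sign v h = G.sign w h
  ax3 : ∀ (i : ℕ) (v w : V), G.D i v w →
    (2 < i → G.sign v (i - 2) = -G.sign w (i - 2) → G.sign v (i - 2) = -G.sign v (i - 1)) ∧
    (i + 1 < n → G.sign v (i + 1) = -G.sign w (i + 1) → G.sign v (i + 1) = -G.sign v i)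
  /-- The non-trivial components of `D_{i-2} ∪ D_{i-1} ∪ D_i`. -/
  ax4_components : ∀ (i : ℕ) (v : V), 3 < i → i < n →
    (∃ w, ∃ j ∈ ({i - 2, i - 1, i} : Set ℕ), G.D j v w) →
    G.ComponentIs {i - 2, i - 1, i} v (path4 i) ∨
    G.ComponentIs {i - 2, i - 1, i} v (doublePath5 i) ∨
    G.ComponentIs {i - 2, i - 1, i} v (flower6 i)
  /-- Any two vertices in the same component of `D_2 ∪ ⋯ ∪ D_i` are joined by a path in
  `D_2 ∪ ⋯ ∪ D_i` that uses no edge of `D_i`, or exactly one, `{a, b}`. -/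
  ax4_paths : ∀ (i : ℕ) (v w : V), 3 < i → i < n → G.Joined (Set.Icc 2 i) v w →
    G.Joined (Set.Ico 2 i) v w ∨
    ∃ a b, G.Joined (Set.Ico 2 i) v a ∧ G.D i a b ∧ G.Joined (Set.Ico 2 i) b w
  /-- The condition that takes the place of the fourth axiom (then empty) when `n = 4`. -/
  ax4_degree_four : n = 4 → ∀ (i : ℕ) (v : V), 2 < i → i < n →
    (∃ w, ∃ j ∈ ({i - 1, i} : Set ℕ), G.D j v w) →
    G.ComponentIs {i - 1, i} v (path3 i) ∨ G.ComponentIs {i - 1, i} v (double2 i)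
  ax5 : ∀ (i j : ℕ) (v u w : V), 3 ≤ |(i : ℤ) - (j : ℤ)| → G.D i v u → G.D j u w →
    ∃ x, G.D j v x ∧ G.D i x w

end SignedColoredGraph

namespace DirectedColoredGraph

variable {n : ℕ} {V : Type u} (X : DirectedColoredGraph n V)

open Classical in
/-- The signed, coloured graph `G(X)`. Here `D i v w` says that `D_i(v)` is defined and
equal to `w`. -/
noncomputable def toSigned : SignedColoredGraph n X.zeroOneVertices where
  sign v i := if X.eps v i = 1 then 1 else -1
  D i v w :=
    (X.eps v i = 1 ∧ X.eps v (i - 1) = 0 ∧ X.IsFFEE i (i - 1) v w) ∨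
    (X.eps v i = 0 ∧ X.eps v (i - 1) = 1 ∧ X.IsFFEE (i - 1) i v w)
  color_mem := by
    rintro i v w (⟨-, -, a, b, c, h1, h2, -, -⟩ | ⟨-, -, a, b, c, h1, h2, -, -⟩)
    · have := X.color_mem h1
      have := X.color_mem h2
      omega
    · have := X.color_mem h1
      have := X.color_mem h2
      omega

end DirectedColoredGraph

-- A regular graph is a type A crystal in Stembridge's sense, and the proof works in one component
-- at a time, that of a vertex `v` of weight zero. Write the weights of this component as integer
-- vectors of length `m` with sum zero. They are symmetric under permutations and closed under unit
-- transfers from a larger entry to a smaller one. If some weight had an entry ≥ 2 and an entry ≤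
-- -2, such transfers would lead down to twice a root. A string through that weight then contains a
-- vertex of weight zero at which `e` is at least 2, against the hypothesis (`not_two_sided`).
-- Comparison with the highest weight shows that, possibly after reversing all edges, every entry of
-- every weight is at least -1 (`weights_one_sided`). Adding 1 to each entry of the highest weight
-- gives a partition `lam` of `m`.
--
-- By Stembridge's uniqueness theorem (`exists_partialIso`) a component with a highest weight vertex
-- is determined by its highest weight, so a concrete model suffices. Tableaux form iterated tensor
-- products of one-row crystals. The tensor product again satisfies the axioms (`tensor`), and
-- semistandardness and shape are preserved by the operators. Vertices of weight zero thereby become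
-- standard tableaux of shape `lam`, encoded by the word `r` with `r k` the row of the letter `k`.
-- The value of ε at `i` is 1 exactly when `r (i + 1) ≤ r i`, and `D_i` becomes Haiman's elementary
-- dual equivalence on the letters `i - 1`, `i`, `i + 1` (`ffee_threeCols`). The reversed crystal
-- yields the same moves on the same words, so the passage to the dual costs nothing.
--
-- It remains to check the axioms on words (`GraphModel`). Axioms 1, 2, 3 and 5 are comparisons of a
-- few neighbouring letters. For the components of three consecutive colours, the crystal is
-- restricted to four consecutive colours; the model then consists of words of length five, and
-- there are finitely many. The path condition is proved by induction on the size, by moving the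
-- largest letter between two corners (`fewMoves`).

universe v

/-! ### Abstract crystals, their duals and restrictions -/

/-- An abstract regular (simply laced, type A) crystal with colours in `C`: `edge i x y` means
`y = F_i x`, and `e i x`, `f i x` count how often `E_i`, `F_i` can be applied to `x`. -/
structure Stem (C : Set ℕ) (V : Type u) where
  edge : ℕ → V → V → Prop
  e : ℕ → V → ℕ
  f : ℕ → V → ℕ
  mem : ∀ {i x y}, edge i x y → i ∈ C
  inj : ∀ {i x y z}, edge i y x → edge i z x → y = z
  det : ∀ {i x y z}, edge i x y → edge i x z → y = z
  e_edge : ∀ {i x y}, edge i x y → e i y = e i x + 1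
  f_edge : ∀ {i x y}, edge i x y → f i x = f i y + 1
  e_pos : ∀ {i x}, 0 < e i x → ∃ y, edge i y x
  f_pos : ∀ {i x}, 0 < f i x → ∃ y, edge i x y
  near : ∀ {i j a x}, j ∈ C → (j = i + 1 ∨ i = j + 1) → edge i a x →
    (e j a = e j x + 1 ∧ f j a = f j x) ∨ (e j a = e j x ∧ f j x = f j a + 1)
  far : ∀ {i j a x}, j ∈ C → j ≠ i → ¬ (j = i + 1 ∨ i = j + 1) → edge i a x →
    e j a = e j x ∧ f j a = f j x
  P5E : ∀ {i j x a b}, i ≠ j → edge i a x → edge j b x → e j a = e j x →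
    ∃ y, edge i y b ∧ edge j y a ∧ f i y = f i a
  P5F : ∀ {i j x a b}, i ≠ j → edge i x a → edge j x b → f j a = f j x →
    ∃ y, edge i b y ∧ edge j a y ∧ e i y = e i a
  P6E : ∀ {i j x a b}, i ≠ j → edge i a x → edge j b x →
    e j a = e j x + 1 → e i b = e i x + 1 →
    ∃ a₁ a' b₁ b' y, edge j a₁ a ∧ edge j a' a₁ ∧ edge i y a' ∧
      edge i b₁ b ∧ edge i b' b₁ ∧ edge j y b' ∧ f j a' = f j y + 1 ∧ f i b' = f i y + 1
  P6F : ∀ {i j x a b}, i ≠ j → edge i x a → edge j x b →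
    f j a = f j x + 1 → f i b = f i x + 1 →
    ∃ a₁ a' b₁ b' y, edge j a a₁ ∧ edge j a₁ a' ∧ edge i a' y ∧
      edge i b b₁ ∧ edge i b₁ b' ∧ edge j b' y ∧ e j a' = e j y + 1 ∧ e i b' = e i y + 1

namespace Stem

variable {C : Set ℕ} {V : Type u}

/-- The crystal with all edges reversed. -/
def dual (S : Stem C V) : Stem C V where
  edge i x y := S.edge i y x
  e := S.f
  f := S.e
  mem := S.mem
  inj := S.det
  det := S.inj
  e_edge := S.f_edge
  f_edge := S.e_edge
  e_pos := S.f_pos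
  f_pos := S.e_pos
  near hj hij h := by rcases S.near hj hij h with h | h <;> omega
  far hj hne hij h := by rcases S.far hj hne hij h with ⟨h1, h2⟩; omega
  P5E := S.P5F
  P5F := S.P5E
  P6E := S.P6F
  P6F := S.P6E

open Classical in
/-- Restriction to the colours `C'`, renumbered by the shift `j ↦ j + s`. -/
noncomputable def pull (S : Stem C V) (s : ℕ) (C' : Set ℕ) (hC : ∀ j ∈ C', j + s ∈ C) :
    Stem C' V where
  edge i x y := i ∈ C' ∧ S.edge (i + s) x y
  e i x := if i ∈ C' then S.e (i + s) x else 0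
  f i x := if i ∈ C' then S.f (i + s) x else 0
  mem h := h.1
  inj h h' := S.inj h.2 h'.2
  det h h' := S.det h.2 h'.2
  e_edge h := by simp only [h.1, if_true]; exact S.e_edge h.2
  f_edge h := by simp only [h.1, if_true]; exact S.f_edge h.2
  e_pos {i x} h := by
    split_ifs at h with hi
    · obtain ⟨y, hy⟩ := S.e_pos h
      exact ⟨y, hi, hy⟩
    · omega
  f_pos {i x} h := by
    split_ifs at h with hi
    · obtain ⟨y, hy⟩ := S.f_pos h
      exact ⟨y, hi, hy⟩
    · omega
  near hj hij h := by
    simp only [hj, if_true]; exact S.near (hC _ hj) (by omega) h.2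
  far hj hne hij h := by
    simp only [hj, if_true]; exact S.far (hC _ hj) (by omega) (by omega) h.2
  P5E hne h h' he := by
    simp only [h.1, h'.1, if_true] at he ⊢
    obtain ⟨y, h1, h2, h3⟩ := S.P5E (by omega) h.2 h'.2 he
    exact ⟨y, ⟨trivial, h1⟩, ⟨trivial, h2⟩, h3⟩
  P5F hne h h' he := by
    simp only [h.1, h'.1, if_true] at he ⊢
    obtain ⟨y, h1, h2, h3⟩ := S.P5F (by omega) h.2 h'.2 he
    exact ⟨y, ⟨trivial, h1⟩, ⟨trivial, h2⟩, h3⟩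
  P6E hne h h' he he' := by
    simp only [h.1, h'.1, if_true, true_and] at he he' ⊢
    exact S.P6E (by omega) h.2 h'.2 he he'
  P6F hne h h' he he' := by
    simp only [h.1, h'.1, if_true, true_and] at he he' ⊢
    exact S.P6F (by omega) h.2 h'.2 he he'

end Stem

/-! ### From regular graphs to abstract crystals -/

namespace DirectedColoredGraph

variable {n : ℕ} {V : Type u} {X : DirectedColoredGraph n V}

/-- The graph with all edges reversed. -/
def reverse (X : DirectedColoredGraph n V) : DirectedColoredGraph n V where
  edge i x y := X.edge i y x
  color_mem := X.color_mem

theorem monoPath_succ_right {i k : ℕ} {x y : V} :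
    X.MonoPath i (k + 1) x y ↔ ∃ z, X.MonoPath i k x z ∧ X.edge i z y := by
  induction k generalizing x with
  | zero => simp [MonoPath]
  | succ k ih =>
    constructor
    · rintro ⟨z, hz, h⟩
      obtain ⟨w, hw, h'⟩ := ih.1 h
      exact ⟨w, ⟨z, hz, hw⟩, h'⟩
    · rintro ⟨w, ⟨z, hz, hw⟩, h'⟩
      exact ⟨z, hz, ih.2 ⟨w, hw, h'⟩⟩

theorem monoPath_reverse {i k : ℕ} {x y : V} :
    X.reverse.MonoPath i k x y ↔ X.MonoPath i k y x := by
  induction k generalizing x y with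
  | zero => exact eq_comm
  | succ k ih =>
    rw [monoPath_succ_right]
    exact exists_congr fun z => by rw [ih]; exact and_comm

/-- The largest length of a path of colour `i` starting at `x`. -/
noncomputable def fLen (X : DirectedColoredGraph n V) (i : ℕ) (x : V) : ℕ :=
  sSup {k : ℕ | ∃ y, X.MonoPath i k x y}

/-- Paths of unbounded length can be truncated to every length. Endpoints are unique because edges
are deterministic, so the truncations fit together into one infinite path. -/
theorem bddAbove_monoPath {i : ℕ}
    (hfin : ¬ ∃ s : ℕ → V, ∀ k, X.edge i (s k) (s (k + 1)))
    (hdet : ∀ x y z, X.edge i x y → X.edge i x z → y = z) (x : V) :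
    BddAbove {k : ℕ | ∃ y, X.MonoPath i k x y} := by
  by_contra hb
  rw [not_bddAbove_iff] at hb
  have hall : ∀ k, ∃ y, X.MonoPath i k x y := by
    intro k
    obtain ⟨l, ⟨y, hy⟩, hl⟩ := hb k
    clear hb
    induction hl generalizing y with
    | refl =>
      obtain ⟨z, hz, -⟩ := monoPath_succ_right.1 hy
      exact ⟨z, hz⟩
    | step _ ih =>
      obtain ⟨z, hz, -⟩ := monoPath_succ_right.1 hy
      exact ih z hz
  have huniq : ∀ k y z, X.MonoPath i k x y → X.MonoPath i k x z → y = z := by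
    intro k
    induction k with
    | zero => rintro y z rfl rfl; rfl
    | succ k ih =>
      intro y z hy hz
      obtain ⟨y', hy', h1⟩ := monoPath_succ_right.1 hy
      obtain ⟨z', hz', h2⟩ := monoPath_succ_right.1 hz
      obtain rfl := ih _ _ hy' hz'
      exact hdet _ _ _ h1 h2
  choose s hs using hall
  refine hfin ⟨s, fun k => ?_⟩
  obtain ⟨z, hz, h⟩ := monoPath_succ_right.1 (hs (k + 1))
  rwa [huniq _ _ _ (hs k) hz]

theorem fLen_edge {i : ℕ}
    (hfin : ¬ ∃ s : ℕ → V, ∀ k, X.edge i (s k) (s (k + 1)))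
    (hdet : ∀ x y z, X.edge i x y → X.edge i x z → y = z) {x y : V} (h : X.edge i x y) :
    X.fLen i x = X.fLen i y + 1 := by
  have hx := bddAbove_monoPath hfin hdet x
  have hy := bddAbove_monoPath hfin hdet y
  apply le_antisymm
  · refine csSup_le ⟨0, x, rfl⟩ ?_
    rintro k ⟨z, hz⟩
    cases k with
    | zero => omega
    | succ k =>
      obtain ⟨w, hw, hwz⟩ := hz
      obtain rfl := hdet _ _ _ h hw
      exact Nat.succ_le_succ (le_csSup hy ⟨z, hwz⟩)
  · obtain ⟨z, hz⟩ : X.fLen i y ∈ {k : ℕ | ∃ z, X.MonoPath i k y z} :=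
      Nat.sSup_mem ⟨0, y, rfl⟩ hy
    exact le_csSup hx ⟨z, y, h, hz⟩

theorem exists_edge_of_fLen_pos {i : ℕ} {x : V} (h : 0 < X.fLen i x) : ∃ y, X.edge i x y := by
  by_contra hno
  have : {k : ℕ | ∃ y, X.MonoPath i k x y} ⊆ {0} := by
    rintro k ⟨y, hy⟩
    cases k with
    | zero => rfl
    | succ k =>
      obtain ⟨z, hz, -⟩ := hy
      exact (hno ⟨z, hz⟩).elim
  have h0 : X.fLen i x ≤ 0 := csSup_le ⟨0, x, rfl⟩ fun k hk => (this hk).le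
  omega

theorem eps_eq (x : V) (i : ℕ) : X.eps x i = X.fLen i x := rfl

theorem del_eq (x : V) (i : ℕ) : X.del x i = -(X.reverse.fLen i x : ℤ) := by
  simp only [del, fLen, monoPath_reverse]

/-- The abstract crystal of a regular graph. -/
noncomputable def IsRegular.stem (hX : X.IsRegular) : Stem {i | 1 ≤ i ∧ i < n} V where
  edge := X.edge
  e := X.reverse.fLen
  f := X.fLen
  mem := X.color_mem
  inj h h' := (hX.P2 _ _ _ _).1 h h'
  det h h' := (hX.P2 _ _ _ _).2 h h'
  e_edge {i _ _} h := fLen_edge (X := X.reverse) (hX.P1 i).2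
    (fun x y z => (hX.P2 i x y z).1) h
  f_edge {i _ _} h := fLen_edge (hX.P1 i).1 (fun x y z => (hX.P2 i x y z).2) h
  e_pos h := exists_edge_of_fLen_pos (X := X.reverse) h
  f_pos h := exists_edge_of_fLen_pos h
  -- By `P3` the two changes add up to -1 and by `P4` both are nonpositive, so exactly one of them
  -- is -1. Since `del` is `-e`, a drop of `del` is a rise of `e`.
  near {i j a x} hj hij h := by
    have h3 := hX.P3 i j x a hj.1 hj.2 h
    have h4 := hX.P4 i j x a hj.1 hj.2 (by omega) h
    rw [if_neg (by omega), if_pos hij] at h3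
    simp only [del_eq, eps_eq] at h3 h4
    omega
  far {i j a x} hj hne hij h := by
    have h3 := hX.P3 i j x a hj.1 hj.2 h
    have h4 := hX.P4 i j x a hj.1 hj.2 hne h
    rw [if_neg hne, if_neg hij] at h3
    simp only [del_eq, eps_eq] at h3 h4
    omega
  P5E {i j x a b} hne h h' he := by
    obtain ⟨y, h1, h2, h3⟩ := hX.P5_E i j x a b hne h h' (by simp only [del_eq]; omega)
    simp only [eps_eq] at h3
    exact ⟨y, h1, h2, by omega⟩
  P5F {i j x a b} hne h h' he := by
    obtain ⟨y, h1, h2, h3⟩ := hX.P5_F i j x a b hne h h' (by simp only [eps_eq]; omega)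
    simp only [del_eq] at h3
    exact ⟨y, h1, h2, by omega⟩
  P6E {i j x a b} hne h h' he he' := by
    obtain ⟨a₁, a', b₁, b', y, h1, h2, h3, h4, h5, h6, h7, h8⟩ :=
      hX.P6_E i j x a b hne h h' (by simp only [del_eq]; omega) (by simp only [del_eq]; omega)
    simp only [eps_eq] at h7 h8
    exact ⟨a₁, a', b₁, b', y, h1, h2, h3, h4, h5, h6, by omega, by omega⟩
  P6F {i j x a b} hne h h' he he' := by
    obtain ⟨a₁, a', b₁, b', y, h1, h2, h3, h4, h5, h6, h7, h8⟩ :=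
      hX.P6_F i j x a b hne h h' (by simp only [eps_eq]; omega) (by simp only [eps_eq]; omega)
    simp only [del_eq] at h7 h8
    exact ⟨a₁, a', b₁, b', y, h1, h2, h3, h4, h5, h6, by omega, by omega⟩

end DirectedColoredGraph

/-! ### Tensor products of crystals -/

namespace Stem

variable {C : Set ℕ} {V : Type u} {W : Type v}

/-- Two noncommuting raising edges of one vertex cannot both lower `f`. -/
theorem not_both_lower (S : Stem C V) {i j : ℕ} (hne : i ≠ j) {x a b : V} (ha : S.edge i a x)
    (hb : S.edge j b x) (h1 : S.e j a = S.e j x) : S.f i b = S.f i x := by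
  -- Around the commuting square, `f i b = f i t - 1 = f i a - 1 = f i x`.
  obtain ⟨t, h3, h4, h5⟩ := S.P5E hne ha hb h1
  have := S.f_edge h3
  have := S.f_edge ha
  omega

/-- If `z = E_j y` increases `e_i` then `E_i z` does not increase `e_j`. -/
theorem second_lower (S : Stem C V) {i j : ℕ} (hij : j = i + 1 ∨ i = j + 1) {y z s : V}
    (h : S.edge j z y) (he : S.e i z = S.e i y + 1) (hs : S.edge i s z) :
    S.e j s = S.e j z ∧ S.f j z = S.f j s + 1 := by
  rcases S.near (S.mem h) hij hs with ⟨h1, h2⟩ | h1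
  -- If `E_i z` raised `e_j`, then `f_j` would agree at `s` and `z`, and `P5F` at `s` would close a
  -- square with bottom corner `y`. That square gives `e i y = e i z`, against `he`.
  · exfalso
    have hf := S.f_edge h
    obtain ⟨s', hs'⟩ := S.f_pos (i := j) (x := s) (by omega)
    obtain ⟨t, h3, h4, h5⟩ := S.P5F (by omega) hs hs' h2.symm
    obtain rfl := S.det h4 h
    omega
  · exact h1

/-- If `z = E_j y` increases `e_i` then so does `E_j z`. -/
theorem raise_raise (S : Stem C V) {i j : ℕ} (hij : j = i + 1 ∨ i = j + 1) {y z z' : V}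
    (h : S.edge j z y) (he : S.e i z = S.e i y + 1) (hz : S.edge j z' z) :
    S.e i z' = S.e i z + 1 ∧ S.f i z' = S.f i z := by
  obtain ⟨s, hs⟩ := S.e_pos (i := i) (x := z) (by omega)
  have h1 := S.second_lower hij h he hs
  have h2 := S.not_both_lower (by omega) hs hz h1.1
  rcases S.near (S.mem hs) (i := j) (by omega) hz with h3 | h3 <;> omega

variable (A : Stem C V) (B : Stem C W)

/-- Edges of the tensor product. -/
def tEdge (i : ℕ) (p q : V × W) : Prop :=
  (A.edge i p.1 q.1 ∧ p.2 = q.2 ∧ B.e i p.2 < A.f i p.1) ∨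
  (p.1 = q.1 ∧ B.edge i p.2 q.2 ∧ A.f i p.1 ≤ B.e i p.2)

/-- `e` on the tensor product. -/
def tE (i : ℕ) (p : V × W) : ℕ := A.e i p.1 + (B.e i p.2 - A.f i p.1)

/-- `f` on the tensor product. -/
def tF (i : ℕ) (p : V × W) : ℕ := B.f i p.2 + (A.f i p.1 - B.e i p.2)

variable {A B}

/-- Reversing the edges exchanges the two factors, so every statement about raising in a tensor
product yields the one about lowering. -/
theorem tEdge_swap {i : ℕ} {p q : V × W} :
    tEdge B.dual A.dual i p.swap q.swap ↔ tEdge A B i q p := by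
  obtain ⟨a, b⟩ := p
  obtain ⟨a', b'⟩ := q
  simp only [tEdge, dual, Prod.swap]
  constructor
  · rintro (⟨h, rfl, h'⟩ | ⟨rfl, h, h'⟩)
    · have := B.e_edge h
      exact Or.inr ⟨rfl, h, by omega⟩
    · have := A.f_edge h
      exact Or.inl ⟨h, rfl, by omega⟩
  · rintro (⟨h, rfl, h'⟩ | ⟨rfl, h, h'⟩)
    · have := A.f_edge h
      exact Or.inr ⟨rfl, h, by omega⟩
    · have := B.e_edge h
      exact Or.inl ⟨h, rfl, by omega⟩

theorem tEdge_left {i : ℕ} {a' a : V} {b : W} (h : A.edge i a' a) (hb : B.e i b ≤ A.f i a) :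
    tEdge A B i (a', b) (a, b) :=
  Or.inl ⟨h, rfl, by have := A.f_edge h; simp only; omega⟩

theorem tEdge_right {i : ℕ} {a : V} {b' b : W} (h : B.edge i b' b) (hb : A.f i a < B.e i b) :
    tEdge A B i (a, b') (a, b) :=
  Or.inr ⟨rfl, h, by have := B.e_edge h; simp only; omega⟩

theorem tEdge_cases {i : ℕ} {q : V × W} {a : V} {b : W} (h : tEdge A B i q (a, b)) :
    (∃ a', q = (a', b) ∧ A.edge i a' a ∧ B.e i b ≤ A.f i a) ∨
    (∃ b', q = (a, b') ∧ B.edge i b' b ∧ A.f i a < B.e i b) := by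
  obtain ⟨a', b'⟩ := q
  rcases h with ⟨h, h1, h2⟩ | ⟨h1, h, h2⟩ <;> simp only at h h1 h2 <;> subst h1
  · have := A.f_edge h
    exact Or.inl ⟨a', rfl, h, by omega⟩
  · have := B.e_edge h
    exact Or.inr ⟨b', rfl, h, by omega⟩

theorem tEdge_e {i : ℕ} {p q : V × W} (h : tEdge A B i p q) : tE A B i q = tE A B i p + 1 := by
  obtain ⟨a, b⟩ := q
  rcases tEdge_cases h with ⟨a', rfl, h1, h2⟩ | ⟨b', rfl, h1, h2⟩
  · have := A.f_edge h1
    have := A.e_edge h1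
    simp only [tE]; omega
  · have := B.e_edge h1
    simp only [tE]; omega

theorem tEdge_f {i : ℕ} {p q : V × W} (h : tEdge A B i p q) : tF A B i p = tF A B i q + 1 := by
  obtain ⟨a, b⟩ := q
  rcases tEdge_cases h with ⟨a', rfl, h1, h2⟩ | ⟨b', rfl, h1, h2⟩
  · have := A.f_edge h1
    simp only [tF]; omega
  · have := B.e_edge h1
    have := B.f_edge h1
    simp only [tF]; omega

theorem tEdge_inj {i : ℕ} {x y z : V × W} (h : tEdge A B i y x) (h' : tEdge A B i z x) :
    y = z := by
  obtain ⟨a, b⟩ := x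
  rcases tEdge_cases h with ⟨a', rfl, h1, h2⟩ | ⟨b', rfl, h1, h2⟩ <;>
  rcases tEdge_cases h' with ⟨a'', rfl, h3, h4⟩ | ⟨b'', rfl, h3, h4⟩
  · rw [A.inj h1 h3]
  · omega
  · omega
  · rw [B.inj h1 h3]

theorem tE_pos {i : ℕ} {x : V × W} (h : 0 < tE A B i x) : ∃ y, tEdge A B i y x := by
  obtain ⟨a, b⟩ := x
  simp only [tE] at h
  by_cases hb : A.f i a < B.e i b
  · obtain ⟨b', hb'⟩ := B.e_pos (i := i) (x := b) (by omega)
    exact ⟨_, tEdge_right hb' hb⟩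
  · obtain ⟨a', ha'⟩ := A.e_pos (i := i) (x := a) (by omega)
    exact ⟨_, tEdge_left ha' (by omega)⟩

theorem tEdge_near {i j : ℕ} {p q : V × W} (hj : j ∈ C) (hij : j = i + 1 ∨ i = j + 1)
    (h : tEdge A B i p q) :
    (tE A B j p = tE A B j q + 1 ∧ tF A B j p = tF A B j q) ∨
    (tE A B j p = tE A B j q ∧ tF A B j q = tF A B j p + 1) := by
  obtain ⟨a, b⟩ := q
  simp only [tE, tF]
  rcases tEdge_cases h with ⟨a', rfl, h1, h2⟩ | ⟨b', rfl, h1, h2⟩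
  · rcases A.near hj hij h1 with h3 | h3 <;> simp only <;> omega
  · rcases B.near hj hij h1 with h3 | h3 <;> simp only <;> omega

theorem tEdge_far {i j : ℕ} {p q : V × W} (hj : j ∈ C) (hne : j ≠ i)
    (hij : ¬ (j = i + 1 ∨ i = j + 1)) (h : tEdge A B i p q) :
    tE A B j p = tE A B j q ∧ tF A B j p = tF A B j q := by
  obtain ⟨a, b⟩ := q
  simp only [tE, tF]
  rcases tEdge_cases h with ⟨a', rfl, h1, h2⟩ | ⟨b', rfl, h1, h2⟩
  · have := A.far hj hne hij h1
    simp only [this, and_self]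
  · have := B.far hj hne hij h1
    simp only [this, and_self]

/-- A uniform form of `near` and `far`. -/
theorem step (S : Stem C V) {i j : ℕ} {a x : V} (hj : j ∈ C) (hne : i ≠ j) (h : S.edge i a x) :
    ((S.e j a = S.e j x + 1 ∧ S.f j a = S.f j x ∧ (j = i + 1 ∨ i = j + 1)) ∨
    (S.e j a = S.e j x ∧ S.f j x = S.f j a + 1 ∧ (j = i + 1 ∨ i = j + 1))) ∨
    (S.e j a = S.e j x ∧ S.f j x = S.f j a ∧ ¬ (j = i + 1 ∨ i = j + 1)) := by
  by_cases hij : j = i + 1 ∨ i = j + 1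
  · rcases S.near hj hij h with h | h <;> simp [h, hij]
  · have := S.far hj (Ne.symm hne) hij h
    simp [this, hij]

/-- When both raises act on the same factor, the hypothesis on `tE` forces the hypothesis of `P5E`
in that factor. When they act on different factors they commute, because `he` keeps each raise from
changing the factor on which the other one acts. -/
theorem tEdge_P5 {i j : ℕ} {x a b : V × W} (hne : i ≠ j) (ha : tEdge A B i a x)
    (hb : tEdge A B j b x) (he : tE A B j a = tE A B j x) :
    ∃ y, tEdge A B i y b ∧ tEdge A B j y a ∧ tF A B i y = tF A B i a := by
  obtain ⟨x, y⟩ := x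
  rcases tEdge_cases ha with ⟨x1, rfl, h1, h1'⟩ | ⟨y1, rfl, h1, h1'⟩ <;>
  rcases tEdge_cases hb with ⟨x2, rfl, h2, h2'⟩ | ⟨y2, rfl, h2, h2'⟩ <;>
  simp only [tE] at he
  · have hs := A.step (A.mem h2) hne h1
    obtain ⟨t, h3, h4, h5⟩ := A.P5E hne h1 h2 (by omega)
    have := A.f_edge h3
    have := A.f_edge h1
    refine ⟨(t, y), tEdge_left h3 (by omega), tEdge_left h4 (by omega), ?_⟩
    simp only [tF]; omega
  · have hs := A.step (B.mem h2) hne h1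
    have hs' := B.step (A.mem h1) hne.symm h2
    have := A.f_edge h1
    refine ⟨(x1, y2), tEdge_left h1 (by omega), tEdge_right h2 (by omega), ?_⟩
    simp only [tF]; omega
  · have hs := B.step (A.mem h2) hne h1
    have hs' := A.step (B.mem h1) hne.symm h2
    have := B.e_edge h1
    refine ⟨(x2, y1), tEdge_right h1 (by omega), tEdge_left h2 (by omega), ?_⟩
    simp only [tF]; omega
  · have hs := B.step (B.mem h2) hne h1
    obtain ⟨t, h3, h4, h5⟩ := B.P5E hne h1 h2 (by omega)
    have := B.e_edge h3
    have := B.e_edge h1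
    have hs' := B.step (B.mem h1) hne.symm h2
    have := B.e_edge h4
    refine ⟨(x, t), tEdge_right h3 (by omega), tEdge_right h4 (by omega), ?_⟩
    have := B.step (B.mem h1) hne.symm h4
    simp only [tF]; omega

/-- The conclusion of the axiom `P6E` in the tensor product. -/
def TensorHexagon (A : Stem C V) (B : Stem C W) (i j : ℕ) (a b : V × W) : Prop :=
  ∃ a₁ a' b₁ b' y, tEdge A B j a₁ a ∧ tEdge A B j a' a₁ ∧ tEdge A B i y a' ∧
    tEdge A B i b₁ b ∧ tEdge A B i b' b₁ ∧ tEdge A B j y b' ∧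
    tF A B j a' = tF A B j y + 1 ∧ tF A B i b' = tF A B i y + 1

theorem TensorHexagon.symm {i j : ℕ} {a b : V × W} (h : TensorHexagon A B j i b a) :
    TensorHexagon A B i j a b := by
  obtain ⟨a₁, a', b₁, b', y, h1, h2, h3, h4, h5, h6, h7, h8⟩ := h
  exact ⟨b₁, b', a₁, a', y, h4, h5, h6, h1, h2, h3, h8, h7⟩

/-- In `A` alone the two raises commute. In the tensor product they do not: `E_j` lowers `f_i` on
the left, and since `B.e i y = A.f i x` this uncovers a letter of the right factor, on which the
next `E_i` acts. -/
theorem tensorHexagon_left_left {i j : ℕ} (hij : j = i + 1 ∨ i = j + 1) {x x1 x2 : V} {y : W}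
    (h1 : A.edge i x1 x) (h2 : A.edge j x2 x) (he : A.e j x1 = A.e j x + 1)
    (he' : A.e i x2 = A.e i x) (hy : B.e i y = A.f i x) (hy' : B.e j y ≤ A.f j x) :
    TensorHexagon A B i j (x1, y) (x2, y) := by
  have h1e := A.e_edge h1
  have h1f := A.f_edge h1
  have h2e := A.e_edge h2
  have h2f := A.f_edge h2
  have n1 := A.near (A.mem h2) hij h1
  have n2 := A.near (A.mem h1) (j := i) (by omega) h2
  obtain ⟨t, h3, h4, h5⟩ := A.P5E (by omega) h2 h1 he'
  have h3e := A.e_edge h3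
  have h4f := A.f_edge h4
  have h3f := A.f_edge h3
  obtain ⟨t', h6⟩ := A.e_pos (i := j) (x := t) (by omega)
  obtain ⟨y1, h7⟩ := B.e_pos (i := i) (x := y) (by omega)
  have h6f := A.f_edge h6
  have h7e := B.e_edge h7
  have h7f := B.f_edge h7
  -- The second `E_j` must lower `f_i` as well. Otherwise `P5F` at `t'` closes a square with bottom
  -- corner `x2`, which makes `e j x2 = e j t`, whereas the values along `h1`, `h2` and `h3` differ
  -- by one.
  have key : A.f i t = A.f i t' + 1 := by
    rcases A.near (A.mem h1) (j := i) (by omega) h6 with n4 | n4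
    · exfalso
      obtain ⟨q, h8⟩ := A.f_pos (i := i) (x := t') (by omega)
      obtain ⟨p, h9, h10, h11⟩ := A.P5F (by omega) h6 h8 n4.2.symm
      obtain rfl := A.det h10 h4
      omega
    · exact n4.2
  have hj1 : B.e j y1 = B.e j y + 1 ∧ B.f j y1 = B.f j y ∨
      B.e j y1 = B.e j y ∧ B.f j y = B.f j y1 + 1 := B.near (A.mem h2) hij h7
  refine ⟨(t, y), (t', y), (x2, y1), (t, y1), (t', y1), tEdge_left h3 (by omega),
    tEdge_left h6 (by omega), tEdge_right h7 (by omega), tEdge_right h7 (by omega),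
    tEdge_left h4 (by omega), tEdge_left h6 (by omega), ?_, ?_⟩ <;>
  simp only [tF] <;> omega

theorem tensorHexagon_left_right {i j : ℕ} (hij : j = i + 1 ∨ i = j + 1) {x x1 : V} {y z : W}
    (h1 : A.edge i x1 x) (h2 : B.edge j z y) (he : B.e i z = B.e i y + 1)
    (hy : B.e i y = A.f i x) (hy' : A.f j x < B.e j y) :
    TensorHexagon A B i j (x1, y) (x, z) := by
  have h1e := A.e_edge h1
  have h1f := A.f_edge h1
  have h2e := B.e_edge h2
  have h2f := B.f_edge h2
  have n1 := A.near (B.mem h2) hij h1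
  obtain ⟨w, h3⟩ := B.e_pos (i := i) (x := z) (by omega)
  have h4 := B.second_lower hij h2 he h3
  have h3e := B.e_edge h3
  have h3f := B.f_edge h3
  have n2 := B.near (A.mem h1) (j := i) (by omega) h2
  -- The case distinction is whether the second `E_j` after `E_i` still acts on the right factor or
  -- has moved to the left one.
  by_cases hc : A.f j x1 < B.e j z
  · obtain ⟨z', h5⟩ := B.e_pos (i := j) (x := z) (by omega)
    have h6 := B.raise_raise hij h2 he h5
    obtain ⟨t, h7, h8, h9⟩ := B.P5E (by omega) h3 h5 h4.1
    have h5e := B.e_edge h5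
    have h5f := B.f_edge h5
    have h7e := B.e_edge h7
    have h7f := B.f_edge h7
    have h8e := B.e_edge h8
    have h8f := B.f_edge h8
    refine ⟨(x1, z), (x1, z'), (x, w), (x1, w), (x1, t), tEdge_right h2 (by omega),
      tEdge_right h5 (by omega), tEdge_right h7 (by omega), tEdge_right h3 (by omega),
      tEdge_left h1 (by omega), tEdge_right h8 (by omega), ?_, ?_⟩ <;>
    simp only [tF] <;> omega
  · obtain ⟨x', h5⟩ := A.e_pos (i := j) (x := x1) (by omega)
    have h6 := A.second_lower (i := j) (j := i) (by omega) h1 (by omega) h5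
    have h5e := A.e_edge h5
    have h5f := A.f_edge h5
    refine ⟨(x1, z), (x', z), (x, w), (x1, w), (x', w), tEdge_right h2 (by omega),
      tEdge_left h5 (by omega), tEdge_right h3 (by omega), tEdge_right h3 (by omega),
      tEdge_left h1 (by omega), tEdge_left h5 (by omega), ?_, ?_⟩ <;>
    simp only [tF] <;> omega

/-- When both raises act on the left factor, each increase of `tE` has one of two causes: `e` grows
in `A`, or `f` drops in `A` and uncovers a letter on the right. Two causes of the first kind give
`P6E` in `A`, mixed causes give `tensorHexagon_left_left`, and two of the second kind contradict
`not_both_lower`. On the right factor only the first cause occurs. -/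
theorem tEdge_P6 {i j : ℕ} {x a b : V × W} (hij : j = i + 1 ∨ i = j + 1) (ha : tEdge A B i a x)
    (hb : tEdge A B j b x) (he : tE A B j a = tE A B j x + 1)
    (he' : tE A B i b = tE A B i x + 1) : TensorHexagon A B i j a b := by
  obtain ⟨x, y⟩ := x
  have hji : i = j + 1 ∨ j = i + 1 := by omega
  rcases tEdge_cases ha with ⟨x1, rfl, h1, h1'⟩ | ⟨y1, rfl, h1, h1'⟩ <;>
  rcases tEdge_cases hb with ⟨x2, rfl, h2, h2'⟩ | ⟨y2, rfl, h2, h2'⟩ <;>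
  simp only [tE] at he he'
  · have n1 := A.near (A.mem h2) hij h1
    have n2 := A.near (A.mem h1) hji h2
    rcases n1 with n1 | n1 <;> rcases n2 with n2 | n2
    · obtain ⟨a₁, a', b₁, b', t, h3, h4, h5, h6, h7, h8, h9, h10⟩ :=
        A.P6E (by omega) h1 h2 n1.1 n2.1
      have := A.f_edge h1
      have := A.f_edge h2
      have := A.f_edge h3
      have := A.f_edge h4
      have := A.f_edge h5
      have := A.f_edge h6
      have := A.f_edge h7
      have := A.f_edge h8
      refine ⟨(a₁, y), (a', y), (b₁, y), (b', y), (t, y), tEdge_left h3 (by omega),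
        tEdge_left h4 (by omega), tEdge_left h5 (by omega), tEdge_left h6 (by omega),
        tEdge_left h7 (by omega), tEdge_left h8 (by omega), ?_, ?_⟩ <;>
      simp only [tF] <;> omega
    · exact tensorHexagon_left_left hij h1 h2 n1.1 n2.1 (by omega) h2'
    · exact (tensorHexagon_left_left hji h2 h1 n2.1 n1.1 (by omega) h1').symm
    · have := A.not_both_lower (by omega) h1 h2 n1.1
      omega
  · have n1 := B.near (A.mem h1) hji h2
    exact tensorHexagon_left_right hij h1 h2 (by omega) (by omega) h2'
  · have n1 := B.near (A.mem h2) hij h1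
    exact (tensorHexagon_left_right hji h2 h1 (by omega) (by omega) h1').symm
  · have n1 := B.near (B.mem h2) hij h1
    have n2 := B.near (B.mem h1) hji h2
    obtain ⟨a₁, a', b₁, b', t, h3, h4, h5, h6, h7, h8, h9, h10⟩ :=
      B.P6E (by omega) h1 h2 (by omega) (by omega)
    have n3 := B.near (B.mem h2) hij h5
    have n4 := B.near (B.mem h1) hji h8
    have := B.e_edge h1
    have := B.e_edge h2
    have := B.e_edge h3
    have := B.e_edge h4
    have := B.e_edge h5
    have := B.e_edge h6
    have := B.e_edge h7
    have := B.e_edge h8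
    refine ⟨(x, a₁), (x, a'), (x, b₁), (x, b'), (x, t), tEdge_right h3 (by omega),
      tEdge_right h4 (by omega), tEdge_right h5 (by omega), tEdge_right h6 (by omega),
      tEdge_right h7 (by omega), tEdge_right h8 (by omega), ?_, ?_⟩ <;>
    simp only [tF] <;> omega

theorem tEdge_eq_or_near {i j : ℕ} {x a b : V × W} (hne : i ≠ j) (ha : tEdge A B i a x)
    (hb : tEdge A B j b x) (he : tE A B j a = tE A B j x + 1) :
    j = i + 1 ∨ i = j + 1 := by
  by_contra hij
  obtain ⟨u, v⟩ := b
  have hj : j ∈ C := by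
    rcases hb with h | h
    · exact A.mem h.1
    · exact B.mem h.2.1
  have := tEdge_far hj hne.symm hij ha
  omega

/-- The tensor product of two crystals. -/
def tensor (A : Stem C V) (B : Stem C W) : Stem C (V × W) where
  edge := tEdge A B
  e := tE A B
  f := tF A B
  mem h := by
    rcases h with h | h
    · exact A.mem h.1
    · exact B.mem h.2.1
  inj := tEdge_inj
  det h h' := Prod.swap_injective <|
    tEdge_inj (A := B.dual) (B := A.dual) (tEdge_swap.2 h) (tEdge_swap.2 h')
  e_edge := tEdge_e
  f_edge := tEdge_f
  e_pos := tE_pos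
  f_pos {i x} h := by
    obtain ⟨y, hy⟩ := tE_pos (A := B.dual) (B := A.dual) (x := x.swap) h
    exact ⟨y.swap, tEdge_swap.1 hy⟩
  near := tEdge_near
  far := tEdge_far
  P5E := tEdge_P5
  P5F hne h h' he := by
    obtain ⟨y, h1, h2, h3⟩ := tEdge_P5 (A := B.dual) (B := A.dual) hne
      (tEdge_swap.2 h) (tEdge_swap.2 h') he
    exact ⟨y.swap, tEdge_swap.1 h1, tEdge_swap.1 h2, h3⟩
  P6E hne h h' he he' := tEdge_P6 (tEdge_eq_or_near hne h h' he) h h' he he'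
  P6F hne h h' he he' := by
    have hn := tEdge_eq_or_near (A := B.dual) (B := A.dual) hne
      (tEdge_swap.2 h) (tEdge_swap.2 h') he
    obtain ⟨a₁, a', b₁, b', y, h1, h2, h3, h4, h5, h6, h7, h8⟩ :=
      tEdge_P6 (A := B.dual) (B := A.dual) hn (tEdge_swap.2 h) (tEdge_swap.2 h') he he'
    exact ⟨a₁.swap, a'.swap, b₁.swap, b'.swap, y.swap, tEdge_swap.1 h1, tEdge_swap.1 h2,
      tEdge_swap.1 h3, tEdge_swap.1 h4, tEdge_swap.1 h5, tEdge_swap.1 h6, h7, h8⟩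

end Stem

/-! ### Stembridge's uniqueness of the crystal with a given highest weight -/

namespace Stem

variable {C : Set ℕ} {V : Type u} {W : Type v}

/-- `x` and `y` are reached from `u` and `u'` by the same path of `k` edges. -/
def Sync (A : Stem C V) (B : Stem C W) (u : V) (u' : W) : ℕ → V → W → Prop
  | 0, x, y => x = u ∧ y = u'
  | k + 1, z, w => ∃ i x y, Sync A B u u' k x y ∧ A.edge i x z ∧ B.edge i y w

variable {A : Stem C V} {B : Stem C W} {u : V} {u' : W}

theorem sync_symm {k : ℕ} {x : V} {y : W} (h : Sync A B u u' k x y) : Sync B A u' u k y x := by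
  induction k generalizing x y with
  | zero => exact ⟨h.2, h.1⟩
  | succ k ih =>
    obtain ⟨i, x', y', h1, h2, h3⟩ := h
    exact ⟨i, y', x', ih h1, h3, h2⟩

/-- Synchronous vertices at depth `k` have the same string lengths. -/
def SyncEq (A : Stem C V) (B : Stem C W) (u : V) (u' : W) (k : ℕ) : Prop :=
  ∀ x y, Sync A B u u' k x y → ∀ i, i ∈ C → A.e i x = B.e i y ∧ A.f i x = B.f i y

/-- Raising edges of synchronous vertices at depth `k` lift. -/
def SyncUp (A : Stem C V) (B : Stem C W) (u : V) (u' : W) (k : ℕ) : Prop :=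
  ∀ x y i x', Sync A B u u' k x y → A.edge i x' x →
    ∃ l y', k = l + 1 ∧ B.edge i y' y ∧ Sync A B u u' l x' y'

theorem SyncEq.symm {k : ℕ} (h : SyncEq A B u u' k) : SyncEq B A u' u k :=
  fun x y hs i hi => ⟨(h y x (sync_symm hs) i hi).1.symm, (h y x (sync_symm hs) i hi).2.symm⟩

/-- Let `z = F_i x`, with partner `w` below `y`, and let `E_j z` exist. The axioms at `z` complete
the two raises to a square or an octagon whose top has smaller depth. The top has a partner by
induction; descending from it in `B` and applying the lowering axiom there closes the same figure,
and determinism of the edges identifies its bottom with `w`. -/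
theorem syncUp_succ {k : ℕ} (hu : ∀ l ≤ k, SyncUp A B u u' l)
    (he : ∀ l ≤ k, SyncEq A B u u' l) : SyncUp A B u u' (k + 1) := by
  rintro z w j x' ⟨i, x, y, hs, hz, hw⟩ hj
  have down : ∀ {l s t i t'}, l ≤ k → Sync A B u u' l t s → A.edge i t t' →
      ∃ s', B.edge i s s' ∧ Sync A B u u' (l + 1) t' s' := by
    intro l s t i t' hl hts h
    have := A.f_edge h
    obtain ⟨s', hs'⟩ := B.f_pos (i := i) (x := s) (by
      rw [← (he l hl t s hts i (A.mem h)).2]; omega)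
    exact ⟨s', hs', i, t, s, hts, h, hs'⟩
  refine ⟨k, ?_⟩
  by_cases hij : i = j
  · subst hij
    obtain rfl := A.inj hz hj
    exact ⟨y, rfl, hw, hs⟩
  -- `t` is the top of a commuting square with sides `x` and `x'`. The two alternatives say in which
  -- order the colours satisfy the hypothesis of `P5F` at the top.
  have square : ∀ t, A.edge j t x → A.edge i t x' → A.f j t = A.f j x' ∨ A.f i t = A.f i x →
      ∃ y', k + 1 = k + 1 ∧ B.edge j y' w ∧ Sync A B u u' k x' y' := by
    intro t h3 h4 h5
    obtain ⟨l, s, rfl, h6, h7⟩ := hu k le_rfl x y j t hs h3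
    obtain ⟨y', h8, h9⟩ := down (by omega) h7 h4
    have e1 := (he l (by omega) t s h7 j (A.mem hj)).2
    have e2 := (he _ le_rfl x' y' h9 j (A.mem hj)).2
    have e3 := (he l (by omega) t s h7 i (A.mem hz)).2
    have e4 := (he _ le_rfl x y hs i (A.mem hz)).2
    refine ⟨y', rfl, ?_, h9⟩
    rcases h5 with h5 | h5
    · obtain ⟨w', h10, h11, -⟩ := B.P5F hij h8 h6 (by omega)
      obtain rfl := B.det h10 hw
      exact h11
    · obtain ⟨w', h10, h11, -⟩ := B.P5F (Ne.symm hij) h6 h8 (by omega)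
      obtain rfl := B.det h11 hw
      exact h10
  have s1 := A.step (A.mem hj) hij hz
  have s2 := A.step (A.mem hz) (Ne.symm hij) hj
  by_cases c1 : A.e j x = A.e j z
  · obtain ⟨t, h3, h4, h5⟩ := A.P5E hij hz hj c1
    exact square t h4 h3 (Or.inr h5)
  by_cases c2 : A.e i x' = A.e i z
  · obtain ⟨t, h3, h4, h5⟩ := A.P5E (Ne.symm hij) hj hz c2
    exact square t h3 h4 (Or.inl h5)
  -- Here the two raises form an octagon. Its top `t` is lifted along the side through `x`, and the
  -- partner of `x'` is found by descending three edges on the other side.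
  obtain ⟨a₁, a', b₁, b', t, h1, h2, h3, h4, h5, h6, h7, h8⟩ :=
    A.P6E hij hz hj (by omega) (by omega)
  obtain ⟨k1, y1, rfl, g1, r1⟩ := hu k le_rfl x y j a₁ hs h1
  obtain ⟨k2, y2, rfl, g2, r2⟩ := hu _ (by omega) a₁ y1 j a' r1 h2
  obtain ⟨k3, s, rfl, g3, r3⟩ := hu _ (by omega) a' y2 i t r2 h3
  obtain ⟨d2, g4, r4⟩ := down (by omega) r3 h6
  obtain ⟨d1, g5, r5⟩ := down (by omega) r4 h5
  obtain ⟨d0, g6, r6⟩ := down (by omega) r5 h4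
  have e1 := (he _ (by omega) t s r3 j (A.mem hj)).2
  have e2 := (he _ (by omega) t s r3 i (A.mem hz)).2
  have e3 := (he _ (by omega) a' y2 r2 j (A.mem hj)).2
  have e4 := (he _ (by omega) b' d2 r4 i (A.mem hz)).2
  obtain ⟨c₁, c', c₂, c₃, w', q1, q2, q3, q4, q5, q6, -, -⟩ :=
    B.P6F hij g3 g4 (by omega) (by omega)
  obtain rfl := B.det q1 g2
  obtain rfl := B.det q2 g1
  obtain rfl := B.det q3 hw
  obtain rfl := B.det q4 g5
  obtain rfl := B.det q5 g6
  exact ⟨_, rfl, q6, r6⟩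

/-- Equality of `e` follows by lifting raising edges in both directions. An edge changes `f - e` by
an amount depending only on the colours, so equality of `f` is inherited from the preceding depth.
-/
theorem syncEq_succ {k : ℕ} (he : SyncEq A B u u' k) (hu : SyncUp A B u u' (k + 1))
    (hu' : SyncUp B A u' u (k + 1)) : SyncEq A B u u' (k + 1) := by
  intro z w hzw j hj
  have hup : ∀ i ∈ C, A.e i z = B.e i w := by
    intro i hi
    rcases Nat.eq_zero_or_pos (A.e i z) with h0 | h0
    · rcases Nat.eq_zero_or_pos (B.e i w) with h1 | h1
      · omega
      · obtain ⟨y, hy⟩ := B.e_pos h1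
        obtain ⟨l, x, -, hx, -⟩ := hu' w z i y (sync_symm hzw) hy
        have := A.e_edge hx
        omega
    · obtain ⟨x, hx⟩ := A.e_pos h0
      obtain ⟨l, y, hl, hy, hxy⟩ := hu z w i x hzw hx
      obtain rfl : l = k := by omega
      have := he x y hxy i hi
      have := A.e_edge hx
      have := B.e_edge hy
      omega
  refine ⟨hup j hj, ?_⟩
  have h1 := hup j hj
  obtain ⟨i, x, y, hxy, hz, hw⟩ := hzw
  have h2 := he x y hxy j hj
  by_cases hij : i = j
  · subst hij
    have := A.f_edge hz
    have := B.f_edge hw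
    omega
  · have := A.step hj hij hz
    have := B.step hj hij hw
    omega

theorem sync_all (h0 : ∀ i ∈ C, A.e i u = 0) (h0' : ∀ i ∈ C, B.e i u' = 0)
    (hf : ∀ i ∈ C, A.f i u = B.f i u') (k : ℕ) :
    SyncEq A B u u' k ∧ SyncUp A B u u' k ∧ SyncUp B A u' u k := by
  induction k using Nat.strong_induction_on with
  | _ k ih =>
    cases k with
    | zero =>
      refine ⟨?_, ?_, ?_⟩
      · rintro x y ⟨rfl, rfl⟩ i hi
        exact ⟨by rw [h0 i hi, h0' i hi], hf i hi⟩
      · rintro x y i x' ⟨rfl, rfl⟩ h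
        have := A.e_edge h
        have := h0 i (A.mem h)
        omega
      · rintro x y i x' ⟨rfl, rfl⟩ h
        have := B.e_edge h
        have := h0' i (B.mem h)
        omega
    | succ k =>
      have h1 := syncUp_succ (fun l hl => (ih l (Nat.lt_succ_of_le hl)).2.1)
        (fun l hl => (ih l (Nat.lt_succ_of_le hl)).1)
      have h2 := syncUp_succ (fun l hl => (ih l (Nat.lt_succ_of_le hl)).2.2)
        (fun l hl => (ih l (Nat.lt_succ_of_le hl)).1.symm)
      exact ⟨syncEq_succ (ih k (by omega)).1 h1 h2, h1, h2⟩

/-- The last edge of one path lifts along the other, so two paths to the same `x` can be retraced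
together; the partner and the depth therefore do not depend on the path. -/
theorem sync_functional (hu : ∀ k, SyncUp A B u u' k) {k : ℕ} {x : V} {y y' : W}
    (h : Sync A B u u' k x y) (h' : Sync A B u u' k x y') : y = y' := by
  induction k generalizing x y y' with
  | zero => rw [h.2, h'.2]
  | succ k ih =>
    obtain ⟨i, x1, y1, h1, hx, hy'⟩ := h'
    obtain ⟨l, y2, hl, hy2, h2⟩ := hu _ x y i x1 h hx
    obtain rfl : l = k := by omega
    obtain rfl := ih h1 h2
    exact B.det hy2 hy'

theorem sync_depth (hu : ∀ k, SyncUp A B u u' k) {k l : ℕ} {x : V} {y y' : W}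
    (h : Sync A B u u' k x y) (h' : Sync A B u u' l x y') : k = l := by
  induction k generalizing x y y' l with
  | zero =>
    cases l with
    | zero => rfl
    | succ l =>
      obtain ⟨i, x1, y1, h1, hx, hy'⟩ := h'
      obtain ⟨l, y2, hl, hy2, h2⟩ := hu _ x y i x1 h hx
      omega
  | succ k ih =>
    obtain ⟨i, x1, y1, h1, hx, hy'⟩ := h
    obtain ⟨m, y2, rfl, hy2, h2⟩ := hu _ x y' i x1 h' hx
    rw [ih h1 h2]

/-- An isomorphism between unions of components of two crystals, as a relation. -/
structure PartialIso (A : Stem C V) (B : Stem C W) (R : V → W → Prop) : Prop where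
  e_eq : ∀ {x y i}, R x y → i ∈ C → A.e i x = B.e i y
  f_eq : ∀ {x y i}, R x y → i ∈ C → A.f i x = B.f i y
  right_unique : ∀ {x y y'}, R x y → R x y' → y = y'
  left_unique : ∀ {x x' y}, R x y → R x' y → x = x'
  down : ∀ {i x y x'}, R x y → A.edge i x x' → ∃ y', B.edge i y y' ∧ R x' y'
  up : ∀ {i x y x'}, R x y → A.edge i x' x → ∃ y', B.edge i y' y ∧ R x' y'

theorem PartialIso.symm {R : V → W → Prop} (h : PartialIso A B R) :
    PartialIso B A (fun y x => R x y) where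
  e_eq hR hi := (h.e_eq hR hi).symm
  f_eq hR hi := (h.f_eq hR hi).symm
  right_unique := h.left_unique
  left_unique := h.right_unique
  down {i y x y'} hR he := by
    have := B.f_edge he
    obtain ⟨x', hx'⟩ := A.f_pos (i := i) (x := x) (by rw [h.f_eq hR (B.mem he)]; omega)
    obtain ⟨y'', h1, h2⟩ := h.down hR hx'
    obtain rfl := B.det h1 he
    exact ⟨x', hx', h2⟩
  up {i y x y'} hR he := by
    have := B.e_edge he
    obtain ⟨x', hx'⟩ := A.e_pos (i := i) (x := x) (by rw [h.e_eq hR (B.mem he)]; omega)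
    obtain ⟨y'', h1, h2⟩ := h.up hR hx'
    obtain rfl := B.inj h1 he
    exact ⟨x', hx', h2⟩

theorem PartialIso.dual {R : V → W → Prop} (h : PartialIso A B R) :
    PartialIso A.dual B.dual R where
  e_eq := h.f_eq
  f_eq := h.e_eq
  right_unique := h.right_unique
  left_unique := h.left_unique
  down := h.up
  up := h.down

/-- Crystals with highest weight vertices of the same weight are isomorphic. -/
theorem exists_partialIso (h0 : ∀ i ∈ C, A.e i u = 0) (h0' : ∀ i ∈ C, B.e i u' = 0)
    (hf : ∀ i ∈ C, A.f i u = B.f i u') :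
    ∃ R : V → W → Prop, PartialIso A B R ∧ R u u' ∧
      ∀ x y, R x y → (∀ i ∈ C, A.e i x = 0) → x = u := by
  have H := sync_all h0 h0' hf
  have hAB : ∀ k, SyncUp A B u u' k := fun k => (H k).2.1
  have hBA : ∀ k, SyncUp B A u' u k := fun k => (H k).2.2
  refine ⟨fun x y => ∃ k, Sync A B u u' k x y, ?_, ⟨0, rfl, rfl⟩, ?_⟩
  · constructor
    · rintro x y i ⟨k, h⟩ hi
      exact ((H k).1 x y h i hi).1
    · rintro x y i ⟨k, h⟩ hi
      exact ((H k).1 x y h i hi).2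
    · rintro x y y' ⟨k, h⟩ ⟨l, h'⟩
      obtain rfl := sync_depth hAB h h'
      exact sync_functional hAB h h'
    · rintro x x' y ⟨k, h⟩ ⟨l, h'⟩
      obtain rfl := sync_depth hBA (sync_symm h) (sync_symm h')
      exact sync_functional hBA (sync_symm h) (sync_symm h')
    · rintro i x y x' ⟨k, h⟩ he
      have := A.f_edge he
      obtain ⟨y', hy'⟩ := B.f_pos (i := i) (x := y) (by
        rw [← ((H k).1 x y h i (A.mem he)).2]; omega)
      exact ⟨y', hy', k + 1, i, x, y, h, he, hy'⟩
    · rintro i x y x' ⟨k, h⟩ he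
      obtain ⟨l, y', -, h1, h2⟩ := hAB k x y i x' h he
      exact ⟨y', h1, l, h2⟩
  · rintro x y ⟨k, h⟩ hx
    cases k with
    | zero => exact h.1
    | succ k =>
      obtain ⟨i, x', y', -, h1, -⟩ := h
      have := A.e_edge h1
      have := hx i (A.mem h1)
      omega

end Stem

/-! ### Weights of a component and their symmetries -/

/-- The colours `1, …, m - 1`. -/
def colours (m : ℕ) : Set ℕ := {i | 1 ≤ i ∧ i < m}

/-- The `i`-th simple root. -/
def simpleRoot (i : ℕ) : ℕ → ℤ := fun k => (if k = i then 1 else 0) - (if k = i + 1 then 1 else 0)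

namespace Stem

variable {m : ℕ} {V : Type u}

/-- `x` is reached from `v` by a path of total weight `μ`. -/
inductive Reach {C : Set ℕ} (S : Stem C V) (v : V) : V → (ℕ → ℤ) → Prop
  | refl : Reach S v v 0
  | up {i x y μ} : Reach S v x μ → S.edge i y x → Reach S v y (μ + simpleRoot i)
  | down {i x y μ} : Reach S v x μ → S.edge i x y → Reach S v y (μ - simpleRoot i)

/-- `x` has weight zero. -/
def IsZero {C : Set ℕ} (S : Stem C V) (x : V) : Prop := ∀ i ∈ C, S.f i x = S.e i x

theorem Reach.dual {C : Set ℕ} {S : Stem C V} {v x : V} {μ : ℕ → ℤ} (h : S.Reach v x μ) :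
    S.dual.Reach v x (-μ) := by
  induction h with
  | refl => rw [neg_zero]; exact .refl
  | @up i x y μ _ h ih =>
    have := Reach.down (S := S.dual) ih h
    rwa [neg_add, ← sub_eq_add_neg]
  | @down i x y μ _ h ih =>
    have := Reach.up (S := S.dual) ih h
    rwa [neg_sub, sub_eq_add_neg, add_comm]

variable {S : Stem (colours m) V} {v : V}

theorem Reach.wt (hv : S.IsZero v) {x : V} {μ : ℕ → ℤ} (h : S.Reach v x μ) {j : ℕ}
    (hj : j ∈ colours m) : (S.f j x : ℤ) - S.e j x = μ j - μ (j + 1) := by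
  have key : ∀ {i y x}, S.edge i y x → (S.f j y : ℤ) - S.e j y =
      S.f j x - S.e j x + (simpleRoot i j - simpleRoot i (j + 1)) := by
    intro i y x h
    by_cases hij : i = j
    · subst hij
      have := S.f_edge h
      have := S.e_edge h
      simp only [simpleRoot]
      split_ifs <;> omega
    · have := S.step hj hij h
      simp only [simpleRoot]
      split_ifs <;> omega
  induction h with
  | refl => simp [hv j hj]
  | up _ h ih => rw [key h, ih]; simp only [Pi.add_apply]; ring
  | down _ h ih =>
    have := key h
    simp only [Pi.sub_apply]; linarith

theorem sum_simpleRoot {i : ℕ} (hi : i ∈ colours m) :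
    ∑ k ∈ Finset.Icc 1 m, simpleRoot i k = 0 := by
  obtain ⟨h1, h2⟩ := hi
  simp only [simpleRoot, Finset.sum_sub_distrib, Finset.sum_ite_eq', Finset.mem_Icc]
  rw [if_pos (by omega), if_pos (by omega), sub_self]

theorem Reach.sum {x : V} {μ : ℕ → ℤ} (h : S.Reach v x μ) :
    ∑ k ∈ Finset.Icc 1 m, μ k = 0 := by
  induction h with
  | refl => simp
  | up _ h ih =>
    simp only [Pi.add_apply, Finset.sum_add_distrib, ih, sum_simpleRoot (S.mem h), add_zero]
  | down _ h ih =>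
    simp only [Pi.sub_apply, Finset.sum_sub_distrib, ih, sum_simpleRoot (S.mem h), sub_zero]

theorem Reach.support {x : V} {μ : ℕ → ℤ} (h : S.Reach v x μ) {k : ℕ} (hk : ¬ (1 ≤ k ∧ k ≤ m)) :
    μ k = 0 := by
  have key : ∀ {i x y}, S.edge i x y → simpleRoot i k = 0 := by
    intro i x y h
    obtain ⟨h1, h2⟩ := S.mem h
    simp only [simpleRoot]
    rw [if_neg (by omega), if_neg (by omega), sub_self]
  induction h with
  | refl => rfl
  | up _ h ih => simp [ih, key h]
  | down _ h ih => simp [ih, key h]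

/-- A weight is determined by its differences and its sum. -/
theorem eq_of_differences {μ ν : ℕ → ℤ} (hd : ∀ i ∈ colours m, μ i - μ (i + 1) = ν i - ν (i + 1))
    (hs : ∑ k ∈ Finset.Icc 1 m, μ k = ∑ k ∈ Finset.Icc 1 m, ν k) {k : ℕ} (h1 : 1 ≤ k)
    (hm : k ≤ m) : μ k = ν k := by
  have hc : ∀ k, 1 ≤ k → k ≤ m → μ k - ν k = μ 1 - ν 1 := by
    intro k h1
    induction k, h1 using Nat.le_induction with
    | base => intro _; rfl
    | succ k hk ih =>
      intro h
      have := ih (by omega)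
      have := hd k ⟨hk, by omega⟩
      linarith
  have h0 : ∑ k ∈ Finset.Icc 1 m, (μ k - ν k) = 0 := by
    rw [Finset.sum_sub_distrib, hs, sub_self]
  rw [Finset.sum_congr rfl fun k hk => hc k (Finset.mem_Icc.1 hk).1 (Finset.mem_Icc.1 hk).2,
    Finset.sum_const, Nat.card_Icc, nsmul_eq_mul] at h0
  have hz : μ 1 - ν 1 = 0 := by
    rcases mul_eq_zero.1 h0 with h | h
    · have : m + 1 - 1 = 0 := by exact_mod_cast h
      omega
    · exact h
  have := hc k h1 hm
  linarith

/-- Weight zero makes consecutive entries equal, and the entries sum to zero. -/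
theorem Reach.isZero_iff (hv : S.IsZero v) {x : V} {μ : ℕ → ℤ} (h : S.Reach v x μ) :
    S.IsZero x ↔ μ = 0 := by
  constructor
  · intro hx
    ext k
    by_cases hk : 1 ≤ k ∧ k ≤ m
    · refine eq_of_differences (m := m) (fun i hi => ?_) (by simpa using h.sum) hk.1 hk.2
      rw [← h.wt hv hi, hx i hi]
      simp
    · exact h.support hk
  · rintro rfl i hi
    have := h.wt hv hi
    simp only [Pi.zero_apply] at this
    omega

/-- The set of weights in the component of `v`. -/
def weights (S : Stem (colours m) V) (v : V) : Set (ℕ → ℤ) := {μ | ∃ x, S.Reach v x μ}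

theorem Reach.down_iter {x : V} {μ : ℕ → ℤ} {i d : ℕ} (h : S.Reach v x μ) (hd : d ≤ S.f i x) :
    ∃ x', S.Reach v x' (μ - (d : ℤ) • simpleRoot i) ∧ S.f i x' + d = S.f i x := by
  induction d with
  | zero => exact ⟨x, by simpa using h, rfl⟩
  | succ d ih =>
    obtain ⟨x', h1, h2⟩ := ih (by omega)
    obtain ⟨y, hy⟩ := S.f_pos (i := i) (x := x') (by omega)
    refine ⟨y, ?_, ?_⟩
    · have := h1.down hy
      convert this using 1
      push_cast
      rw [add_smul, one_smul, sub_sub]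
    · have := S.f_edge hy
      omega

theorem weights_dual {μ : ℕ → ℤ} : μ ∈ S.dual.weights v ↔ -μ ∈ S.weights v := by
  constructor
  · rintro ⟨x, h⟩
    exact ⟨x, h.dual⟩
  · rintro ⟨x, h⟩
    exact ⟨x, by simpa using h.dual⟩

theorem isZero_dual : S.dual.IsZero v ↔ S.IsZero v := by
  simp only [IsZero, dual, eq_comm]

/-- The difference `μ i - μ (i + 1)` equals `f - e`, hence is at most `f`, and so many lowering
steps are available. -/
theorem sub_mem_weights (hv : S.IsZero v) {μ : ℕ → ℤ} (h : μ ∈ S.weights v) {i d : ℕ}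
    (hi : i ∈ colours m) (hd : (d : ℤ) ≤ μ i - μ (i + 1)) :
    μ - (d : ℤ) • simpleRoot i ∈ S.weights v := by
  obtain ⟨x, hx⟩ := h
  have := hx.wt hv hi
  obtain ⟨x', h1, -⟩ := hx.down_iter (i := i) (d := d) (by omega)
  exact ⟨x', h1⟩

/-- This is reflection of the `i`-string. A positive difference is removed by lowering, a negative
one by lowering in the dual. -/
theorem swap_succ_mem_weights (hv : S.IsZero v) {μ : ℕ → ℤ} (h : μ ∈ S.weights v) {i : ℕ}
    (hi : i ∈ colours m) : μ ∘ Equiv.swap i (i + 1) ∈ S.weights v := by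
  have key : μ ∘ Equiv.swap i (i + 1) = μ - (μ i - μ (i + 1)) • simpleRoot i := by
    ext k
    simp only [Function.comp, Equiv.swap_apply_def, simpleRoot, Pi.sub_apply, Pi.smul_apply,
      smul_eq_mul]
    split_ifs with h1 h2 h3 <;> subst_vars <;> omega
  rw [key]
  rcases le_total (μ (i + 1)) (μ i) with hle | hle
  · obtain ⟨d, hd⟩ := Int.eq_ofNat_of_zero_le (sub_nonneg.2 hle)
    rw [hd]
    exact sub_mem_weights hv h hi hd.ge
  · obtain ⟨d, hd⟩ := Int.eq_ofNat_of_zero_le (sub_nonneg.2 hle)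
    have h' : -μ ∈ S.dual.weights v := weights_dual.2 (by simpa using h)
    have := sub_mem_weights (isZero_dual.2 hv) h' hi (d := d) (by simp; omega)
    rw [weights_dual] at this
    convert this using 1
    have : μ i - μ (i + 1) = -(d : ℤ) := by omega
    rw [this]
    simp [sub_eq_add_neg, add_comm]

theorem swap_mem_weights (hv : S.IsZero v) {μ : ℕ → ℤ} (h : μ ∈ S.weights v) {a b : ℕ}
    (ha : 1 ≤ a ∧ a ≤ m) (hb : 1 ≤ b ∧ b ≤ m) : μ ∘ Equiv.swap a b ∈ S.weights v := by
  wlog hab : a ≤ b generalizing a b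
  · rw [Equiv.swap_comm]
    exact this hb ha (by omega)
  obtain ⟨d, rfl⟩ := Nat.exists_eq_add_of_le hab
  induction d generalizing μ with
  | zero => simpa using h
  | succ d ih =>
    rcases Nat.eq_zero_or_pos d with rfl | hd
    · exact swap_succ_mem_weights hv h ⟨ha.1, by omega⟩
    have hi : a + d ∈ colours m := ⟨by omega, by omega⟩
    have h1 := swap_succ_mem_weights hv
      (ih (swap_succ_mem_weights hv h hi) (by omega) (by omega)) hi
    have h2 : Equiv.swap a (a + d + 1) = Equiv.swap (a + d) (a + d + 1) * Equiv.swap a (a + d) *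
        Equiv.swap (a + d) (a + d + 1) := by
      rw [Equiv.swap_mul_swap_mul_swap (by omega) (by omega), Equiv.swap_comm]
    rw [← add_assoc, h2]
    exact h1

/-- Transfer of one unit between two entries of a weight. -/
theorem transfer_mem_weights (hv : S.IsZero v) {μ : ℕ → ℤ} (h : μ ∈ S.weights v) {p q : ℕ}
    (hp : 1 ≤ p ∧ p ≤ m) (hq : 1 ≤ q ∧ q ≤ m) (hpq : p ≠ q) (hlt : μ q < μ p) :
    ∃ g : Equiv.Perm ℕ, g 1 = p ∧ g 2 = q ∧ μ ∘ g ∈ S.weights v ∧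
      (fun k => μ k - (if k = p then 1 else 0) + (if k = q then 1 else 0)) ∈ S.weights v := by
  have hm : 2 ≤ m := by omega
  -- After `p` has been brought to position 1, the entry of `q` stands at `q'`, which is then
  -- brought to position 2. The transfer becomes subtraction of the first simple root, and the
  -- permutations are undone afterwards.
  set q' := Equiv.swap 1 p q with hq'
  have hq'1 : q' ≠ 1 := by
    rw [hq', Ne, Equiv.swap_apply_eq_iff, Equiv.swap_apply_left]
    exact hpq.symm
  have hq'm : 1 ≤ q' ∧ q' ≤ m := by
    rw [hq', Equiv.swap_apply_def]
    split_ifs <;> omega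
  have h1 := swap_mem_weights hv h ⟨le_refl 1, by omega⟩ hp
  have h2 := swap_mem_weights hv h1 ⟨by omega, hm⟩ hq'm
  have e1 : Equiv.swap 1 p (Equiv.swap 2 q' 1) = p := by
    rw [Equiv.swap_apply_of_ne_of_ne (by omega) hq'1.symm, Equiv.swap_apply_left]
  have e2 : Equiv.swap 1 p (Equiv.swap 2 q' 2) = q := by
    rw [Equiv.swap_apply_left, hq', Equiv.swap_apply_self]
  refine ⟨Equiv.swap 1 p * Equiv.swap 2 q', e1, e2, h2, ?_⟩
  have h3 := sub_mem_weights hv h2 (i := 1) (d := 1) ⟨le_rfl, by omega⟩ (by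
    simp only [Function.comp, e1, e2]; push_cast; omega)
  have h4 := swap_mem_weights hv (swap_mem_weights hv h3 ⟨by omega, hm⟩ hq'm)
    ⟨le_refl 1, by omega⟩ hp
  convert h4 using 1
  ext k
  have e3 : Equiv.swap 2 q' (Equiv.swap 1 p k) = 1 ↔ k = p := by
    rw [Equiv.swap_apply_eq_iff, Equiv.swap_apply_of_ne_of_ne (by omega) hq'1.symm,
      Equiv.swap_apply_eq_iff, Equiv.swap_apply_left]
  have e4 : Equiv.swap 2 q' (Equiv.swap 1 p k) = 2 ↔ k = q := by
    rw [Equiv.swap_apply_eq_iff, Equiv.swap_apply_left, Equiv.swap_apply_eq_iff, hq',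
      Equiv.swap_apply_self]
  simp only [Function.comp, Pi.sub_apply, Pi.smul_apply, smul_eq_mul, Equiv.swap_apply_self,
    simpleRoot, one_add_one_eq_two, e3, e4]
  push_cast
  ring

end Stem

/-! ### Weights are bounded on one side -/

namespace Stem

variable {m : ℕ} {V : Type u} {S : Stem (colours m) V} {v : V}

/-- A transfer across a gap of at least 2 strictly decreases the sum of squares, which is the
measure for the descent in `not_two_sided`. -/
theorem sum_sq_transfer {μ : ℕ → ℤ} {p q : ℕ} (hp : 1 ≤ p ∧ p ≤ m) (hq : 1 ≤ q ∧ q ≤ m)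
    (hpq : p ≠ q) :
    ∑ k ∈ Finset.Icc 1 m, (μ k - (if k = p then 1 else 0) + (if k = q then 1 else 0)) ^ 2 =
    ∑ k ∈ Finset.Icc 1 m, μ k ^ 2 - 2 * (μ p - μ q) + 2 := by
  have key : ∀ k, (μ k - (if k = p then 1 else 0) + (if k = q then 1 else 0)) ^ 2 =
      μ k ^ 2 + ((if k = p then 1 - 2 * μ p else 0) + (if k = q then 1 + 2 * μ q else 0)) := by
    intro k
    split_ifs with h1 h2 h2
    · omega
    · subst h1; ring
    · subst h2; ring
    · ring
  simp only [key, Finset.sum_add_distrib, Finset.sum_ite_eq', Finset.mem_Icc, hp, hq, and_self,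
    if_true]
  ring

/-- The zero weight vertices of the component of `v` lie on strings of length at most two. -/
def ZeroOne (S : Stem (colours m) V) (v : V) : Prop :=
  ∀ x, S.Reach v x 0 → ∀ i ∈ colours m, S.e i x ≤ 1

/-- After a permutation the weight is twice the first simple root. Two steps down its string lie at
weight zero, where at least two more steps remain; so `f`, which equals `e` there, is at least 2. -/
theorem no_double_root (hv : S.IsZero v) (H : S.ZeroOne v) {μ : ℕ → ℤ}
    (h : μ ∈ S.weights v) {p q : ℕ} (hp : μ p = 2) (hq : μ q = -2)
    (h0 : ∀ k, k ≠ p → k ≠ q → μ k = 0) : False := by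
  have hsupp : ∀ k, μ k ≠ 0 → 1 ≤ k ∧ k ≤ m := by
    obtain ⟨x, hx⟩ := h
    intro k hk
    by_contra hc
    exact hk (hx.support hc)
  have hpq : p ≠ q := by rintro rfl; omega
  have hpm := hsupp p (by omega)
  have hqm := hsupp q (by omega)
  obtain ⟨g, g1, g2, ⟨x, hx⟩, -⟩ := transfer_mem_weights hv h hpm hqm hpq (by omega)
  have hg : μ ∘ g = (2 : ℕ) • simpleRoot 1 := by
    ext k
    simp only [Function.comp, simpleRoot, Pi.smul_apply, one_add_one_eq_two]
    by_cases h1 : k = 1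
    · subst h1; simp [g1, hp]
    by_cases h2 : k = 2
    · subst h2; simp [g2, hq]
    have : μ (g k) = 0 := by
      apply h0
      · rw [← g1]; exact fun h => h1 (g.injective h)
      · rw [← g2]; exact fun h => h2 (g.injective h)
    simp [this, h1, h2]
  have hC : 1 ∈ colours m := ⟨le_rfl, by omega⟩
  have hw := hx.wt hv hC
  simp only [Function.comp, g1, one_add_one_eq_two, g2, hp, hq] at hw
  obtain ⟨y, hy, hf⟩ := hx.down_iter (i := 1) (d := 2) (by omega)
  rw [hg] at hy
  have hy0 : S.Reach v y 0 := by
    convert hy using 1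
    rw [← natCast_zsmul, sub_self]
  have := H y hy0 1 hC
  have := (hy0.isZero_iff hv).2 rfl 1 hC
  omega

/-- Descent on the sum of squares. While a transfer across a gap of at least 2 can be made that
keeps entry `p` at least 2 and entry `q` at most -2, the induction hypothesis applies. When none is
possible, the vanishing sum forces the weight to be 2 at `p`, -2 at `q` and 0 elsewhere. -/
theorem not_two_sided (hv : S.IsZero v) (H : S.ZeroOne v) {μ : ℕ → ℤ}
    (h : μ ∈ S.weights v) {p q : ℕ} (hp : 2 ≤ μ p) (hq : μ q ≤ -2) : False := by
  obtain ⟨N, hN⟩ : ∃ N, (∑ k ∈ Finset.Icc 1 m, μ k ^ 2).toNat = N := ⟨_, rfl⟩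
  induction N using Nat.strong_induction_on generalizing μ with
  | _ N ih =>
    have hsupp : ∀ k, μ k ≠ 0 → 1 ≤ k ∧ k ≤ m := by
      obtain ⟨x, hx⟩ := h
      intro k hk
      by_contra hc
      exact hk (hx.support hc)
    have hsum : ∑ k ∈ Finset.Icc 1 m, μ k = 0 := by
      obtain ⟨x, hx⟩ := h
      exact hx.sum
    have hpm := hsupp p (by omega)
    have hqm := hsupp q (by omega)
    have hpq : p ≠ q := by rintro rfl; omega
    have trans : ∀ a b, 1 ≤ a ∧ a ≤ m → 1 ≤ b ∧ b ≤ m → a ≠ b → 2 ≤ μ a - μ b →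
        (a = p → 3 ≤ μ p) → (b = q → μ q ≤ -3) → b ≠ p → a ≠ q → False := by
      intro a b ha hb hab hd h3 h4 h5 h6
      obtain ⟨-, -, -, -, hmem⟩ := transfer_mem_weights hv h ha hb hab (by omega)
      refine ih _ ?_ hmem ?_ ?_ rfl
      · have h7 := sum_sq_transfer (μ := μ) ha hb hab
        have h8 : 0 ≤ ∑ k ∈ Finset.Icc 1 m,
            (μ k - (if k = a then 1 else 0) + (if k = b then 1 else 0)) ^ 2 :=
          Finset.sum_nonneg fun k _ => sq_nonneg _
        omega
      · simp only [h5.symm, if_false]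
        split_ifs with h7
        · have := h3 h7.symm; omega
        · omega
      · simp only [h6.symm, if_false]
        split_ifs with h7
        · have := h4 h7.symm; omega
        · omega
    have hsplit : μ p + (μ q + ∑ k ∈ ((Finset.Icc 1 m).erase p).erase q, μ k) = 0 := by
      rw [Finset.add_sum_erase _ _ (Finset.mem_erase.2 ⟨hpq.symm, Finset.mem_Icc.2 hqm⟩),
        Finset.add_sum_erase _ _ (Finset.mem_Icc.2 hpm), hsum]
    have hmem : ∀ k ∈ ((Finset.Icc 1 m).erase p).erase q, k ≠ q ∧ k ≠ p ∧ (1 ≤ k ∧ k ≤ m) := by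
      intro k hk
      simpa only [Finset.mem_erase, Finset.mem_Icc] using hk
    -- If `μ p ≥ 3`, a unit could be taken from `p` and given to `q` when `μ q ≤ -3`, or to any
    -- other negative entry. With neither possible, `μ q = -2` and the rest is nonnegative, so the
    -- sum would be positive.
    have hp2 : μ p = 2 := by
      by_contra hne
      have h1 : ¬ μ q ≤ -3 := fun h3 =>
        trans p q hpm hqm hpq (by omega) (by omega) (by omega) hpq.symm hpq
      have h2 : 0 ≤ ∑ k ∈ ((Finset.Icc 1 m).erase p).erase q, μ k := by
        refine Finset.sum_nonneg fun k hk => ?_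
        obtain ⟨hk1, hk2, hk3⟩ := hmem k hk
        by_contra hc
        exact trans p k hpm hk3 hk2.symm (by omega) (by omega) (by omega) hk2 hpq
      omega
    have hq2 : μ q = -2 := by
      by_contra hne
      have h2 : ∑ k ∈ ((Finset.Icc 1 m).erase p).erase q, μ k ≤ 0 := by
        refine Finset.sum_nonpos fun k hk => ?_
        obtain ⟨hk1, hk2, hk3⟩ := hmem k hk
        by_contra hc
        exact trans k q hk3 hqm hk1 (by omega) (by omega) (by omega) hpq.symm hk1
      omega
    -- The remaining entries now sum to zero. Were one nonzero, there would be another of opposite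
    -- sign, and a transfer between the two would be allowed.
    refine no_double_root hv H h hp2 hq2 fun k hkp hkq => ?_
    by_cases hk : 1 ≤ k ∧ k ≤ m
    · have hmk : k ∈ ((Finset.Icc 1 m).erase p).erase q :=
        Finset.mem_erase.2 ⟨hkq, Finset.mem_erase.2 ⟨hkp, Finset.mem_Icc.2 hk⟩⟩
      by_contra hne
      rcases lt_or_gt_of_ne hne with hlt | hgt
      · have hle : ∀ l ∈ ((Finset.Icc 1 m).erase p).erase q, μ l ≤ 0 := by
          intro l hl
          obtain ⟨h1, h2, h3⟩ := hmem l hl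
          by_contra hc
          exact trans l k h3 hk (by rintro rfl; omega) (by omega) (by omega) (by omega) hkp h1
        have h5 := Finset.sum_lt_sum hle ⟨k, hmk, hlt⟩
        simp only [Finset.sum_const_zero] at h5
        omega
      · have hle : ∀ l ∈ ((Finset.Icc 1 m).erase p).erase q, 0 ≤ μ l := by
          intro l hl
          obtain ⟨h1, h2, h3⟩ := hmem l hl
          by_contra hc
          exact trans k l hk h3 (by rintro rfl; omega) (by omega) (by omega) (by omega) h2 hkq
        have h5 := Finset.sum_lt_sum hle ⟨k, hmk, hgt⟩
        simp only [Finset.sum_const_zero] at h5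
        omega
    · by_contra hne
      exact hk (hsupp k hne)

/-- If some entry is at most -2, all entries are at most 1, and the vanishing sum bounds each from
below. This crude bound is what makes raising terminate. -/
theorem neg_le_weight (hv : S.IsZero v) (H : S.ZeroOne v) {μ : ℕ → ℤ} (h : μ ∈ S.weights v)
    {k : ℕ} (hk : 1 ≤ k ∧ k ≤ m) : -(m : ℤ) ≤ μ k := by
  have hs : ∑ k ∈ Finset.Icc 1 m, μ k = 0 := by
    obtain ⟨x, hx⟩ := h
    exact hx.sum
  by_cases hc : ∃ q, μ q ≤ -2
  · obtain ⟨q, hq⟩ := hc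
    have h1 : ∀ p, μ p ≤ 1 := fun p => by
      by_contra hp
      exact not_two_sided hv H h (p := p) (by omega) hq
    rw [← Finset.add_sum_erase _ _ (Finset.mem_Icc.2 hk)] at hs
    have h2 : ∑ j ∈ (Finset.Icc 1 m).erase k, μ j ≤ ∑ j ∈ (Finset.Icc 1 m).erase k, 1 :=
      Finset.sum_le_sum fun j _ => h1 j
    rw [Finset.sum_const, Finset.card_erase_of_mem (Finset.mem_Icc.2 hk), Nat.card_Icc,
      nsmul_eq_mul, mul_one] at h2
    omega
  · push Not at hc
    have := hc k
    omega

/-- Every vertex can be raised to a highest weight vertex. -/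
theorem exists_highest (hv : S.IsZero v) (H : S.ZeroOne v) {x : V} {μ : ℕ → ℤ}
    (h : S.Reach v x μ) : ∃ u ν, S.Reach v u ν ∧ (∀ i ∈ colours m, S.e i u = 0) ∧
      μ 1 ≤ ν 1 ∧ ν m ≤ μ m := by
  -- Raising in colour `i` moves a unit from entry `i + 1` to entry `i`, so this sum drops by
  -- exactly 1. The shift by `m` makes it nonnegative.
  have hb : ∀ {x μ}, S.Reach v x μ → 0 ≤ ∑ k ∈ Finset.Icc 1 m, (k : ℤ) * (μ k + m) := by
    intro x μ h
    refine Finset.sum_nonneg fun k hk => ?_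
    have := neg_le_weight hv H ⟨x, h⟩ (Finset.mem_Icc.1 hk)
    exact mul_nonneg (by omega) (by linarith)
  obtain ⟨N, hN⟩ : ∃ N, (∑ k ∈ Finset.Icc 1 m, (k : ℤ) * (μ k + m)).toNat = N := ⟨_, rfl⟩
  induction N using Nat.strong_induction_on generalizing x μ with
  | _ N ih =>
    by_cases hc : ∀ i ∈ colours m, S.e i x = 0
    · exact ⟨x, μ, h, hc, le_rfl, le_rfl⟩
    · push Not at hc
      obtain ⟨i, hi, hne⟩ := hc
      obtain ⟨y, hy⟩ := S.e_pos (Nat.pos_of_ne_zero hne)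
      have h1 := h.up hy
      have h2 : ∑ k ∈ Finset.Icc 1 m, (k : ℤ) * ((μ + simpleRoot i) k + m) =
          ∑ k ∈ Finset.Icc 1 m, (k : ℤ) * (μ k + m) - 1 := by
        have : ∀ k : ℕ, (k : ℤ) * ((μ + simpleRoot i) k + m) = (k : ℤ) * (μ k + m) +
            ((if k = i then (i : ℤ) else 0) - (if k = i + 1 then (i : ℤ) + 1 else 0)) := by
          intro k
          simp only [Pi.add_apply, simpleRoot]
          split_ifs with h1 h2 h2
          · omega
          · subst h1; ring
          · subst h2; push_cast; ring
          · ring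
        simp only [this, Finset.sum_add_distrib, Finset.sum_sub_distrib, Finset.sum_ite_eq',
          Finset.mem_Icc]
        rw [if_pos ⟨hi.1, hi.2.le⟩, if_pos ⟨by omega, hi.2⟩]
        ring
      have h3 := hb h1
      obtain ⟨u, ν, h4, h5, h6, h7⟩ := ih _ (by omega) h1 rfl
      obtain ⟨hi1, hi2⟩ := hi
      refine ⟨u, ν, h4, h5, ?_, ?_⟩
      · refine le_trans ?_ h6
        simp only [Pi.add_apply, simpleRoot]
        split_ifs <;> omega
      · refine h7.trans ?_
        simp only [Pi.add_apply, simpleRoot]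
        split_ifs <;> omega

theorem PartialIso.reach {C : Set ℕ} {W : Type v} {A : Stem C V} {B : Stem C W}
    {R : V → W → Prop} (h : PartialIso A B R) {a x : V} {b : W} {μ : ℕ → ℤ} (hab : R a b)
    (hx : A.Reach a x μ) : ∃ y, R x y ∧ B.Reach b y μ := by
  induction hx with
  | refl => exact ⟨b, hab, .refl⟩
  | up _ he ih =>
    obtain ⟨y, hy, hr⟩ := ih
    obtain ⟨y', h1, h2⟩ := h.up hy he
    exact ⟨y', h2, hr.up h1⟩
  | down _ he ih =>
    obtain ⟨y, hy, hr⟩ := ih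
    obtain ⟨y', h1, h2⟩ := h.down hy he
    exact ⟨y', h2, hr.down h1⟩

theorem Reach.trans {C : Set ℕ} {S : Stem C V} {x y z : V} {μ ν : ℕ → ℤ} (h : S.Reach x y μ)
    (h' : S.Reach y z ν) : S.Reach x z (μ + ν) := by
  induction h' with
  | refl => simpa using h
  | up _ he ih => rw [← add_assoc]; exact ih.up he
  | down _ he ih => rw [← add_sub_assoc]; exact ih.down he

theorem Reach.symm {C : Set ℕ} {S : Stem C V} {x y : V} {μ : ℕ → ℤ} (h : S.Reach x y μ) :
    S.Reach y x (-μ) := by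
  induction h with
  | refl => rw [neg_zero]; exact .refl
  | @up i x y μ _ he ih =>
    have := (Reach.refl.down he).trans ih
    convert this using 1; ring
  | @down i x y μ _ he ih =>
    have := (Reach.refl.up he).trans ih
    convert this using 1; ring

/-- The partial isomorphism of the crystal with itself based at `x` extends along the path from `x`
to `y`, and the only highest weight vertex in its domain is `x`. -/
theorem highest_unique (hv : S.IsZero v) {x y : V} {μ ν : ℕ → ℤ} (hx : S.Reach v x μ)
    (hy : S.Reach v y ν) (hx0 : ∀ i ∈ colours m, S.e i x = 0)
    (hy0 : ∀ i ∈ colours m, S.e i y = 0) : x = y ∧ μ = ν := by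
  obtain ⟨R, hR, h1, h2⟩ := exists_partialIso hx0 hx0 (fun i _ => rfl)
  obtain ⟨z, hz, -⟩ := hR.reach h1 (hx.symm.trans hy)
  obtain rfl := h2 _ _ hz hy0
  refine ⟨rfl, ?_⟩
  ext k
  by_cases hk : 1 ≤ k ∧ k ≤ m
  · refine eq_of_differences (m := m) (fun i hi => ?_) (by rw [hx.sum, hy.sum]) hk.1 hk.2
    rw [← hx.wt hv hi, ← hy.wt hv hi]
  · rw [hx.support hk, hy.support hk]

/-- Up to duality, the weights of the component of `v` are compositions of `m`, shifted. -/
theorem weights_one_sided (hv : S.IsZero v) (H : S.ZeroOne v) :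
    (∀ μ ∈ S.weights v, ∀ k, -1 ≤ μ k) ∨ (∀ μ ∈ S.dual.weights v, ∀ k, -1 ≤ μ k) := by
  by_contra! hc
  obtain ⟨⟨μ, hμ, q, hq⟩, ⟨ν, hν, p, hp⟩⟩ := hc
  rw [weights_dual] at hν
  have hqm : 1 ≤ q ∧ q ≤ m := by
    obtain ⟨x, hx⟩ := hμ
    by_contra hc
    have := hx.support hc
    omega
  have hpm : 1 ≤ p ∧ p ≤ m := by
    obtain ⟨x, hx⟩ := hν
    by_contra hc
    have := hx.support hc
    simp only [Pi.neg_apply] at this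
    omega
  -- The entry ≤ -2 is moved to the last place and the entry ≥ 2 to the first. Raising never
  -- increases the last entry nor decreases the first, so the common highest weight has both defects
  -- at once.
  obtain ⟨x, hx⟩ := swap_mem_weights hv hμ hqm (b := m) ⟨by omega, le_rfl⟩
  obtain ⟨y, hy⟩ := swap_mem_weights hv hν hpm (b := 1) ⟨le_rfl, by omega⟩
  obtain ⟨u, κ, h1, h2, h3, h4⟩ := exists_highest hv H hx
  obtain ⟨u', κ', h5, h6, h7, h8⟩ := exists_highest hv H hy
  obtain ⟨rfl, rfl⟩ := highest_unique hv h1 h5 h2 h6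
  simp only [Function.comp, Equiv.swap_apply_right, Pi.neg_apply] at h4 h7
  exact not_two_sided hv H ⟨_, h1⟩ (p := 1) (q := m) (by omega) (by omega)

end Stem

/-! ### The crystal of tableaux -/

/-- The crystal of one-row tableaux, given by their contents. -/
def rowStem : Stem Set.univ (ℕ → ℕ) where
  edge i c d := c i = d i + 1 ∧ d (i + 1) = c (i + 1) + 1 ∧ ∀ k, k ≠ i → k ≠ i + 1 → d k = c k
  e i c := c (i + 1)
  f i c := c i
  mem _ := trivial
  inj {i x y z} h h' := by
    ext k
    by_cases h1 : k = i
    · subst h1; omega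
    by_cases h2 : k = i + 1
    · subst h2; omega
    rw [← h.2.2 k h1 h2, ← h'.2.2 k h1 h2]
  det {i x y z} h h' := by
    ext k
    by_cases h1 : k = i
    · subst h1; omega
    by_cases h2 : k = i + 1
    · subst h2; omega
    rw [h.2.2 k h1 h2, h'.2.2 k h1 h2]
  e_edge h := h.2.1
  f_edge h := h.1
  e_pos {i x} h := ⟨fun k => if k = i then x i + 1 else if k = i + 1 then x (i + 1) - 1 else x k,
    by simp, by simp; omega, fun k h1 h2 => by simp [h1, h2]⟩
  f_pos {i x} h := ⟨fun k => if k = i then x i - 1 else if k = i + 1 then x (i + 1) + 1 else x k,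
    by simp; omega, by simp, fun k h1 h2 => by simp [h1, h2]⟩
  near {i j a x} _ hij h := by
    obtain ⟨h1, h2, h3⟩ := h
    rcases hij with rfl | rfl
    · exact Or.inr ⟨(h3 _ (by omega) (by omega)).symm, h2⟩
    · exact Or.inl ⟨h1, (h3 _ (by omega) (by omega)).symm⟩
  far {i j a x} _ hne hij h := by
    obtain ⟨h1, h2, h3⟩ := h
    exact ⟨(h3 _ (by omega) (by omega)).symm, (h3 _ (by omega) (by omega)).symm⟩
  P5E {i j x a b} hne ha hb he := by
    obtain ⟨h1, h2, h3⟩ := ha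
    obtain ⟨h4, h5, h6⟩ := hb
    -- For `i = j + 1` the raise creates a letter `j + 1` and so increases `e_j`, against `he`.
    have hij : i ≠ j + 1 := by rintro rfl; omega
    have h7 := h3 j hne.symm
    have h8 := h6 i hne hij
    have h9 := h3 (j + 1) (by omega) (by omega)
    have h10 := h6 (i + 1)
    have h11 : ∀ k, x k ≤ a k + b k := by
      intro k
      by_cases hk : k = i + 1
      · subst hk
        by_cases hj : i + 1 = j
        · subst hj; omega
        · have := h10 hj (by omega); omega
      · by_cases hk' : k = i
        · subst hk'; omega
        · have := h3 k hk' hk; omega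
    -- The changes made by the two raises are added. By `h11` the subtraction does not truncate.
    refine ⟨fun k => a k + b k - x k, ⟨?_, ?_, ?_⟩, ⟨?_, ?_, ?_⟩, ?_⟩
    · simp only; omega
    · have := h11 (i + 1); simp only; omega
    · intro k hk hk'
      have := h3 k hk hk'
      simp only; omega
    · have := h11 j; simp only; omega
    · simp only; omega
    · intro k hk hk'
      have := h6 k hk hk'
      simp only; omega
    · simp only; omega
  P5F {i j x a b} hne ha hb he := by
    obtain ⟨h1, h2, h3⟩ := ha
    obtain ⟨h4, h5, h6⟩ := hb
    have hij : j ≠ i + 1 := by rintro rfl; omega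
    have h7 := h3 j hne.symm hij
    have h8 := h6 i hne
    have h9 := h3 (j + 1)
    have h10 := h6 (i + 1) (by omega) (by omega)
    have h11 : ∀ k, x k ≤ a k + b k := by
      intro k
      by_cases hk : k = i
      · subst hk
        by_cases hj : k = j + 1
        · subst hj; omega
        · have := h8 hj; omega
      · by_cases hk' : k = i + 1
        · subst hk'; omega
        · have := h3 k hk hk'; omega
    refine ⟨fun k => a k + b k - x k, ⟨?_, ?_, ?_⟩, ⟨?_, ?_, ?_⟩, ?_⟩
    · have := h11 i; simp only; omega
    · simp only; omega
    · intro k hk hk'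
      have := h3 k hk hk'
      simp only; omega
    · simp only; omega
    · have := h11 (j + 1); simp only; omega
    · intro k hk hk'
      have := h6 k hk hk'
      simp only; omega
    · simp only; omega
  P6E {i j x a b} hne ha hb he he' := by
    -- In a row, `E_i` increases `e_j` only if `i = j + 1`, and this cannot hold in both directions.
    exfalso
    obtain ⟨h1, h2, h3⟩ := ha
    obtain ⟨h4, h5, h6⟩ := hb
    have h7 := h3 (j + 1)
    have h8 := h6 (i + 1)
    omega
  P6F {i j x a b} hne ha hb he he' := by
    exfalso
    obtain ⟨h1, h2, h3⟩ := ha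
    obtain ⟨h4, h5, h6⟩ := hb
    have h7 := h3 j
    have h8 := h6 i
    omega

/-- Tableaux with `K` rows, given by the contents of the rows. -/
def Tab : ℕ → Type
  | 0 => Unit
  | K + 1 => (ℕ → ℕ) × Tab K

/-- The trivial crystal. -/
def unitStem : Stem Set.univ Unit where
  edge _ _ _ := False
  e _ _ := 0
  f _ _ := 0
  mem h := h.elim
  inj h := h.elim
  det h := h.elim
  e_edge h := h.elim
  f_edge h := h.elim
  e_pos h := absurd h (lt_irrefl _)
  f_pos h := absurd h (lt_irrefl _)
  near _ _ h := h.elim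
  far _ _ _ h := h.elim
  P5E _ h := h.elim
  P5F _ h := h.elim
  P6E _ h := h.elim
  P6F _ h := h.elim

/-- The crystal structure on tableaux. -/
def tabStem : (K : ℕ) → Stem Set.univ (Tab K)
  | 0 => unitStem
  | K + 1 => rowStem.tensor (tabStem K)

/-- The number of letters `≤ k` in a row. -/
def upTo (c : ℕ → ℕ) (k : ℕ) : ℕ := ∑ j ∈ Finset.range (k + 1), c j

/-- The tableau is semistandard, also when put below the row `c`. -/
def SemiStd : (K : ℕ) → (ℕ → ℕ) → Tab K → Prop
  | 0, _, _ => True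
  | K + 1, c, (d, y) => d 0 = 0 ∧ (∀ k, upTo d (k + 1) ≤ upTo c k) ∧ SemiStd K d y

theorem tab_e_succ {K i : ℕ} (c : ℕ → ℕ) (y : Tab K) :
    (tabStem (K + 1)).e i (c, y) = c (i + 1) + ((tabStem K).e i y - c i) := rfl

theorem tab_f_succ {K i : ℕ} (c : ℕ → ℕ) (y : Tab K) :
    (tabStem (K + 1)).f i (c, y) = (tabStem K).f i y + (c i - (tabStem K).e i y) := rfl

theorem tab_edge_succ {K i : ℕ} {c d : ℕ → ℕ} {y z : Tab K} :
    (tabStem (K + 1)).edge i (c, y) (d, z) ↔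
      (rowStem.edge i c d ∧ y = z ∧ (tabStem K).e i y < c i) ∨
      (c = d ∧ (tabStem K).edge i y z ∧ c i ≤ (tabStem K).e i y) := Iff.rfl

theorem upTo_succ (c : ℕ → ℕ) (k : ℕ) : upTo c (k + 1) = upTo c k + c (k + 1) :=
  Finset.sum_range_succ _ _

theorem upTo_of_edge {i : ℕ} {c d : ℕ → ℕ} (h : rowStem.edge i c d) (k : ℕ) :
    upTo c k = upTo d k + if k = i then 1 else 0 := by
  obtain ⟨h1, h2, h3⟩ := h
  have key : ∀ k, (k < i → upTo c k = upTo d k) ∧ (k = i → upTo c k = upTo d k + 1) ∧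
      (i < k → upTo c k = upTo d k) := by
    intro k
    induction k with
    | zero =>
      simp only [upTo, zero_add, Finset.sum_range_one]
      refine ⟨fun h => (h3 0 (by omega) (by omega)).symm, fun h => ?_, fun h => by omega⟩
      subst h; exact h1
    | succ k ih =>
      rw [upTo_succ, upTo_succ]
      refine ⟨fun h => ?_, fun h => ?_, fun h => ?_⟩
      · rw [ih.1 (by omega), h3 _ (by omega) (by omega)]
      · subst h; rw [ih.1 (by omega)]; omega
      · by_cases hk : k = i
        · subst hk; rw [ih.2.1 rfl]; omega
        · rw [ih.2.2 (by omega), h3 _ (by omega) (by omega)]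
  have := key k
  split_ifs with h <;> omega

theorem semiStd_congr {K : ℕ} {c c' : ℕ → ℕ} {y : Tab K} (h : ∀ k, upTo c k ≤ upTo c' k)
    (hy : SemiStd K c y) : SemiStd K c' y := by
  cases K with
  | zero => trivial
  | succ K =>
    obtain ⟨d, y⟩ := y
    exact ⟨hy.1, fun k => (hy.2.1 k).trans (h k), hy.2.2⟩

/-- The hypothesis `hc` says that raising in the tableau with the row `c` on top acts below that
row. When the row `d` is the one raised, `hc` reads `c i < d (i + 1)`; with the column condition for
letters up to `i + 1` it leaves room for one more letter `i` in `d`. -/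
theorem semiStd_of_raise {K i : ℕ} {c : ℕ → ℕ} {y z : Tab K} (hi : 1 ≤ i)
    (h : (tabStem K).edge i z y) (hc : c i < (tabStem K).e i y) (hy : SemiStd K c y) :
    SemiStd K c z := by
  induction K generalizing c with
  | zero => trivial
  | succ K ih =>
    obtain ⟨d, y⟩ := y
    obtain ⟨d', z⟩ := z
    obtain ⟨hy0, hy1, hy2⟩ := hy
    rw [tab_e_succ] at hc
    rcases tab_edge_succ.1 h with ⟨h1, rfl, h2⟩ | ⟨rfl, h1, h2⟩
    · refine ⟨?_, ?_, semiStd_congr (fun k => by rw [upTo_of_edge h1]; omega) hy2⟩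
      · have := h1.2.2 0 (by omega) (by omega)
        omega
      · intro k
        have := hy1 k
        rw [upTo_of_edge h1]
        split_ifs with hk
        · subst hk
          have e1 := hy1 (k + 1)
          rw [upTo_succ d, upTo_succ c] at e1
          have := h1.1
          omega
        · omega
    · have := (tabStem K).e_edge h1
      exact ⟨hy0, hy1, ih h1 (by omega) hy2⟩

/-- Lowering in the row `d` can only harm the row below it. That row has at most `e_i` letters `i +
1`, and the signature rule makes this number smaller than `d i`, so the column condition at `i` was
strict. -/
theorem semiStd_of_lower {K i : ℕ} {c : ℕ → ℕ} {y z : Tab K} (hi : 1 ≤ i)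
    (h : (tabStem K).edge i y z) (hy : SemiStd K c y) : SemiStd K c z := by
  induction K generalizing c with
  | zero => trivial
  | succ K ih =>
    obtain ⟨d, y⟩ := y
    obtain ⟨d', z⟩ := z
    obtain ⟨hy0, hy1, hy2⟩ := hy
    rcases tab_edge_succ.1 h with ⟨h1, rfl, h2⟩ | ⟨rfl, h1, h2⟩
    · refine ⟨?_, ?_, ?_⟩
      · have := h1.2.2 0 (by omega) (by omega)
        omega
      · intro k
        have := hy1 k
        have := upTo_of_edge h1 (k + 1)
        omega
      · cases K with
        | zero => trivial
        | succ K =>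
          obtain ⟨b, y⟩ := y
          refine ⟨hy2.1, fun k => ?_, hy2.2.2⟩
          have e1 := hy2.2.1 k
          have e2 := upTo_of_edge h1 k
          rw [tab_e_succ] at h2
          split_ifs at e2 with hk
          · subst hk
            obtain ⟨k, rfl⟩ := Nat.exists_eq_add_of_le' hi
            have e3 := hy2.2.1 k
            rw [upTo_succ] at e1 e2 ⊢
            rw [upTo_succ] at e1
            omega
          · omega
    · exact ⟨hy0, hy1, ih h1 hy2⟩

/-- The number of letters `k`. -/
def letterCount : (K : ℕ) → ℕ → Tab K → ℕ
  | 0, _, _ => 0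
  | K + 1, k, (c, y) => c k + letterCount K k y

theorem tab_wt {K i : ℕ} (y : Tab K) :
    (tabStem K).f i y + letterCount K (i + 1) y = (tabStem K).e i y + letterCount K i y := by
  induction K with
  | zero => rfl
  | succ K ih =>
    obtain ⟨c, y⟩ := y
    have := ih y
    rw [tab_e_succ, tab_f_succ]
    simp only [letterCount]
    omega

/-- The rows have lengths `lam a, lam (a + 1), …` and letters in `{1, …, m}`. -/
def HasShape (m : ℕ) (lam : ℕ → ℕ) : (K a : ℕ) → Tab K → Prop
  | 0, _, _ => True
  | K + 1, a, (c, y) => upTo c m = lam a ∧ c 0 = 0 ∧ (∀ k, m < k → c k = 0) ∧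
      HasShape m lam K (a + 1) y

theorem hasShape_edge {m K a i : ℕ} {lam : ℕ → ℕ} {y z : Tab K} (hi : i ∈ colours m)
    (h : (tabStem K).edge i y z) : HasShape m lam K a y ↔ HasShape m lam K a z := by
  obtain ⟨hi1, hi2⟩ := hi
  induction K generalizing a with
  | zero => exact Iff.rfl
  | succ K ih =>
    obtain ⟨d, y⟩ := y
    obtain ⟨d', z⟩ := z
    rcases tab_edge_succ.1 h with ⟨h1, rfl, h2⟩ | ⟨rfl, h1, h2⟩
    · have h3 := upTo_of_edge h1 m
      rw [if_neg (by omega), add_zero] at h3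
      simp only [HasShape, h3, h1.2.2 0 (by omega) (by omega)]
      refine and_congr_right fun _ => and_congr_right fun _ => and_congr_left fun _ => ?_
      exact forall_congr' fun k => forall_congr' fun hk => by
        rw [h1.2.2 k (by omega) (by omega)]
    · simp only [HasShape, ih h1]

theorem exists_semiStd_of_lower {K i : ℕ} {y z : Tab K} (hi : 1 ≤ i)
    (h : (tabStem K).edge i y z) (hy : ∃ c, SemiStd K c y) : ∃ c, SemiStd K c z := by
  obtain ⟨c, hc⟩ := hy
  exact ⟨c, semiStd_of_lower hi h hc⟩

theorem exists_semiStd_of_raise {K i : ℕ} {y z : Tab K} (hi : 1 ≤ i)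
    (h : (tabStem K).edge i z y) (hy : ∃ c, SemiStd K c y) : ∃ c, SemiStd K c z := by
  cases K with
  | zero => exact ⟨0, trivial⟩
  | succ K =>
    obtain ⟨d, y⟩ := y
    obtain ⟨d', z⟩ := z
    obtain ⟨c, hy0, hy1, hy2⟩ := hy
    rcases tab_edge_succ.1 h with ⟨h1, rfl, h2⟩ | ⟨rfl, h1, h2⟩
    -- The row above is artificial: each of its entries alone is already as large as the column
    -- condition requires of the partial sum.
    · refine ⟨fun k => upTo d' (k + 1), ?_, fun k => ?_,
        semiStd_congr (fun k => by rw [upTo_of_edge h1]; omega) hy2⟩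
      · have := h1.2.2 0 (by omega) (by omega)
        omega
      · exact Finset.single_le_sum (f := fun k => upTo d' (k + 1)) (fun _ _ => Nat.zero_le _)
          (Finset.self_mem_range_succ k)
    · have := (tabStem K).e_edge h1
      exact ⟨c, hy0, hy1, semiStd_of_raise hi h1 (by omega) hy2⟩

/-- The tableau with rows `M a, M (a + 1), …`. -/
def mkTab (M : ℕ → ℕ → ℕ) : (K a : ℕ) → Tab K
  | 0, _ => ()
  | K + 1, a => (M a, mkTab M K (a + 1))

theorem mkTab_congr {M N : ℕ → ℕ → ℕ} {K a : ℕ} (h : ∀ b, a ≤ b → b < a + K → M b = N b) :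
    mkTab M K a = mkTab N K a := by
  induction K generalizing a with
  | zero => rfl
  | succ K ih =>
    rw [mkTab, mkTab, h a le_rfl (by omega), ih fun b h1 h2 => h b (by omega) (by omega)]

theorem mkTab_inj {M N : ℕ → ℕ → ℕ} {K a : ℕ} (h : mkTab M K a = mkTab N K a) :
    ∀ b, a ≤ b → b < a + K → M b = N b := by
  induction K generalizing a with
  | zero => intro b h1 h2; omega
  | succ K ih =>
    replace h := Prod.mk.inj h
    intro b h1 h2
    by_cases hb : b = a
    · rw [hb, h.1]
    · exact ih h.2 b (by omega) (by omega)

theorem letterCount_mkTab {M : ℕ → ℕ → ℕ} {K a k : ℕ} :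
    letterCount K k (mkTab M K a) = ∑ b ∈ Finset.Ico a (a + K), M b k := by
  induction K generalizing a with
  | zero => simp [letterCount]
  | succ K ih =>
    rw [mkTab, letterCount, ih, Finset.sum_eq_sum_Ico_succ_bot (show a < a + (K + 1) by omega),
      add_right_comm, add_assoc]

/-! ### The highest weight tableau -/

/-- The rows of the highest weight tableau. -/
def diagRow (lam : ℕ → ℕ) (a k : ℕ) : ℕ := if k = a then lam a else 0

theorem upTo_diagRow (lam : ℕ → ℕ) (a k : ℕ) :
    upTo (diagRow lam a) k = if a ≤ k then lam a else 0 := by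
  simp only [upTo, diagRow, Finset.sum_ite_eq', Finset.mem_range, Nat.lt_succ_iff]

theorem semiStd_diag {lam : ℕ → ℕ} (hlam : ∀ i, 1 ≤ i → lam (i + 1) ≤ lam i) {K a : ℕ}
    (ha : 1 ≤ a) : SemiStd K (diagRow lam a) (mkTab (diagRow lam) K (a + 1)) := by
  induction K generalizing a with
  | zero => trivial
  | succ K ih =>
    refine ⟨by simp [diagRow], fun k => ?_, ih (by omega)⟩
    have := hlam a ha
    rw [upTo_diagRow, upTo_diagRow]
    split_ifs <;> omega

theorem hasShape_diag {lam : ℕ → ℕ} {m K a : ℕ} (ha : 1 ≤ a) (hK : a + K ≤ m + 1) :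
    HasShape m lam K a (mkTab (diagRow lam) K a) := by
  induction K generalizing a with
  | zero => trivial
  | succ K ih =>
    refine ⟨?_, ?_, fun k hk => ?_, ih (by omega) (by omega)⟩
    · rw [upTo_diagRow, if_pos (by omega)]
    · rw [diagRow, if_neg (by omega)]
    · rw [diagRow, if_neg (by omega)]

/-- The last clause is the highest weight property. The other two serve the induction: the rows from
`a` on offer at most `lam a` unpaired letters `a`, and the row above has enough letters `a - 1` to
cancel them. -/
theorem e_diag {lam : ℕ → ℕ} (hlam : ∀ i, 1 ≤ i → lam (i + 1) ≤ lam i) {K a i : ℕ}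
    (ha : 1 ≤ a) : (i + 1 < a → (tabStem K).e i (mkTab (diagRow lam) K a) = 0) ∧
      (i + 1 = a → (tabStem K).e i (mkTab (diagRow lam) K a) ≤ lam a) ∧
      (a ≤ i → (tabStem K).e i (mkTab (diagRow lam) K a) = 0) := by
  induction K generalizing a with
  | zero => exact ⟨fun _ => rfl, fun _ => Nat.zero_le _, fun _ => rfl⟩
  | succ K ih =>
    obtain ⟨h1, h2, h3⟩ := ih (a := a + 1) (by omega)
    have := hlam a ha
    rw [mkTab, tab_e_succ]
    simp only [diagRow]
    refine ⟨fun h => ?_, fun h => ?_, fun h => ?_⟩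
    · rw [h1 (by omega)]; split_ifs <;> omega
    · rw [h1 (by omega)]; split_ifs <;> omega
    · by_cases hi : i = a
      · have := h2 (by omega)
        split_ifs <;> omega
      · rw [h3 (by omega)]; split_ifs <;> omega

/-! ### Edges -/

/-- The only letter `i + 1`, in row `s`, is unpaired exactly when no letter `i` stands in a higher
row. A value `s < a` encodes that no such letter is present in the rows considered. -/
theorem e_mkTab {M : ℕ → ℕ → ℕ} {K a i s : ℕ}
    (hM : ∀ b, a ≤ b → M b (i + 1) = if b = s then 1 else 0) (hs : s < a + K) :
    ((a ≤ s ∧ ∀ b, a ≤ b → b < s → M b i = 0) → (tabStem K).e i (mkTab M K a) = 1) ∧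
    (¬ (a ≤ s ∧ ∀ b, a ≤ b → b < s → M b i = 0) → (tabStem K).e i (mkTab M K a) = 0) := by
  induction K generalizing a with
  | zero => exact ⟨fun h => by omega, fun _ => rfl⟩
  | succ K ih =>
    obtain ⟨h1, h2⟩ := ih (a := a + 1) (fun b hb => hM b (by omega)) (by omega)
    rw [mkTab, tab_e_succ, hM a le_rfl]
    constructor
    · rintro ⟨h3, h4⟩
      by_cases has : a = s
      · rw [h2 (by omega), if_pos has]
        omega
      · rw [h1 ⟨by omega, fun b hb => h4 b (by omega)⟩, h4 a le_rfl (by omega), if_neg has]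
    · intro h3
      have has : a ≠ s := fun h => h3 ⟨h.le, fun b hb hb' => by omega⟩
      rw [if_neg has]
      by_cases h4 : a + 1 ≤ s ∧ ∀ b, a + 1 ≤ b → b < s → M b i = 0
      · rw [h1 h4]
        by_contra h5
        refine h3 ⟨by omega, fun b hb hb' => ?_⟩
        by_cases hab : b = a
        · subst hab; omega
        · exact h4.2 b (by omega) hb'
      · rw [h2 h4]; omega

/-- Lowering acts on the highest row with an unpaired letter `i`. By `h1` row `t` keeps one after
the pairing with the `i + 1` of row `s`; by `h2` any letter `i` above row `t` is consumed by that
pairing. -/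
theorem edge_mkTab {M N : ℕ → ℕ → ℕ} {K a i s t : ℕ}
    (hM : ∀ b, a ≤ b → M b (i + 1) = if b = s then 1 else 0) (hs : s < a + K)
    (ht : a ≤ t) (ht' : t < a + K) (hedge : rowStem.edge i (M t) (N t))
    (hN : ∀ b, b ≠ t → N b = M b)
    (h1 : (t < s ∧ ∀ b, t < b → b < s → M b i = 0) → 1 < M t i)
    (h2 : ∀ b, a ≤ b → b < t →
      M b i = 0 ∨ (M b i = 1 ∧ b < s ∧ ∀ c, b < c → c < s → M c i = 0)) :
    (tabStem K).edge i (mkTab M K a) (mkTab N K a) := by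
  induction K generalizing a with
  | zero => omega
  | succ K ih =>
    obtain ⟨h3, h4⟩ := e_mkTab (a := a + 1) (K := K) (fun b hb => hM b (by omega)) (by omega)
    rw [mkTab, mkTab, tab_edge_succ]
    by_cases hat : a = t
    · subst hat
      refine Or.inl ⟨hedge, mkTab_congr fun b hb _ => (hN b (by omega)).symm, ?_⟩
      have := hedge.1
      by_cases h5 : a + 1 ≤ s ∧ ∀ b, a + 1 ≤ b → b < s → M b i = 0
      · rw [h3 h5]; exact h1 h5
      · rw [h4 h5]; omega
    · refine Or.inr ⟨(hN a hat).symm, ih (fun b hb => hM b (by omega)) (by omega) (by omega)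
        (by omega) (fun b hb => h2 b (by omega)), ?_⟩
      rcases h2 a le_rfl (by omega) with h5 | ⟨h5, h6⟩
      · omega
      · rw [h3 h6, h5]

/-- The column with a single entry in row `p`. -/
def unitCol (p b : ℕ) : ℕ := if b = p then 1 else 0

/-- The matrix `M` with the columns of the letters `j`, `j + 1`, `j + 2` replaced. -/
def threeCols (M : ℕ → ℕ → ℕ) (j : ℕ) (A B D : ℕ → ℕ) (b k : ℕ) : ℕ :=
  if k = j then A b else if k = j + 1 then B b else if k = j + 2 then D b else M b k

section

variable {M N : ℕ → ℕ → ℕ} {K i p q s : ℕ}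

/-- `M` and `N` agree except in the columns of the letters `i` and `i + 1`,
which are `X` and `Y` in `M`, and `X'` and `Y'` in `N`. -/
structure PairCols (M N : ℕ → ℕ → ℕ) (i : ℕ) (X Y X' Y' : ℕ → ℕ) : Prop where
  fst : ∀ b, M b i = X b
  snd : ∀ b, M b (i + 1) = Y b
  fst' : ∀ b, N b i = X' b
  snd' : ∀ b, N b (i + 1) = Y' b
  rest : ∀ b k, k ≠ i → k ≠ i + 1 → N b k = M b k

theorem PairCols.edge {X Y X' Y' : ℕ → ℕ} {t : ℕ} (h : PairCols M N i X Y X' Y')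
    (hs : s < 1 + K) (hY : ∀ b, 1 ≤ b → Y b = unitCol s b) (ht : 1 ≤ t) (htK : t ≤ K)
    (h1 : ∀ b, X b = X' b + unitCol t b) (h2 : ∀ b, Y' b = Y b + unitCol t b)
    (h3 : (t < s ∧ ∀ b, t < b → b < s → X b = 0) → 1 < X t)
    (h4 : ∀ b, 1 ≤ b → b < t → X b = 0 ∨ (X b = 1 ∧ b < s ∧ ∀ c, b < c → c < s → X c = 0)) :
    (tabStem K).edge i (mkTab M K 1) (mkTab N K 1) := by
  refine edge_mkTab (t := t) (s := s) ?_ hs ht (by omega) ⟨?_, ?_, ?_⟩ ?_ ?_ ?_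
  · intro b hb
    rw [h.snd, hY b hb, unitCol]
  · rw [h.fst, h.fst', h1, unitCol, if_pos rfl]
  · rw [h.snd, h.snd', h2, unitCol, if_pos rfl]
  · exact h.rest t
  · intro b hb
    ext k
    by_cases hk : k = i
    · subst hk; rw [h.fst, h.fst', h1, unitCol, if_neg hb]; rfl
    by_cases hk' : k = i + 1
    · subst hk'; rw [h.snd, h.snd', h2, unitCol, if_neg hb]; rfl
    exact h.rest b k hk hk'
  · simpa only [h.fst] using h3
  · simpa only [h.fst] using h4

/-- Of two unpaired letters `i`, the one in the higher row moves. Row 0 stands for the absent letter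
`i + 1`. -/
theorem edge_pair_zero (h : PairCols M N i (unitCol p + unitCol s) 0 (unitCol p) (unitCol s))
    (hsp : s ≤ p) (hs : 1 ≤ s) (hp : p ≤ K) :
    (tabStem K).edge i (mkTab M K 1) (mkTab N K 1) := by
  refine h.edge (t := s) (s := 0) (by omega) ?_ hs (by omega) ?_ ?_ ?_ ?_
  · intro b hb; simp [unitCol]; omega
  · intro b; rfl
  · intro b; simp
  · omega
  · intro b hb hbs
    simp only [unitCol, Pi.add_apply]
    split_ifs <;> omega

theorem edge_one_one (h : PairCols M N i (unitCol p) (unitCol s) 0 (unitCol p + unitCol s))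
    (hsp : s ≤ p) (hs : 1 ≤ s) (hp : p ≤ K) :
    (tabStem K).edge i (mkTab M K 1) (mkTab N K 1) := by
  refine h.edge (t := p) (s := s) (by omega) ?_ (by omega) (by omega) ?_ ?_ ?_ ?_
  · intro b hb; rfl
  · intro b; simp
  · intro b; simp only [Pi.add_apply]; omega
  · omega
  · intro b hb hbs
    simp only [unitCol]
    split_ifs <;> omega

/-- The `i` in row `p` is paired with the `i + 1` in row `s` below it, so the one in row `q` moves.
-/
theorem edge_pair_one (h : PairCols M N i (unitCol p + unitCol q) (unitCol s) (unitCol p)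
    (unitCol q + unitCol s)) (hps : p < s) (hsq : s ≤ q) (hp : 1 ≤ p) (hq : q ≤ K) :
    (tabStem K).edge i (mkTab M K 1) (mkTab N K 1) := by
  refine h.edge (t := q) (s := s) (by omega) ?_ (by omega) (by omega) ?_ ?_ ?_ ?_
  · intro b hb; rfl
  · intro b; rfl
  · intro b; simp only [Pi.add_apply]; omega
  · omega
  · intro b hb hbs
    by_cases hbp : b = p
    · refine Or.inr ⟨?_, by omega, fun c h1 h2 => ?_⟩ <;>
      simp only [unitCol, Pi.add_apply] <;> split_ifs <;> omega
    · refine Or.inl ?_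
      simp only [unitCol, Pi.add_apply]
      rw [if_neg hbp, if_neg (by omega)]

/-- The `i + 1` in row `q` is paired with the nearest `i` above it, in row `p`, so the one in row
`s` moves. -/
theorem edge_pair_one' (h : PairCols M N i (unitCol p + unitCol s) (unitCol q) (unitCol p)
    (unitCol q + unitCol s)) (hsp : s ≤ p) (hpq : p < q) (hs : 1 ≤ s) (hq : q ≤ K) :
    (tabStem K).edge i (mkTab M K 1) (mkTab N K 1) := by
  refine h.edge (t := s) (s := q) (by omega) ?_ (by omega) (by omega) ?_ ?_ ?_ ?_
  · intro b hb; rfl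
  · intro b; rfl
  · intro b; rfl
  · rintro ⟨h1, h2⟩
    by_cases hc : s = p
    · subst hc; simp [unitCol]
    · have := h2 p (by omega) hpq
      simp [unitCol] at this
  · intro b hb hbs
    refine Or.inl ?_
    simp only [unitCol, Pi.add_apply]
    split_ifs <;> omega

theorem edge_one_zero (h : PairCols M N i (unitCol s) 0 0 (unitCol s)) (hs : 1 ≤ s)
    (hsK : s ≤ K) : (tabStem K).edge i (mkTab M K 1) (mkTab N K 1) := by
  refine h.edge (t := s) (s := 0) (by omega) ?_ hs hsK ?_ ?_ ?_ ?_
  · intro b hb; simp [unitCol]; omega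
  · intro b; simp
  · intro b; simp
  · omega
  · intro b hb hbs
    simp only [unitCol]
    split_ifs <;> omega

end

/-! ### Elementary dual equivalences as crystal operators -/

/-- `w` is obtained from `v` by `F_j F_i E_j E_i`. -/
def Stem.FFEE {C : Set ℕ} {V : Type u} (S : Stem C V) (i j : ℕ) (v w : V) : Prop :=
  ∃ a b c, S.edge i a v ∧ S.edge j b a ∧ S.edge i b c ∧ S.edge j c w

theorem Stem.FFEE.symm {C : Set ℕ} {V : Type u} {S : Stem C V} {i j : ℕ} {v w : V}
    (h : S.FFEE i j v w) : S.FFEE j i w v := by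
  obtain ⟨a, b, c, h1, h2, h3, h4⟩ := h
  exact ⟨c, b, a, h4, h3, h2, h1⟩

theorem Stem.FFEE.unique {C : Set ℕ} {V : Type u} {S : Stem C V} {i j : ℕ} {v w w' : V}
    (h : S.FFEE i j v w) (h' : S.FFEE i j v w') : w = w' := by
  obtain ⟨a, b, c, h1, h2, h3, h4⟩ := h
  obtain ⟨a', b', c', h1', h2', h3', h4'⟩ := h'
  obtain rfl := S.inj h1 h1'
  obtain rfl := S.inj h2 h2'
  obtain rfl := S.det h3 h3'
  exact S.det h4 h4'

theorem Stem.PartialIso.ffee {C : Set ℕ} {V : Type u} {W : Type v} {A : Stem C V} {B : Stem C W}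
    {R : V → W → Prop} (h : Stem.PartialIso A B R) {i j : ℕ} {v w : V} {y : W} (hv : R v y)
    (hf : A.FFEE i j v w) : ∃ z, B.FFEE i j y z ∧ R w z := by
  obtain ⟨a, b, c, h1, h2, h3, h4⟩ := hf
  obtain ⟨a', g1, r1⟩ := h.up hv h1
  obtain ⟨b', g2, r2⟩ := h.up r1 h2
  obtain ⟨c', g3, r3⟩ := h.down r2 h3
  obtain ⟨z, g4, r4⟩ := h.down r3 h4
  exact ⟨z, ⟨a', b', c', g1, g2, g3, g4⟩, r4⟩

/-- The matrix of a word: row `b` contains the letters `k` with `r k = b`. -/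
def rowOf (r : ℕ → ℕ) (b k : ℕ) : ℕ := unitCol (r k) b

/-- The elementary dual equivalence `r ↦ r'` at the positions `j`, `j + 1`, `j + 2`, for
`r j < r (j + 1)` and `r (j + 2) ≤ r (j + 1)`. -/
def KnuthStep (j : ℕ) (r r' : ℕ → ℕ) : Prop :=
  (r j < r (j + 1) ∧ r (j + 2) ≤ r (j + 1)) ∧
  ((r j < r (j + 2) ∧ r' j = r (j + 1) ∧ r' (j + 1) = r j ∧ r' (j + 2) = r (j + 2)) ∨
    (r (j + 2) ≤ r j ∧ r' j = r j ∧ r' (j + 1) = r (j + 2) ∧ r' (j + 2) = r (j + 1))) ∧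
  ∀ k, k ≠ j → k ≠ j + 1 → k ≠ j + 2 → r' k = r k

/-- Two words differ by an elementary dual equivalence at `j`, `j + 1`, `j + 2`. -/
def Knuth (j : ℕ) (r r' : ℕ → ℕ) : Prop := KnuthStep j r r' ∨ KnuthStep j r' r

theorem pairCols_low (M : ℕ → ℕ → ℕ) (j : ℕ) (A B A' B' D : ℕ → ℕ) :
    PairCols (threeCols M j A B D) (threeCols M j A' B' D) j A B A' B' := by
  constructor
  · intro b; simp [threeCols]
  · intro b; simp [threeCols]
  · intro b; simp [threeCols]
  · intro b; simp [threeCols]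
  · intro b k h1 h2; simp [threeCols, h1, h2]

theorem pairCols_high (M : ℕ → ℕ → ℕ) (j : ℕ) (A B B' D D' : ℕ → ℕ) :
    PairCols (threeCols M j A B D) (threeCols M j A B' D') (j + 1) B D B' D' := by
  have h0 : j + 1 + 1 ≠ j := by omega
  constructor
  · intro b; simp [threeCols]
  · intro b; simp [threeCols, h0]
  · intro b; simp [threeCols]
  · intro b; simp [threeCols, h0]
  · intro b k h1 h2
    have h3 : k ≠ j + 2 := h2
    simp [threeCols, h1, h3]

theorem rowOf_eq_threeCols {j : ℕ} {r r' : ℕ → ℕ}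
    (h : ∀ k, k ≠ j → k ≠ j + 1 → k ≠ j + 2 → r' k = r k) :
    rowOf r' = threeCols (rowOf r) j (unitCol (r' j)) (unitCol (r' (j + 1)))
      (unitCol (r' (j + 2))) := by
  ext b k
  simp only [threeCols, rowOf]
  split_ifs with h1 h2 h3
  · rw [h1]
  · rw [h2]
  · rw [h3]
  · rw [h k h1 h2 h3]

/-- Only the letters `j`, `j + 1`, `j + 2` move, so each of the four edges is one of the
configurations above. The second half is needed because weights are bounded below only up to
duality: raising and lowering with exchanged roles produce the same move. -/
theorem ffee_threeCols {K j p q s p' q' s' : ℕ} (M : ℕ → ℕ → ℕ) (b1 : 1 ≤ p ∧ p ≤ K)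
    (b2 : 1 ≤ q ∧ q ≤ K) (b3 : 1 ≤ s ∧ s ≤ K) (h1 : p < q) (h2 : s ≤ q)
    (h3 : (p < s ∧ p' = q ∧ q' = p ∧ s' = s) ∨ (s ≤ p ∧ p' = p ∧ q' = s ∧ s' = q)) :
    (tabStem K).FFEE (j + 1) j (mkTab (threeCols M j (unitCol p) (unitCol q) (unitCol s)) K 1)
      (mkTab (threeCols M j (unitCol p') (unitCol q') (unitCol s')) K 1) ∧
    (tabStem K).dual.FFEE (j + 1) j
      (mkTab (threeCols M j (unitCol p) (unitCol q) (unitCol s)) K 1)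
      (mkTab (threeCols M j (unitCol p') (unitCol q') (unitCol s')) K 1) := by
  let T (A B D : ℕ → ℕ) := mkTab (threeCols M j A B D) K 1
  rcases h3 with ⟨h3, e1, e2, e3⟩ | ⟨h3, e1, e2, e3⟩ <;> rw [e1, e2, e3] <;> constructor
  · exact ⟨T (unitCol p) (unitCol q + unitCol s) 0, T (unitCol p + unitCol q) (unitCol s) 0,
      T (unitCol p + unitCol q) 0 (unitCol s),
      edge_pair_zero (pairCols_high _ _ _ _ _ _ _) h2 b3.1 b2.2,
      edge_pair_one (pairCols_low _ _ _ _ _ _ _) h3 h2 b1.1 b2.2,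
      edge_one_zero (pairCols_high _ _ _ _ _ _ _) b3.1 b3.2,
      edge_pair_zero (by rw [add_comm]; exact pairCols_low _ _ _ _ _ _ _) h1.le b1.1 b2.2⟩
  · exact ⟨T (unitCol p) 0 (unitCol q + unitCol s), T 0 (unitCol p) (unitCol q + unitCol s),
      T 0 (unitCol p + unitCol q) (unitCol s),
      edge_one_one (pairCols_high _ _ _ _ _ _ _) h2 b3.1 b2.2,
      edge_one_zero (pairCols_low _ _ _ _ _ _ _) b1.1 b1.2,
      edge_pair_one (pairCols_high _ _ _ _ _ _ _) h3 h2 b1.1 b2.2,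
      edge_one_one (by rw [add_comm (unitCol p)]; exact pairCols_low _ _ _ _ _ _ _) h1.le b1.1
        b2.2⟩
  · exact ⟨T (unitCol p) (unitCol q + unitCol s) 0, T (unitCol p + unitCol s) (unitCol q) 0,
      T (unitCol p + unitCol s) 0 (unitCol q),
      edge_pair_zero (pairCols_high _ _ _ _ _ _ _) h2 b3.1 b2.2,
      edge_pair_one' (pairCols_low _ _ _ _ _ _ _) h3 h1 b3.1 b2.2,
      edge_one_zero (pairCols_high _ _ _ _ _ _ _) b2.1 b2.2,
      edge_pair_zero (pairCols_low _ _ _ _ _ _ _) h3 b3.1 b1.2⟩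
  · exact ⟨T (unitCol p) 0 (unitCol q + unitCol s), T 0 (unitCol p) (unitCol q + unitCol s),
      T 0 (unitCol p + unitCol s) (unitCol q),
      edge_one_one (pairCols_high _ _ _ _ _ _ _) h2 b3.1 b2.2,
      edge_one_zero (pairCols_low _ _ _ _ _ _ _) b1.1 b1.2,
      edge_pair_one' (pairCols_high _ _ _ _ _ _ _) h3 h1 b3.1 b2.2,
      edge_one_one (pairCols_low _ _ _ _ _ _ _) h3 b3.1 b1.2⟩

theorem KnuthStep.ffee {K j : ℕ} {r r' : ℕ → ℕ} (h : KnuthStep j r r')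
    (hr : ∀ k, j ≤ k → k ≤ j + 2 → 1 ≤ r k ∧ r k ≤ K) :
    (tabStem K).FFEE (j + 1) j (mkTab (rowOf r) K 1) (mkTab (rowOf r') K 1) ∧
    (tabStem K).dual.FFEE (j + 1) j (mkTab (rowOf r) K 1) (mkTab (rowOf r') K 1) := by
  have key := ffee_threeCols (K := K) (j := j) (rowOf r) (hr j le_rfl (by omega))
    (hr (j + 1) (by omega) (by omega)) (hr (j + 2) (by omega) le_rfl) h.1.1 h.1.2 h.2.1
  rwa [← rowOf_eq_threeCols h.2.2, ← rowOf_eq_threeCols (r' := r) fun _ _ _ _ => rfl] at key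

/-! ### Standard tableaux as ballot words -/

/-- The row words of standard tableaux of shape `lam` and size `m`. -/
structure Ballot (m : ℕ) (lam : ℕ → ℕ) (r : ℕ → ℕ) : Prop where
  pos : ∀ {k}, 1 ≤ k → k ≤ m → 1 ≤ r k ∧ r k ≤ m
  out : ∀ {k}, ¬ (1 ≤ k ∧ k ≤ m) → r k = 0
  shape : ∀ a, 1 ≤ a → upTo (rowOf r a) m = lam a
  ballot : ∀ a k, 1 ≤ a → upTo (rowOf r (a + 1)) k ≤ upTo (rowOf r a) k

theorem rowOf_zero {r : ℕ → ℕ} {b : ℕ} (h : r 0 = 0) (hb : 1 ≤ b) : rowOf r b 0 = 0 := by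
  rw [rowOf, unitCol, h, if_neg (by omega)]

theorem upTo_zero_rowOf {r : ℕ → ℕ} {b : ℕ} (h : r 0 = 0) (hb : 1 ≤ b) :
    upTo (rowOf r b) 0 = 0 := by
  simp [upTo, rowOf_zero h hb]

theorem upTo_le_succ_of_semiStd {K a b : ℕ} {c : ℕ → ℕ} {M : ℕ → ℕ → ℕ}
    (h : SemiStd K c (mkTab M K a)) (hab : a ≤ b) (hb : b + 1 < a + K) (k : ℕ) :
    upTo (M (b + 1)) (k + 1) ≤ upTo (M b) k := by
  induction K generalizing a c with
  | zero => omega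
  | succ K ih =>
    obtain ⟨-, -, h⟩ := h
    by_cases hb' : b = a
    · subst hb'
      cases K with
      | zero => omega
      | succ K => exact h.2.1 k
    · exact ih h (by omega) (by omega)

theorem hasShape_mkTab {m : ℕ} {lam : ℕ → ℕ} {K a b : ℕ} {M : ℕ → ℕ → ℕ}
    (h : HasShape m lam K a (mkTab M K a)) (hab : a ≤ b) (hb : b < a + K) :
    upTo (M b) m = lam b ∧ M b 0 = 0 ∧ (∀ k, m < k → M b k = 0) := by
  induction K generalizing a with
  | zero => omega
  | succ K ih =>
    obtain ⟨h1, h2, h3, h4⟩ := h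
    by_cases hb' : b = a
    · subst hb'
      exact ⟨h1, h2, h3⟩
    · exact ih h4 (by omega) (by omega)

theorem upTo_mono (c : ℕ → ℕ) {k l : ℕ} (h : k ≤ l) : upTo c k ≤ upTo c l :=
  Finset.sum_le_sum_of_subset (Finset.range_mono (by omega))

/-- A tableau with each letter at most once is given by a word. -/
theorem exists_word {K a : ℕ} (ha : 1 ≤ a) (y : Tab K) (h : ∀ k, letterCount K k y ≤ 1) :
    ∃ r, y = mkTab (rowOf r) K a ∧ (∀ k, letterCount K k y = 1 → a ≤ r k ∧ r k < a + K) ∧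
      ∀ k, letterCount K k y = 0 → r k = 0 := by
  induction K generalizing a with
  | zero => exact ⟨0, rfl, fun k hk => by simp [letterCount] at hk, fun k _ => rfl⟩
  | succ K ih =>
    obtain ⟨c, y⟩ := y
    simp only [letterCount] at h ⊢
    obtain ⟨r, h1, h2, h3⟩ := ih (a := a + 1) (by omega) y fun k => by have := h k; omega
    refine ⟨fun k => if c k = 1 then a else r k, ?_, fun k hk => ?_, fun k hk => ?_⟩
    · rw [mkTab]
      have hc : c = rowOf (fun k => if c k = 1 then a else r k) a := by
        ext k
        have := h k
        simp only [rowOf, unitCol]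
        split_ifs with h4 h5 h5
        · exact h4
        · omega
        · by_cases h6 : letterCount K k y = 1
          · have := h2 k h6; omega
          · have := h3 k (by omega); omega
        · omega
      rw [← hc, h1]
      refine congrArg _ (mkTab_congr fun b hb _ => ?_)
      ext k
      simp only [rowOf, unitCol]
      by_cases h4 : c k = 1
      · have := h3 k (by have := h k; omega)
        simp only [h4, if_true]
        rw [if_neg (by omega), if_neg (by omega)]
      · simp only [h4, if_false]
    · simp only
      split_ifs with h4
      · omega
      · have := h2 k (by have := h k; omega)
        omega
    · simp only
      rw [if_neg (by omega)]
      exact h3 k (by omega)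

theorem sum_letterCount {m : ℕ} {lam : ℕ → ℕ} {K a : ℕ} {y : Tab K}
    (h : HasShape m lam K a y) :
    ∑ k ∈ Finset.Icc 1 m, letterCount K k y = ∑ b ∈ Finset.Ico a (a + K), lam b := by
  induction K generalizing a with
  | zero => simp [letterCount]
  | succ K ih =>
    obtain ⟨c, y⟩ := y
    obtain ⟨h1, h2, h3, h4⟩ := h
    simp only [letterCount]
    rw [Finset.sum_add_distrib, ih h4,
      Finset.sum_eq_sum_Ico_succ_bot (show a < a + (K + 1) by omega),
      add_right_comm a 1 K, ← add_assoc a K 1]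
    congr 1
    rw [← h1, upTo, Finset.sum_range_eq_add_Ico _ (by omega), h2, zero_add]
    rfl

theorem letterCount_out {m : ℕ} {lam : ℕ → ℕ} {K a k : ℕ} {y : Tab K}
    (h : HasShape m lam K a y) (hk : ¬ (1 ≤ k ∧ k ≤ m)) : letterCount K k y = 0 := by
  induction K generalizing a with
  | zero => rfl
  | succ K ih =>
    obtain ⟨c, y⟩ := y
    obtain ⟨h1, h2, h3, h4⟩ := h
    rw [letterCount, ih h4]
    rcases Nat.eq_zero_or_pos k with rfl | hk0
    · rw [h2]
    · rw [h3 k (by omega)]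

/-- Weight zero makes all letters equally frequent, and there are `m` letters in total, so each
occurs once. For such tableaux the shifted column condition implies the unshifted ballot condition.
-/
theorem exists_ballot {m : ℕ} {lam : ℕ → ℕ} (hlam : ∑ b ∈ Finset.Ico 1 (1 + m), lam b = m)
    (hlam0 : ∀ b, m < b → lam b = 0)
    {y : Tab m} (hy : HasShape m lam m 1 y) (hs : ∃ c, SemiStd m c y)
    (hz : ∀ i ∈ colours m, (tabStem m).f i y = (tabStem m).e i y) :
    ∃ r, Ballot m lam r ∧ y = mkTab (rowOf r) m 1 := by
  have h1 : ∀ k, 1 ≤ k → k ≤ m → letterCount m k y = letterCount m 1 y := by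
    intro k hk
    induction k, hk using Nat.le_induction with
    | base => intro _; rfl
    | succ k hk ih =>
      intro hkm
      have := tab_wt (i := k) y
      have := hz k ⟨hk, hkm⟩
      have := ih (by omega)
      omega
  have h2 : ∀ k, 1 ≤ k → k ≤ m → letterCount m k y = 1 := by
    intro k hk hkm
    have h3 := sum_letterCount hy
    rw [hlam, Finset.sum_congr rfl fun k hk =>
      h1 k (Finset.mem_Icc.1 hk).1 (Finset.mem_Icc.1 hk).2, Finset.sum_const, Nat.card_Icc,
      smul_eq_mul, Nat.add_sub_cancel] at h3
    rw [h1 k hk hkm]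
    exact Nat.eq_of_mul_eq_mul_left (show 0 < m by omega) (by rw [h3, mul_one])
  obtain ⟨r, hr, hr1, hr0⟩ := exists_word (a := 1) le_rfl y fun k => by
    by_cases hk : 1 ≤ k ∧ k ≤ m
    · rw [h2 k hk.1 hk.2]
    · rw [letterCount_out hy hk]; omega
  have out : ∀ {k}, ¬ (1 ≤ k ∧ k ≤ m) → r k = 0 := fun hk => hr0 _ (letterCount_out hy hk)
  have pos : ∀ {k}, 1 ≤ k → k ≤ m → 1 ≤ r k ∧ r k ≤ m := fun hk hkm => by
    have := hr1 _ (h2 _ hk hkm)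
    omega
  have hbig : ∀ a, m < a → ∀ k, upTo (rowOf r a) k = 0 := by
    intro a ha k
    refine Finset.sum_eq_zero fun j _ => ?_
    rw [rowOf, unitCol, if_neg]
    by_cases hj : 1 ≤ j ∧ j ≤ m
    · have := pos hj.1 hj.2; omega
    · have := out hj; omega
  rw [hr] at hy hs
  refine ⟨r, ⟨pos, out, fun a ha => ?_, fun a k ha => ?_⟩, hr⟩
  · by_cases ham : a ≤ m
    · exact (hasShape_mkTab hy ha (by omega)).1
    · rw [hbig a (by omega), hlam0 a (by omega)]
  · by_cases ham : a + 1 ≤ m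
    · obtain ⟨c, hc⟩ := hs
      exact (upTo_mono _ (Nat.le_succ k)).trans (upTo_le_succ_of_semiStd hc ha (by omega) k)
    · rw [hbig (a + 1) (by omega)]; omega

/-- The single letter `i + 1` is unpaired exactly when the single `i` is not in a higher row. -/
theorem Ballot.e_eq {m : ℕ} {lam r : ℕ → ℕ} (h : Ballot m lam r) {i : ℕ} (hi : i ∈ colours m) :
    (tabStem m).e i (mkTab (rowOf r) m 1) = if r (i + 1) ≤ r i then 1 else 0 := by
  obtain ⟨hi1, hi2⟩ := hi
  have h1 := h.pos hi1 hi2.le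
  have h2 := h.pos (k := i + 1) (by omega) hi2
  obtain ⟨h3, h4⟩ := e_mkTab (M := rowOf r) (K := m) (a := 1) (i := i) (s := r (i + 1))
    (fun b _ => rfl) (by omega)
  split_ifs with hle
  · refine h3 ⟨h2.1, fun b hb hb' => ?_⟩
    rw [rowOf, unitCol, if_neg (by omega)]
  · refine h4 fun hc => ?_
    have := hc.2 (r i) h1.1 (by omega)
    simp [rowOf, unitCol] at this

theorem letterCount_word {m : ℕ} {r : ℕ → ℕ} {k : ℕ} (h : 1 ≤ r k ∧ r k ≤ m) :
    letterCount m k (mkTab (rowOf r) m 1) = 1 := by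
  rw [letterCount_mkTab]
  simp only [rowOf, unitCol, Finset.sum_ite_eq', Finset.mem_Ico]
  rw [if_pos (by omega)]

theorem isZero_word {m : ℕ} {r : ℕ → ℕ} {i : ℕ} (h : 1 ≤ r i ∧ r i ≤ m)
    (h' : 1 ≤ r (i + 1) ∧ r (i + 1) ≤ m) :
    (tabStem m).f i (mkTab (rowOf r) m 1) = (tabStem m).e i (mkTab (rowOf r) m 1) := by
  have := tab_wt (K := m) (i := i) (mkTab (rowOf r) m 1)
  rw [letterCount_word h, letterCount_word h'] at this
  omega

/-! ### Weight zero vertices as standard tableaux -/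

open Stem

/-- The zero weight vertices of the component of `v` correspond to the row words of the standard
tableaux of shape `lam`. -/
structure WordModel {m : ℕ} {V : Type u} (S : Stem (colours m) V) (v : V) (lam : ℕ → ℕ)
    (P : V → (ℕ → ℕ) → Prop) : Prop where
  ballot : ∀ {w r}, P w r → Ballot m lam r
  reach : ∀ {w r}, P w r → S.Reach v w 0
  exists_word : ∀ {w}, S.Reach v w 0 → ∃ r, P w r
  right_unique : ∀ {w r r'}, P w r → P w r' → r = r'
  left_unique : ∀ {w w' r}, P w r → P w' r → w = w'
  e_eq : ∀ {w r i}, P w r → i ∈ colours m → S.e i w = if r (i + 1) ≤ r i then 1 else 0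
  ffee : ∀ {w r r' j}, P w r → 1 ≤ j → j + 2 ≤ m → KnuthStep j r r' →
    ∃ w', P w' r' ∧ S.FFEE (j + 1) j w w'
  ffee' : ∀ {w r r' j}, P w r → 1 ≤ j → j + 2 ≤ m → KnuthStep j r' r →
    ∃ w', P w' r' ∧ S.FFEE j (j + 1) w w'

theorem word_inj {m : ℕ} {lam r r' : ℕ → ℕ} (h : ∀ k, 1 ≤ k → k ≤ m → 1 ≤ r k ∧ r k ≤ m)
    (h0 : ∀ k, ¬ (1 ≤ k ∧ k ≤ m) → r k = 0) (h' : Ballot m lam r')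
    (he : mkTab (rowOf r) m 1 = mkTab (rowOf r') m 1) : r = r' := by
  ext k
  by_cases hk : 1 ≤ k ∧ k ≤ m
  · have h1 := h k hk.1 hk.2
    have h2 := congrFun (mkTab_inj he (r k) h1.1 (by omega)) k
    simp only [rowOf, unitCol, if_true] at h2
    by_contra hne
    rw [if_neg hne] at h2
    omega
  · rw [h0 k hk, h'.out hk]

/-- The crystal of tableaux, restricted to the letters `1, …, m`. -/
noncomputable def tabStemRestrict (m : ℕ) : Stem (colours m) (Tab m) :=
  (tabStem m).pull 0 (colours m) fun _ _ => trivial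

theorem restrict_e {m i : ℕ} {y : Tab m} (hi : i ∈ colours m) :
    (tabStemRestrict m).e i y = (tabStem m).e i y := if_pos hi

theorem restrict_f {m i : ℕ} {y : Tab m} (hi : i ∈ colours m) :
    (tabStemRestrict m).f i y = (tabStem m).f i y := if_pos hi

theorem semiStd_reach {m : ℕ} {lam : ℕ → ℕ} {y z : Tab m} {μ : ℕ → ℤ}
    (h : (tabStemRestrict m).Reach y z μ) (hy : HasShape m lam m 1 y ∧ ∃ c, SemiStd m c y) :
    HasShape m lam m 1 z ∧ ∃ c, SemiStd m c z := by
  induction h with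
  | refl => exact hy
  | up _ h ih =>
    exact ⟨(hasShape_edge h.1 h.2).2 ih.1, exists_semiStd_of_raise h.1.1 h.2 ih.2⟩
  | down _ h ih =>
    exact ⟨(hasShape_edge h.1 h.2).1 ih.1, exists_semiStd_of_lower h.1.1 h.2 ih.2⟩

theorem exists_semiStd_mkTab {M : ℕ → ℕ → ℕ} {K a : ℕ} (h0 : M a 0 = 0)
    (h : ∀ K, SemiStd K (M a) (mkTab M K (a + 1))) : ∃ c, SemiStd K c (mkTab M K a) := by
  cases K with
  | zero => exact ⟨0, trivial⟩
  | succ K =>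
    exact ⟨fun k => upTo (M a) (k + 1), h0, fun k =>
      Finset.single_le_sum (f := fun k => upTo (M a) (k + 1)) (fun _ _ => Nat.zero_le _)
        (Finset.self_mem_range_succ k), h K⟩

theorem diag_f {lam : ℕ → ℕ} {m i : ℕ} (hlam : ∀ i, 1 ≤ i → lam (i + 1) ≤ lam i)
    (hi : i ∈ colours m) :
    (tabStem m).f i (mkTab (diagRow lam) m 1) + lam (i + 1) = lam i := by
  obtain ⟨h1, h2⟩ := hi
  have h3 := tab_wt (K := m) (i := i) (mkTab (diagRow lam) m 1)
  rw [(e_diag hlam le_rfl).2.2 h1, letterCount_mkTab, letterCount_mkTab, zero_add] at h3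
  simp only [diagRow, Finset.sum_ite_eq, Finset.mem_Ico] at h3
  rwa [if_pos (by omega), if_pos (by omega)] at h3

theorem Stem.FFEE.reach {m : ℕ} {V : Type u} {S : Stem (colours m) V} {v w w' : V} {i j : ℕ}
    {μ : ℕ → ℤ} (h : S.FFEE i j w w') (hw : S.Reach v w μ) : ∃ ν, S.Reach v w' ν := by
  obtain ⟨a, b, c, h1, h2, h3, h4⟩ := h
  exact ⟨_, (((hw.up h1).up h2).down h3).down h4⟩

theorem KnuthStep.mem_iff {j m : ℕ} {r r' : ℕ → ℕ} (h : KnuthStep j r r') (hj : 1 ≤ j)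
    (hjm : j + 2 ≤ m) :
    ((∀ k, 1 ≤ k → k ≤ m → 1 ≤ r k ∧ r k ≤ m) ↔ (∀ k, 1 ≤ k → k ≤ m → 1 ≤ r' k ∧ r' k ≤ m)) ∧
    ((∀ k, ¬ (1 ≤ k ∧ k ≤ m) → r k = 0) ↔ (∀ k, ¬ (1 ≤ k ∧ k ≤ m) → r' k = 0)) := by
  obtain ⟨-, h1, h2⟩ := h
  refine ⟨?_, ?_⟩
  · constructor <;> intro h k hk hkm
    all_goals
      have e0 := h j hj (by omega)
      have e1 := h (j + 1) (by omega) (by omega)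
      have e2 := h (j + 2) (by omega) (by omega)
      have e3 := h k hk hkm
      by_cases c0 : k = j
      · subst c0; omega
      by_cases c1 : k = j + 1
      · subst c1; omega
      by_cases c2 : k = j + 2
      · subst c2; omega
      have := h2 k c0 c1 c2
      omega
  · refine forall_congr' fun k => forall_congr' fun hk => ?_
    rw [h2 k (by omega) (by omega) (by omega)]

theorem reach_dual_zero {C : Set ℕ} {V : Type u} {S : Stem C V} {v w : V} :
    S.dual.Reach v w 0 ↔ S.Reach v w 0 := by
  constructor <;> intro h <;> have h1 := h.dual <;> rw [neg_zero] at h1 <;> exact h1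

/-- The highest weight shifted by 1 is a partition of `m`, and uniqueness identifies the component
with that of the highest weight tableau. Both models use the same words, since `FFEE` and its dual
realize the same moves. -/
theorem exists_wordModel_aux {m : ℕ} {V : Type u} {S : Stem (colours m) V} {v : V}
    (hv : S.IsZero v) (H : S.ZeroOne v) (hpos : ∀ μ ∈ S.weights v, ∀ k, -1 ≤ μ k) :
    ∃ lam P, WordModel S v lam P ∧ WordModel S.dual v lam P := by
  obtain ⟨u, ν, hu, hu0, -⟩ := exists_highest hv H .refl
  obtain ⟨lam, hlamν, hlam0⟩ : ∃ lam : ℕ → ℕ, (∀ k, 1 ≤ k → k ≤ m → (lam k : ℤ) = ν k + 1) ∧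
      ∀ k, ¬ (1 ≤ k ∧ k ≤ m) → lam k = 0 := by
    refine ⟨fun k => if 1 ≤ k ∧ k ≤ m then (ν k + 1).toNat else 0, fun k h1 h2 => ?_,
      fun k hk => if_neg hk⟩
    have := hpos ν ⟨u, hu⟩ k
    simp only [h1, h2, and_self, if_true]
    omega
  have hlam : ∀ i, 1 ≤ i → lam (i + 1) ≤ lam i := by
    intro i hi
    by_cases him : i < m
    · have h1 := hu.wt hv (j := i) ⟨hi, him⟩
      have h2 := hu0 i ⟨hi, him⟩
      have h3 := hlamν i hi him.le
      have h4 := hlamν (i + 1) (by omega) him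
      omega
    · rw [hlam0 (i + 1) (by omega)]; omega
  have hsum : ∑ b ∈ Finset.Ico 1 (1 + m), lam b = m := by
    have h1 : ∑ b ∈ Finset.Icc 1 m, (lam b : ℤ) = m := by
      rw [Finset.sum_congr rfl fun k hk =>
        hlamν k (Finset.mem_Icc.1 hk).1 (Finset.mem_Icc.1 hk).2, Finset.sum_add_distrib, hu.sum]
      simp
    rw [show Finset.Ico 1 (1 + m) = Finset.Icc 1 m by ext k; simp; omega]
    exact_mod_cast h1
  have hlam0' : ∀ b, m < b → lam b = 0 := fun b hb => hlam0 b (by omega)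
  have hd0 : ∀ i ∈ colours m, (tabStemRestrict m).e i (mkTab (diagRow lam) m 1) = 0 :=
    fun i hi => by rw [restrict_e hi, (e_diag hlam le_rfl).2.2 hi.1]
  obtain ⟨R, hR, hRu, -⟩ := exists_partialIso (A := S) (B := tabStemRestrict m) (u := u)
    (u' := mkTab (diagRow lam) m 1) hu0 hd0 (by
      intro i hi
      have h1 := hu.wt hv hi
      have h2 := hu0 i hi
      have h3 := hlamν i hi.1 hi.2.le
      have h4 := hlamν (i + 1) (by omega) hi.2
      have h5 := diag_f hlam hi
      rw [restrict_f hi]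
      omega)
  have inv : HasShape m lam m 1 (mkTab (diagRow lam) m 1) ∧
      ∃ c, SemiStd m c (mkTab (diagRow lam) m 1) :=
    ⟨hasShape_diag le_rfl (by omega), exists_semiStd_mkTab
      (by rw [diagRow, if_neg (by omega)]) fun K =>
      semiStd_diag hlam le_rfl⟩
  have word : ∀ {w}, S.Reach v w 0 → ∃ r, R w (mkTab (rowOf r) m 1) ∧ Ballot m lam r := by
    intro w hw
    obtain ⟨y, hy, hyr⟩ := hR.reach hRu (hu.symm.trans hw)
    obtain ⟨hs, hss⟩ := semiStd_reach hyr inv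
    have hz := (hw.isZero_iff hv).2 rfl
    obtain ⟨r, hr, rfl⟩ := exists_ballot hsum hlam0' hs hss fun i hi => by
      rw [← restrict_e hi, ← restrict_f hi, ← hR.e_eq hy hi, ← hR.f_eq hy hi, hz i hi]
    exact ⟨r, hy, hr⟩
  have zero : ∀ {w r μ}, S.Reach v w μ → R w (mkTab (rowOf r) m 1) →
      (∀ k, 1 ≤ k → k ≤ m → 1 ≤ r k ∧ r k ≤ m) → S.Reach v w 0 := by
    intro w r μ hw hwr hr
    have : μ = 0 := (hw.isZero_iff hv).1 fun i hi => by
      rw [hR.e_eq hwr hi, hR.f_eq hwr hi, restrict_e hi, restrict_f hi]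
      exact isZero_word (hr i hi.1 hi.2.le) (hr (i + 1) (by omega) hi.2)
    exact this ▸ hw
  -- That a move preserves shape and the ballot condition need not be checked combinatorially: its
  -- result is the tableau of a weight zero vertex of the component, and such tableaux come from
  -- ballot words of shape `lam`.
  have lift : ∀ {w w' r r' j}, S.Reach v w 0 → Ballot m lam r → 1 ≤ j → j + 2 ≤ m →
      Knuth j r r' → R w' (mkTab (rowOf r') m 1) → (∃ μ, S.Reach v w' μ) →
      Ballot m lam r' ∧ S.Reach v w' 0 := by
    intro w w' r r' j hw hr hj hjm hk hw' ⟨μ, hμ⟩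
    have h1 : ∀ k, 1 ≤ k → k ≤ m → 1 ≤ r' k ∧ r' k ≤ m := by
      rcases hk with hk | hk
      · exact (hk.mem_iff hj hjm).1.1 fun k => hr.pos
      · exact (hk.mem_iff hj hjm).1.2 fun k => hr.pos
    have h2 : ∀ k, ¬ (1 ≤ k ∧ k ≤ m) → r' k = 0 := by
      rcases hk with hk | hk
      · exact (hk.mem_iff hj hjm).2.1 fun k => hr.out
      · exact (hk.mem_iff hj hjm).2.2 fun k => hr.out
    have h3 := zero hμ hw' h1
    obtain ⟨r'', h4, h5⟩ := word h3
    obtain rfl := word_inj h1 h2 h5 (hR.right_unique hw' h4)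
    exact ⟨h5, h3⟩
  have restr : ∀ {i j y z}, i ∈ colours m → j ∈ colours m →
      ((tabStem m).FFEE i j y z → (tabStemRestrict m).FFEE i j y z) ∧
      ((tabStem m).dual.FFEE i j y z → (tabStemRestrict m).dual.FFEE i j y z) := by
    intro i j y z hi hj
    constructor <;> rintro ⟨a, b, c, h1, h2, h3, h4⟩ <;>
    exact ⟨a, b, c, ⟨hi, h1⟩, ⟨hj, h2⟩, ⟨hi, h3⟩, ⟨hj, h4⟩⟩
  have words : ∀ {r r'}, Ballot m lam r → Ballot m lam r' →
      mkTab (rowOf r) m 1 = mkTab (rowOf r') m 1 → r = r' := fun hr hr' h =>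
    word_inj (fun k => hr.pos) (fun k => hr.out) hr' h
  refine ⟨lam, fun w r => R w (mkTab (rowOf r) m 1) ∧ Ballot m lam r ∧ S.Reach v w 0, ?_, ?_⟩
  · constructor
    · exact fun h => h.2.1
    · exact fun h => h.2.2
    · intro w hw
      obtain ⟨r, h1, h2⟩ := word hw
      exact ⟨r, h1, h2, hw⟩
    · exact fun h h' => words h.2.1 h'.2.1 (hR.right_unique h.1 h'.1)
    · exact fun h h' => hR.left_unique h.1 h'.1
    · intro w r i h hi
      rw [hR.e_eq h.1 hi, restrict_e hi, h.2.1.e_eq hi]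
    · intro w r r' j h hj hjm hk
      have h1 := (restr ⟨by omega, by omega⟩ ⟨hj, by omega⟩).1
        (hk.ffee fun k _ _ => h.2.1.pos (by omega) (by omega)).1
      obtain ⟨w', h2, h3⟩ := hR.symm.ffee h.1 h1
      exact ⟨w', ⟨h3, lift h.2.2 h.2.1 hj hjm (Or.inl hk) h3 (h2.reach h.2.2)⟩, h2⟩
    · intro w r r' j h hj hjm hk
      have hr' := (hk.mem_iff hj hjm).1.2 fun k => h.2.1.pos
      have h1 := (restr ⟨by omega, by omega⟩ ⟨hj, by omega⟩).1
        (hk.ffee fun k _ _ => hr' k (by omega) (by omega)).1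
      obtain ⟨w', h2, h3⟩ := hR.symm.ffee h.1 h1.symm
      exact ⟨w', ⟨h3, lift h.2.2 h.2.1 hj hjm (Or.inr hk) h3 (h2.reach h.2.2)⟩, h2⟩
  · constructor
    · exact fun h => h.2.1
    · exact fun h => reach_dual_zero.2 h.2.2
    · intro w hw
      obtain ⟨r, h1, h2⟩ := word (reach_dual_zero.1 hw)
      exact ⟨r, h1, h2, reach_dual_zero.1 hw⟩
    · exact fun h h' => words h.2.1 h'.2.1 (hR.right_unique h.1 h'.1)
    · exact fun h h' => hR.left_unique h.1 h'.1
    · intro w r i h hi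
      -- The dual `e` is `f`, which agrees with `e` at weight zero.
      rw [← h.2.1.e_eq hi, ← restrict_e hi, ← hR.e_eq h.1 hi]
      exact (h.2.2.isZero_iff hv).2 rfl i hi
    · intro w r r' j h hj hjm hk
      have h1 := (restr ⟨by omega, by omega⟩ ⟨hj, by omega⟩).2
        (hk.ffee fun k _ _ => h.2.1.pos (by omega) (by omega)).2
      obtain ⟨w', h2, h3⟩ := hR.dual.symm.ffee h.1 h1
      obtain ⟨μ, hμ⟩ := h2.reach (reach_dual_zero.2 h.2.2)
      exact ⟨w', ⟨h3, lift h.2.2 h.2.1 hj hjm (Or.inl hk) h3 ⟨_, hμ.dual⟩⟩, h2⟩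
    · intro w r r' j h hj hjm hk
      have hr' := (hk.mem_iff hj hjm).1.2 fun k => h.2.1.pos
      have h1 := (restr ⟨by omega, by omega⟩ ⟨hj, by omega⟩).2
        (hk.ffee fun k _ _ => hr' k (by omega) (by omega)).2
      obtain ⟨w', h2, h3⟩ := hR.dual.symm.ffee h.1 h1.symm
      obtain ⟨μ, hμ⟩ := h2.reach (reach_dual_zero.2 h.2.2)
      exact ⟨w', ⟨h3, lift h.2.2 h.2.1 hj hjm (Or.inr hk) h3 ⟨_, hμ.dual⟩⟩, h2⟩

/-- The zero weight vertices of a component are described by standard tableaux. -/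
theorem exists_wordModel {m : ℕ} {V : Type u} {S : Stem (colours m) V} {v : V}
    (hv : S.IsZero v) (H : S.ZeroOne v) : ∃ lam P, WordModel S v lam P := by
  rcases weights_one_sided hv H with hpos | hpos
  · obtain ⟨lam, P, h, -⟩ := exists_wordModel_aux hv H hpos
    exact ⟨lam, P, h⟩
  · have H' : S.dual.ZeroOne v := by
      intro x hx i hi
      have h1 := reach_dual_zero.1 hx
      have h2 := (h1.isZero_iff hv).2 rfl i hi
      have h3 := H x h1 i hi
      rw [← h2] at h3
      exact h3
    obtain ⟨lam, P, -, h⟩ := exists_wordModel_aux (isZero_dual.2 hv) H' hpos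
    exact ⟨lam, P, h⟩

/-! ### Connecting words with at most one move at the last position -/

/-- The number of positions `≤ k` with `r j = a`. -/
abbrev rowCount (r : ℕ → ℕ) (a k : ℕ) : ℕ := upTo (rowOf r a) k

/-- Row words of standard tableaux of size `m`. -/
structure IsBallot (m : ℕ) (r : ℕ → ℕ) : Prop where
  pos : ∀ {k}, 1 ≤ k → k ≤ m → 1 ≤ r k
  out : ∀ {k}, ¬ (1 ≤ k ∧ k ≤ m) → r k = 0
  ballot : ∀ a k, 1 ≤ a → rowCount r (a + 1) k ≤ rowCount r a k

theorem rowCount_succ (r : ℕ → ℕ) (a k : ℕ) :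
    rowCount r a (k + 1) = rowCount r a k + if a = r (k + 1) then 1 else 0 := upTo_succ _ _

theorem rowCount_congr {r r' : ℕ → ℕ} {a k : ℕ} (h : ∀ j, j ≤ k → r j = r' j) :
    rowCount r a k = rowCount r' a k :=
  Finset.sum_congr rfl fun j hj => by
    rw [rowOf, rowOf, h j (Nat.lt_succ_iff.1 (Finset.mem_range.1 hj))]

/-- A letter in row `a + 1` requires an earlier one in row `a`, so row numbers grow by at most one
per position. -/
theorem IsBallot.le {m : ℕ} {r : ℕ → ℕ} (h : IsBallot m r) (k : ℕ) : r k ≤ k := by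
  induction k using Nat.strong_induction_on with
  | _ k ih =>
    by_contra hc
    have hk : 1 ≤ k ∧ k ≤ m := by
      by_contra hk
      have := h.out hk
      omega
    obtain ⟨a, ha⟩ : ∃ a, r k = a + 1 := ⟨r k - 1, by omega⟩
    have h1 := h.ballot a k (by omega)
    have h2 : 0 < rowCount r (a + 1) k := by
      obtain ⟨k, rfl⟩ := Nat.exists_eq_add_of_le' hk.1
      rw [rowCount_succ, if_pos ha.symm]
      omega
    obtain ⟨j, hj, hne⟩ := Finset.exists_ne_zero_of_sum_ne_zero (show rowCount r a k ≠ 0 by omega)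
    rw [Finset.mem_range] at hj
    simp only [rowOf, unitCol] at hne
    have hja : a = r j := by
      by_contra hc
      rw [if_neg hc] at hne
      exact hne rfl
    have hjk : j ≠ k := by rintro rfl; omega
    have := ih j (by omega)
    omega

theorem ballot_iff {m : ℕ} {lam r : ℕ → ℕ} :
    Ballot m lam r ↔ IsBallot m r ∧ ∀ a, 1 ≤ a → rowCount r a m = lam a := by
  constructor
  · exact fun h => ⟨⟨fun h1 h2 => (h.pos h1 h2).1, h.out, h.ballot⟩, h.shape⟩
  · exact fun ⟨h, hs⟩ => ⟨fun {k} h1 h2 => ⟨h.pos h1 h2, (h.le k).trans h2⟩, h.out, hs, h.ballot⟩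

theorem rowCount_update_of_lt {r : ℕ → ℕ} {a c k l : ℕ} (h : k < l) :
    rowCount (Function.update r l c) a k = rowCount r a k :=
  rowCount_congr fun j hj => Function.update_of_ne (by omega) _ _

theorem rowCount_update {r : ℕ → ℕ} {a c k : ℕ} :
    rowCount (Function.update r (k + 1) c) a (k + 1) =
      rowCount r a k + if a = c then 1 else 0 := by
  rw [rowCount_succ, rowCount_update_of_lt (Nat.lt_succ_self k), Function.update_self]

theorem IsBallot.init {m : ℕ} {r : ℕ → ℕ} (h : IsBallot (m + 1) r) :
    IsBallot m (Function.update r (m + 1) 0) := by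
  have hout : ∀ {k}, ¬ (1 ≤ k ∧ k ≤ m) → Function.update r (m + 1) 0 k = 0 := by
    intro k hk
    by_cases hkm : k = m + 1
    · rw [hkm, Function.update_self]
    · rw [Function.update_of_ne hkm, h.out (by omega)]
  have hb : ∀ a k, 1 ≤ a → k ≤ m → rowCount (Function.update r (m + 1) 0) (a + 1) k ≤
      rowCount (Function.update r (m + 1) 0) a k := fun a k ha hk => by
    rw [rowCount_update_of_lt (by omega), rowCount_update_of_lt (by omega)]
    exact h.ballot a k ha
  refine ⟨fun h1 h2 => ?_, hout, fun a k ha => ?_⟩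
  · rw [Function.update_of_ne (by omega)]
    exact h.pos h1 (by omega)
  · induction k with
    | zero => exact hb a 0 ha (by omega)
    | succ k ih =>
      by_cases hk : k + 1 ≤ m
      · exact hb a _ ha hk
      · rw [rowCount_succ, rowCount_succ, hout (by omega), if_neg (by omega), if_neg (by omega)]
        exact ih

theorem IsBallot.extend {m c : ℕ} {r : ℕ → ℕ} (h : IsBallot m r) (hc : 1 ≤ c)
    (hb : ∀ a, 1 ≤ a → rowCount r (a + 1) m + (if a + 1 = c then 1 else 0) ≤
      rowCount r a m + if a = c then 1 else 0) :
    IsBallot (m + 1) (Function.update r (m + 1) c) := by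
  have hout : ∀ {k}, ¬ (1 ≤ k ∧ k ≤ m + 1) → Function.update r (m + 1) c k = 0 := by
    intro k hk
    rw [Function.update_of_ne (by omega), h.out (by omega)]
  refine ⟨fun {k} h1 h2 => ?_, hout, fun a k ha => ?_⟩
  · by_cases hkm : k = m + 1
    · rw [hkm, Function.update_self]; exact hc
    · rw [Function.update_of_ne hkm]
      exact h.pos h1 (by omega)
  · induction k with
    | zero =>
      rw [rowCount_update_of_lt (by omega), rowCount_update_of_lt (by omega)]
      exact h.ballot a 0 ha
    | succ k ih =>
      by_cases hk : k + 1 ≤ m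
      · rw [rowCount_update_of_lt (by omega), rowCount_update_of_lt (by omega)]
        exact h.ballot a _ ha
      · by_cases hkm : k = m
        · subst hkm
          rw [rowCount_update, rowCount_update]
          exact hb a ha
        · rw [rowCount_succ, rowCount_succ, hout (by omega), if_neg (by omega),
            if_neg (by omega)]
          exact ih

theorem rowCount_init {m a : ℕ} (r : ℕ → ℕ) :
    rowCount r a (m + 1) = rowCount (Function.update r (m + 1) 0) a m +
      if a = r (m + 1) then 1 else 0 := by
  rw [rowCount_succ, rowCount_update_of_lt (Nat.lt_succ_self m)]

/-- A corner of the shape can be removed. -/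
theorem IsBallot.remove {m d : ℕ} {r : ℕ → ℕ} (h : IsBallot (m + 1) r) (hd : 1 ≤ d)
    (hc : rowCount r (d + 1) (m + 1) < rowCount r d (m + 1)) :
    ∃ s, IsBallot m s ∧
      ∀ a, 1 ≤ a → rowCount r a (m + 1) = rowCount s a m + if a = d then 1 else 0 := by
  induction m generalizing r with
  | zero =>
    have h1 := rowCount_init (m := 0) (a := d) r
    have h2 : rowCount (Function.update r (0 + 1) 0) d 0 = 0 :=
      upTo_zero_rowOf (h.init.out (by omega)) hd
    have h3 : d = r (0 + 1) := by
      by_contra hne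
      rw [if_neg hne] at h1
      omega
    exact ⟨_, h.init, fun a _ => by rw [h3]; exact rowCount_init r⟩
  | succ m ih =>
    by_cases hl : r (m + 1 + 1) = d
    · exact ⟨_, h.init, fun a _ => by rw [← hl]; exact rowCount_init r⟩
    -- The last letter lies in another row: the corner is removed from the initial word and the last
    -- letter is appended again.
    · have e := fun a => rowCount_init (m := m + 1) (a := a) r
      obtain ⟨s, hs, hsc⟩ := ih h.init (by
        have h1 := e d
        have h2 := e (d + 1)
        rw [if_neg (Ne.symm hl)] at h1
        omega)
      have hl1 := h.pos (k := m + 1 + 1) (by omega) le_rfl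
      refine ⟨_, hs.extend hl1 fun a ha => ?_, fun a ha => ?_⟩
      · have h1 := e a
        have h2 := e (a + 1)
        have h3 := hsc a ha
        have h4 := hsc (a + 1) (by omega)
        have h5 := h.ballot a (m + 1 + 1) ha
        by_cases had : a = d
        · subst had
          rw [if_neg (show ¬ a + 1 = a by omega)] at h4
          rw [if_pos rfl] at h3
          omega
        · rw [if_neg had] at h3
          omega
      · rw [rowCount_update, e a, hsc a ha]
        omega

/-- Words joined by elementary dual equivalences at `j` with `j + d ≤ m`. -/
def WordJoined (m d : ℕ) (lam : ℕ → ℕ) : (ℕ → ℕ) → (ℕ → ℕ) → Prop :=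
  Relation.ReflTransGen fun r r' => Ballot m lam r ∧ Ballot m lam r' ∧
    ∃ j, 1 ≤ j ∧ j + d ≤ m ∧ Knuth j r r'

theorem Knuth.symm {j : ℕ} {r r' : ℕ → ℕ} (h : Knuth j r r') : Knuth j r' r := Or.symm h

theorem WordJoined.symm {m d : ℕ} {lam r r' : ℕ → ℕ} (h : WordJoined m d lam r r') :
    WordJoined m d lam r' r := by
  induction h with
  | refl => exact .refl
  | tail _ h ih =>
    obtain ⟨h1, h2, j, h3, h4, h5⟩ := h
    exact .head ⟨h2, h1, j, h3, h4, h5.symm⟩ ih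

theorem KnuthStep.update {j l c : ℕ} {r r' : ℕ → ℕ} (h : KnuthStep j r r') (hl : j + 2 < l) :
    KnuthStep j (Function.update r l c) (Function.update r' l c) := by
  have e : ∀ (s : ℕ → ℕ) k, k ≤ j + 2 → Function.update s l c k = s k := fun s k hk =>
    Function.update_of_ne (by omega) _ _
  obtain ⟨h1, h2, h3⟩ := h
  simp only [KnuthStep, e _ j (by omega), e _ (j + 1) (by omega), e _ (j + 2) le_rfl]
  refine ⟨h1, h2, fun k hk1 hk2 hk3 => ?_⟩
  by_cases hkl : k = l
  · rw [hkl, Function.update_self, Function.update_self]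
  · rw [Function.update_of_ne hkl, Function.update_of_ne hkl, h3 k hk1 hk2 hk3]

/-- The bound `j + 2 ≤ m` turns into `j + 3 ≤ m + 1`: moves on the initial word never touch the
appended letter. -/
theorem wordJoined_extend {m c : ℕ} {lam lam' r r' : ℕ → ℕ}
    (hc : 1 ≤ c) (hlam : ∀ a, 1 ≤ a → lam' a = lam a + if a = c then 1 else 0)
    (hanti : ∀ a, 1 ≤ a → lam' (a + 1) ≤ lam' a) (h : WordJoined m 2 lam r r') :
    WordJoined (m + 1) 3 lam' (Function.update r (m + 1) c) (Function.update r' (m + 1) c) := by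
  have ext : ∀ {x}, Ballot m lam x → Ballot (m + 1) lam' (Function.update x (m + 1) c) := by
    intro x hx
    obtain ⟨h1, h2⟩ := ballot_iff.1 hx
    refine ballot_iff.2 ⟨h1.extend hc fun a ha => ?_, fun a ha => ?_⟩
    · rw [h2 a ha, h2 (a + 1) (by omega), ← hlam a ha, ← hlam (a + 1) (by omega)]
      exact hanti a ha
    · rw [rowCount_update, h2 a ha, hlam a ha]
  induction h with
  | refl => exact .refl
  | tail _ h ih =>
    obtain ⟨hx, hy, j, h1, h2, h3⟩ := h
    exact ih.tail ⟨ext hx, ext hy, j, h1, by omega, h3.imp (fun h => h.update (by omega))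
      fun h => h.update (by omega)⟩

/-- Two words of the same shape are joined with at most one move at the last position. -/
def FewMoves (m : ℕ) (lam r r' : ℕ → ℕ) : Prop :=
  WordJoined m 3 lam r r' ∨ ∃ a b j, j + 2 = m ∧ 1 ≤ j ∧ WordJoined m 3 lam r a ∧
    Ballot m lam a ∧ Ballot m lam b ∧ Knuth j a b ∧ WordJoined m 3 lam b r'

theorem FewMoves.symm {m : ℕ} {lam r r' : ℕ → ℕ} (h : FewMoves m lam r r') :
    FewMoves m lam r' r := by
  rcases h with h | ⟨a, b, j, h1, h2, h3, h4, h5, h6, h7⟩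
  · exact Or.inl h.symm
  · exact Or.inr ⟨b, a, j, h1, h2, h7.symm, h5, h4, h6.symm, h3.symm⟩

theorem FewMoves.joined {m : ℕ} {lam r r' : ℕ → ℕ} (h : FewMoves m lam r r') :
    WordJoined m 2 lam r r' := by
  have mono : ∀ {x y}, WordJoined m 3 lam x y → WordJoined m 2 lam x y := fun h => by
    induction h with
    | refl => exact .refl
    | tail _ h ih =>
      obtain ⟨h1, h2, j, h3, h4, h5⟩ := h
      exact ih.tail ⟨h1, h2, j, h3, by omega, h5⟩
  rcases h with h | ⟨a, b, j, h1, h2, h3, h4, h5, h6, h7⟩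
  · exact mono h
  · exact ((mono h3).tail ⟨h4, h5, j, h2, by omega, h6⟩).trans (mono h7)

theorem joined_of_last_eq {m : ℕ} {lam r r' : ℕ → ℕ}
    (ih : ∀ lam r r', Ballot m lam r → Ballot m lam r' → FewMoves m lam r r')
    (h : Ballot (m + 1) lam r) (h' : Ballot (m + 1) lam r') (he : r (m + 1) = r' (m + 1)) :
    WordJoined (m + 1) 3 lam r r' := by
  obtain ⟨h1, h2⟩ := ballot_iff.1 h
  obtain ⟨h1', h2'⟩ := ballot_iff.1 h'
  have hlam : ∀ a, 1 ≤ a → lam a = rowCount (Function.update r (m + 1) 0) a m +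
      if a = r (m + 1) then 1 else 0 := fun a ha => by rw [← h2 a ha]; exact rowCount_init r
  have hj := (ih (fun a => rowCount (Function.update r (m + 1) 0) a m) _ _
    (ballot_iff.2 ⟨h1.init, fun _ _ => rfl⟩)
    (ballot_iff.2 ⟨h1'.init, fun a ha => by
      have e1 := hlam a ha
      have e2 := rowCount_init (m := m) (a := a) r'
      rw [h2' a ha, ← he] at e2
      omega⟩)).joined
  have := wordJoined_extend (h1.pos (k := m + 1) (by omega) le_rfl) hlam (fun a ha => by
    rw [← h2 a ha, ← h2 (a + 1) (by omega)]; exact h1.ballot a _ ha) hj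
  rw [Function.update_idem, Function.update_eq_self] at this
  rwa [Function.update_idem, he, Function.update_eq_self] at this

/-- Let `c > c'` be the rows of the last letters. Removing both corners and then a corner in row `q
= c - 1` leaves a word `t`. Since `c' ≤ q < c`, the words `t, q, c', c` and `t, q, c, c'` differ by
one move at the last position. Each has the same last letter as one of the given words, so
`joined_of_last_eq` supplies the rest. -/
theorem fewMoves_of_last_lt {m : ℕ} {lam r r' : ℕ → ℕ}
    (ih : ∀ lam r r', Ballot m lam r → Ballot m lam r' → FewMoves m lam r r')
    (h : Ballot (m + 1) lam r) (h' : Ballot (m + 1) lam r') (hlt : r' (m + 1) < r (m + 1)) :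
    FewMoves (m + 1) lam r r' := by
  obtain ⟨h1, h2⟩ := ballot_iff.1 h
  obtain ⟨h1', h2'⟩ := ballot_iff.1 h'
  obtain ⟨c, hc⟩ : ∃ c, r (m + 1) = c := ⟨_, rfl⟩
  obtain ⟨c', hc'⟩ : ∃ c', r' (m + 1) = c' := ⟨_, rfl⟩
  have hc'1 : 1 ≤ c' := hc' ▸ h1'.pos (by omega) le_rfl
  rw [hc, hc'] at hlt
  have e : ∀ a, 1 ≤ a → lam a = rowCount (Function.update r (m + 1) 0) a m +
      if a = c then 1 else 0 := fun a ha => by rw [← h2 a ha, ← hc]; exact rowCount_init r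
  have e' : ∀ a, 1 ≤ a → lam a = rowCount (Function.update r' (m + 1) 0) a m +
      if a = c' then 1 else 0 := fun a ha => by rw [← h2' a ha, ← hc']; exact rowCount_init r'
  have b0 : ∀ a, 1 ≤ a → lam (a + 1) ≤ lam a := fun a ha => by
    rw [← h2 a ha, ← h2 (a + 1) (by omega)]; exact h1.ballot a _ ha
  have b1 := h1.init.ballot
  have b1' := h1'.init.ballot
  have hcorner : lam (c' + 1) < lam c' := by
    have e1 := e' c' hc'1
    have e2 := e' (c' + 1) (by omega)
    have e3 := b1' c' m hc'1
    rw [if_pos rfl] at e1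
    rw [if_neg (by omega)] at e2
    omega
  have hm0 : m ≠ 0 := by
    rintro rfl
    have e1 := e c' hc'1
    have e2 : rowCount (Function.update r (0 + 1) 0) c' 0 = 0 :=
      upTo_zero_rowOf (h1.init.out (by omega)) hc'1
    rw [if_neg (by omega), e2] at e1
    omega
  obtain ⟨m, rfl⟩ : ∃ k, m = k + 1 := ⟨m - 1, by omega⟩
  obtain ⟨s, hs, hsc⟩ := h1.init.remove hc'1 (by
    have e1 := e c' hc'1
    have e2 := e (c' + 1) (by omega)
    rw [if_neg (by omega)] at e1
    omega)
  obtain ⟨q, rfl⟩ : ∃ q, c = q + 1 := ⟨c - 1, by omega⟩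
  have es : ∀ a, 1 ≤ a → lam a = rowCount s a m + (if a = c' then 1 else 0) +
      if a = q + 1 then 1 else 0 := fun a ha => by rw [e a ha, hsc a ha]
  -- Once a box of row `q + 1` has gone, row `q` is strictly longer. If `q = c'` it has lost a box
  -- too, and strictness comes from `hcorner`.
  have hq : rowCount s (q + 1) m < rowCount s q m := by
    have e1 := es q (by omega)
    have e2 := es (q + 1) (by omega)
    have e3 := b0 q (by omega)
    rw [if_neg (show ¬ q + 1 = c' by omega), if_pos rfl] at e2
    rw [if_neg (show ¬ q = q + 1 by omega)] at e1
    by_cases hqc : q = c'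
    · subst hqc
      rw [if_pos rfl] at e1
      omega
    · rw [if_neg hqc] at e1
      omega
  have hm0 : m ≠ 0 := by
    rintro rfl
    have e2 : rowCount s q 0 = 0 := upTo_zero_rowOf (hs.out (by omega)) (by omega)
    omega
  obtain ⟨m, rfl⟩ : ∃ k, m = k + 1 := ⟨m - 1, by omega⟩
  obtain ⟨t, ht, htc⟩ := hs.remove (show 1 ≤ q by omega) hq
  have g1 := ht.extend (show 1 ≤ q by omega) fun a ha => by
    rw [← htc a ha, ← htc (a + 1) (by omega)]; exact hs.ballot a _ ha
  have c1 : ∀ a, 1 ≤ a → rowCount (Function.update t (m + 1) q) a (m + 1) =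
      rowCount s a (m + 1) := fun a ha => by rw [rowCount_update, htc a ha]
  have g2 := g1.extend hc'1 fun a ha => by
    rw [c1 a ha, c1 (a + 1) (by omega), ← hsc a ha, ← hsc (a + 1) (by omega)]
    exact h1.init.ballot a _ ha
  have g2' := g1.extend (show 1 ≤ q + 1 by omega) fun a ha => by
    rw [c1 a ha, c1 (a + 1) (by omega)]
    have e1 := es a ha
    have e2 := es (a + 1) (by omega)
    have e3 := e' a ha
    have e4 := e' (a + 1) (by omega)
    have e5 := b1' a (m + 1 + 1) ha
    omega
  have c2 : ∀ x a, 1 ≤ a →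
      rowCount (Function.update (Function.update t (m + 1) q) (m + 1 + 1) x) a (m + 1 + 1) =
        rowCount s a (m + 1) + if a = x then 1 else 0 := fun x a ha => by
    rw [rowCount_update, c1 a ha]
  have g3 := g2.extend (show 1 ≤ q + 1 by omega) fun a ha => by
    rw [c2 _ a ha, c2 _ (a + 1) (by omega)]
    have e1 := es a ha
    have e2 := es (a + 1) (by omega)
    have e3 := b0 a ha
    omega
  have g3' := g2'.extend hc'1 fun a ha => by
    rw [c2 _ a ha, c2 _ (a + 1) (by omega)]
    have e1 := es a ha
    have e2 := es (a + 1) (by omega)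
    have e3 := b0 a ha
    omega
  have k3 := ballot_iff.2 ⟨g3, fun a ha => show _ = lam a by
    rw [rowCount_update, rowCount_update, c1 a ha, es a ha]⟩
  have k3' := ballot_iff.2 ⟨g3', fun a ha => show _ = lam a by
    rw [rowCount_update, rowCount_update, c1 a ha, es a ha]; omega⟩
  refine Or.inr ⟨_, _, m + 1, rfl, by omega, joined_of_last_eq ih h k3 ?_, k3, k3', ?_,
    joined_of_last_eq ih k3' h' ?_⟩
  · rw [Function.update_self, hc]
  · have v0 : ∀ x y : ℕ, Function.update (Function.update (Function.update t (m + 1) q)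
        (m + 1 + 1) x) (m + 1 + 1 + 1) y (m + 1) = q := fun x y => by
      rw [Function.update_of_ne (by omega), Function.update_of_ne (by omega),
        Function.update_self]
    have v1 : ∀ x y : ℕ, Function.update (Function.update (Function.update t (m + 1) q)
        (m + 1 + 1) x) (m + 1 + 1 + 1) y (m + 1 + 1) = x := fun x y => by
      rw [Function.update_of_ne (by omega), Function.update_self]
    -- The step goes from `q, c, c'` to `q, c', c`; as `c' ≤ q`, it exchanges the last two letters.
    refine Or.inr ⟨?_, Or.inr ?_, fun k hk1 hk2 hk3 => ?_⟩
    · rw [v0, v1, Function.update_self]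
      omega
    · rw [v0, v0, v1, v1, Function.update_self, Function.update_self]
      exact ⟨by omega, rfl, rfl, rfl⟩
    · rw [Function.update_of_ne hk3, Function.update_of_ne hk2, Function.update_of_ne hk3,
        Function.update_of_ne hk2]
  · rw [Function.update_self, hc']

theorem fewMoves {m : ℕ} {lam r r' : ℕ → ℕ} (h : Ballot m lam r) (h' : Ballot m lam r') :
    FewMoves m lam r r' := by
  induction m generalizing lam r r' with
  | zero =>
    refine Or.inl ?_
    obtain rfl : r = r' := by
      ext k
      rw [h.out (by omega), h'.out (by omega)]
    exact .refl
  | succ m ih =>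
    rcases lt_trichotomy (r (m + 1)) (r' (m + 1)) with hlt | heq | hgt
    · exact (fewMoves_of_last_lt (fun _ _ _ => ih) h' h hlt).symm
    · exact Or.inl (joined_of_last_eq (fun _ _ _ => ih) h h' heq)
    · exact fewMoves_of_last_lt (fun _ _ _ => ih) h h' hgt

/-! ### Components on words of length four and five -/

open SignedColoredGraph

/-- The position `j + 1` carries a descent or an ascent different from the one at `j`. -/
def Active (j : ℕ) (r : ℕ → ℕ) : Prop := ¬ (r (j + 1) ≤ r j ↔ r (j + 2) ≤ r (j + 1))

theorem KnuthStep.active {j : ℕ} {r r' : ℕ → ℕ} (h : KnuthStep j r r') :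
    Active j r ∧ Active j r' := by
  obtain ⟨h1, h2 | h2, -⟩ := h <;> constructor <;> unfold Active <;> omega

theorem Knuth.active {j : ℕ} {r r' : ℕ → ℕ} (h : Knuth j r r') : Active j r :=
  h.elim (fun h => h.active.1) fun h => h.active.2

theorem Knuth.right_unique {j : ℕ} {r s t : ℕ → ℕ} (h : Knuth j r s) (h' : Knuth j r t) :
    s = t := by
  ext k
  by_cases h0 : k = j ∨ k = j + 1 ∨ k = j + 2
  · rcases h with ⟨h1, h2, -⟩ | ⟨h1, h2, -⟩ <;> rcases h' with ⟨h3, h4, -⟩ | ⟨h3, h4, -⟩ <;>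
      rcases h0 with rfl | rfl | rfl <;> omega
  · push Not at h0
    rcases h with ⟨-, -, h⟩ | ⟨-, -, h⟩ <;> rcases h' with ⟨-, -, h'⟩ | ⟨-, -, h'⟩ <;>
      have h1 := h k h0.1 h0.2.1 h0.2.2 <;> have h2 := h' k h0.1 h0.2.1 h0.2.2 <;> omega

/-- The words `φ a` form a component of the graph of elementary dual equivalences on words of
length `m`, isomorphic to `T`. -/
structure WordComponent (m : ℕ) {k : ℕ} (T : ℕ → Fin k → Fin k → Prop) (φ : Fin k → ℕ → ℕ) :
    Prop where
  inj : Function.Injective φ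
  knuth : ∀ {j a b}, 1 ≤ j → j + 2 ≤ m → (Knuth j (φ a) (φ b) ↔ T (j + 1) a b)
  closed : ∀ {j a r}, 1 ≤ j → j + 2 ≤ m → Knuth j (φ a) r → ∃ b, r = φ b
  conn : ∀ a b, Relation.ReflTransGen (fun a b => ∃ j, 1 ≤ j ∧ j + 2 ≤ m ∧ T (j + 1) a b) a b

/-- The word with the letters of `l` at the positions `1, 2, …`. -/
def word (l : List ℕ) (k : ℕ) : ℕ := (0 :: l).getD k 0

theorem word_of_lt {l : List ℕ} {k : ℕ} (h : l.length < k) : word l k = 0 :=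
  List.getD_eq_default _ _ h

/-- `KnuthStep` for finite words. -/
def ListStep (m j : ℕ) (l l' : List ℕ) : Prop :=
  (word l j < word l (j + 1) ∧ word l (j + 2) ≤ word l (j + 1)) ∧
  ((word l j < word l (j + 2) ∧ word l' j = word l (j + 1) ∧ word l' (j + 1) = word l j ∧
      word l' (j + 2) = word l (j + 2)) ∨
    (word l (j + 2) ≤ word l j ∧ word l' j = word l j ∧ word l' (j + 1) = word l (j + 2) ∧
      word l' (j + 2) = word l (j + 1))) ∧
  ∀ k < m + 1, k ≠ j → k ≠ j + 1 → k ≠ j + 2 → word l' k = word l k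

instance (m j : ℕ) (l l' : List ℕ) : Decidable (ListStep m j l l') := by
  unfold ListStep; infer_instance

theorem knuthStep_word_iff {m j : ℕ} {l l' : List ℕ} (hl : l.length = m) (hl' : l'.length = m) :
    KnuthStep j (word l) (word l') ↔ ListStep m j l l' := by
  refine and_congr_right fun _ => and_congr_right fun _ => ⟨fun h k _ => h k, fun h k => ?_⟩
  by_cases hk : k < m + 1
  · exact h k hk
  · intro _ _ _
    rw [word_of_lt (by omega), word_of_lt (by omega)]

theorem word_injective {m : ℕ} {l l' : List ℕ} (hl : l.length = m) (hl' : l'.length = m)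
    (h : word l = word l') : l = l' := by
  refine List.ext_getElem (by omega) fun k h1 h2 => ?_
  have := congrFun h (k + 1)
  simpa [word, h1, h2] using this

/-- The edges at position `j` among the words `L a` are those of `T`, and no edge at position `j`
leaves this set of words. -/
def ListEdges (m : ℕ) {k : ℕ} (T : Fin k → Fin k → Prop) (L : Fin k → List ℕ) (j : ℕ) : Prop :=
  (∀ a b, (ListStep m j (L a) (L b) ∨ ListStep m j (L b) (L a)) ↔ T a b) ∧
  ∀ a, (word (L a) (j + 1) ≤ word (L a) j ↔ word (L a) (j + 2) ≤ word (L a) (j + 1)) ∨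
    ∃ b, T a b

instance (m : ℕ) {k : ℕ} (T : Fin k → Fin k → Prop) [∀ a b, Decidable (T a b)]
    (L : Fin k → List ℕ) (j : ℕ) : Decidable (ListEdges m T L j) := by
  unfold ListEdges; infer_instance

/-- The finitely many conditions for the words `L a` to form a component isomorphic to `T`. -/
def ListComponent (m : ℕ) {k : ℕ} (T : ℕ → Fin k → Fin k → Prop) (L : Fin k → List ℕ) : Prop :=
  (∀ a, (L a).length = m) ∧ (∀ a b, L a = L b → a = b) ∧
  (∀ j < m, 1 ≤ j → j + 2 ≤ m → ListEdges m (T (j + 1)) L j) ∧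
  ∀ a, a.val ≠ 0 → ∃ b < a, ∃ j < m, 1 ≤ j ∧ j + 2 ≤ m ∧ T (j + 1) a b

instance (m : ℕ) {k : ℕ} (T : ℕ → Fin k → Fin k → Prop) [∀ j a b, Decidable (T j a b)]
    (L : Fin k → List ℕ) : Decidable (ListComponent m T L) := by
  unfold ListComponent; infer_instance

/-- Closedness holds because a move at `j` makes `j` active; then `T` has an edge at that vertex,
and moves at a given position are unique. Each vertex other than 0 has a neighbour of smaller index,
which gives connectedness. -/
theorem ListComponent.wordComponent {m k : ℕ} {T : ℕ → Fin k → Fin k → Prop}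
    {L : Fin k → List ℕ} (h : ListComponent m T L) :
    WordComponent m T fun a => word (L a) := by
  obtain ⟨hl, hi, hk, hc⟩ := h
  have knuth : ∀ {j a b}, 1 ≤ j → j + 2 ≤ m →
      (Knuth j (word (L a)) (word (L b)) ↔ T (j + 1) a b) := fun {j a b} h1 h2 => by
    rw [← (hk j (by omega) h1 h2).1, ← knuthStep_word_iff (hl a) (hl b),
      ← knuthStep_word_iff (hl b) (hl a)]
    rfl
  have symm : ∀ {j a b}, 1 ≤ j → j + 2 ≤ m → T (j + 1) a b → T (j + 1) b a := fun h1 h2 h =>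
    (knuth h1 h2).1 ((knuth h1 h2).2 h).symm
  have conn : ∀ n (a : Fin k), a.val = n → ∀ b : Fin k, b.val = 0 →
      Relation.ReflTransGen (fun a b => ∃ j, 1 ≤ j ∧ j + 2 ≤ m ∧ T (j + 1) a b) a b ∧
      Relation.ReflTransGen (fun a b => ∃ j, 1 ≤ j ∧ j + 2 ≤ m ∧ T (j + 1) a b) b a := by
    intro n
    induction n using Nat.strong_induction_on with
    | _ n ih =>
      intro a ha b hb
      by_cases h0 : a.val = 0
      · obtain rfl : a = b := Fin.ext (by omega)
        exact ⟨.refl, .refl⟩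
      · obtain ⟨c, hca, j, -, h1, h2, h3⟩ := hc a h0
        obtain ⟨g1, g2⟩ := ih c.val (by rw [← ha]; exact hca) c rfl b hb
        exact ⟨.head ⟨j, h1, h2, h3⟩ g1, g2.tail ⟨j, h1, h2, symm h1 h2 h3⟩⟩
  refine ⟨fun a b hab => hi a b (word_injective (hl a) (hl b) hab), knuth, ?_, fun a b => ?_⟩
  · intro j a r h1 h2 h
    obtain ⟨b, hb⟩ := ((hk j (by omega) h1 h2).2 a).resolve_left h.active
    exact ⟨b, h.right_unique ((knuth h1 h2).2 hb)⟩
  · have h0 : 0 < k := by have := a.isLt; omega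
    exact (conn _ a rfl ⟨0, h0⟩ rfl).1.trans (conn _ b rfl ⟨0, h0⟩ rfl).2

instance (i j : ℕ) (a b : Fin 3) : Decidable (path3 i j a b) := by unfold path3; infer_instance
instance (i j : ℕ) (a b : Fin 2) : Decidable (double2 i j a b) := by
  unfold double2; infer_instance
instance (i j : ℕ) (a b : Fin 4) : Decidable (path4 i j a b) := by unfold path4; infer_instance
instance (i j : ℕ) (a b : Fin 5) : Decidable (doublePath5 i j a b) := by
  unfold doublePath5; infer_instance
instance (i j : ℕ) (a b : Fin 6) : Decidable (flower6 i j a b) := by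
  unfold flower6; infer_instance

abbrev words31 : Fin 3 → List ℕ := ![[1, 2, 1, 1], [1, 1, 2, 1], [1, 1, 1, 2]]
abbrev words22 : Fin 2 → List ℕ := ![[1, 1, 2, 2], [1, 2, 1, 2]]
abbrev words211 : Fin 3 → List ℕ := ![[1, 1, 2, 3], [1, 2, 1, 3], [1, 2, 3, 1]]
abbrev words41 : Fin 4 → List ℕ :=
  ![[1, 2, 1, 1, 1], [1, 1, 2, 1, 1], [1, 1, 1, 2, 1], [1, 1, 1, 1, 2]]
abbrev words32 : Fin 5 → List ℕ :=
  ![[1, 1, 1, 2, 2], [1, 1, 2, 1, 2], [1, 2, 1, 1, 2], [1, 2, 1, 2, 1], [1, 1, 2, 2, 1]]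
abbrev words311 : Fin 6 → List ℕ := ![[1, 1, 1, 2, 3], [1, 1, 2, 1, 3], [1, 1, 2, 3, 1],
  [1, 2, 1, 1, 3], [1, 2, 1, 3, 1], [1, 2, 3, 1, 1]]
abbrev words221 : Fin 5 → List ℕ :=
  ![[1, 2, 3, 1, 2], [1, 2, 1, 3, 2], [1, 1, 2, 3, 2], [1, 1, 2, 2, 3], [1, 2, 1, 2, 3]]
abbrev words2111 : Fin 4 → List ℕ :=
  ![[1, 1, 2, 3, 4], [1, 2, 1, 3, 4], [1, 2, 3, 1, 4], [1, 2, 3, 4, 1]]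

/-- Each list consists of all standard tableaux of the shape named by its digits, ordered to match
the vertices of the target graph. -/
theorem component31 : ListComponent 4 (path3 3) words31 := by decide +kernel
theorem component22 : ListComponent 4 (double2 3) words22 := by decide +kernel
theorem component211 : ListComponent 4 (path3 3) words211 := by decide +kernel
theorem component41 : ListComponent 5 (path4 4) words41 := by decide +kernel
theorem component32 : ListComponent 5 (doublePath5 4) words32 := by decide +kernel
theorem component311 : ListComponent 5 (flower6 4) words311 := by decide +kernel
theorem component221 : ListComponent 5 (doublePath5 4) words221 := by decide +kernel
theorem component2111 : ListComponent 5 (path4 4) words2111 := by decide +kernel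

theorem IsBallot.eq_word {m : ℕ} {r : ℕ → ℕ} (h : IsBallot m r) {l : List ℕ}
    (hl : l.length = m) (he : ∀ k < m, r (k + 1) = word l (k + 1)) : r = word l := by
  ext k
  by_cases hk : 1 ≤ k ∧ k ≤ m
  · obtain ⟨k, rfl⟩ := Nat.exists_eq_add_of_le' hk.1
    exact he k (by omega)
  · rw [h.out hk]
    by_cases h0 : k = 0
    · rw [h0]; rfl
    · rw [word_of_lt (by omega)]

/-- The ballot condition for a finite word. -/
def ListBallot (m : ℕ) (l : List ℕ) : Prop :=
  ∀ a < m, 1 ≤ a → ∀ k < m + 1, rowCount (word l) (a + 1) k ≤ rowCount (word l) a k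

instance (m : ℕ) (l : List ℕ) : Decidable (ListBallot m l) := by
  unfold ListBallot; infer_instance

/-- The list of the ballot words of length four. -/
def ListedFour (l : List ℕ) : Prop :=
  l = [1, 1, 1, 1] ∨ l = [1, 2, 3, 4] ∨ (∃ a, l = words31 a) ∨ (∃ a, l = words22 a) ∨
    ∃ a, l = words211 a

instance (l : List ℕ) : Decidable (ListedFour l) := by unfold ListedFour; infer_instance

/-- The list of the ballot words of length five. -/
def ListedFive (l : List ℕ) : Prop :=
  l = [1, 1, 1, 1, 1] ∨ l = [1, 2, 3, 4, 5] ∨ (∃ a, l = words41 a) ∨ (∃ a, l = words32 a) ∨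
    (∃ a, l = words311 a) ∨ (∃ a, l = words221 a) ∨ ∃ a, l = words2111 a

instance (l : List ℕ) : Decidable (ListedFive l) := by unfold ListedFive; infer_instance

/-- The ranges come from `IsBallot.le`: the letter at position `k` is at most `k`, and the first is
1. -/
theorem list_cases_four : ∀ b < 3, ∀ c < 4, ∀ d < 5, 1 ≤ b ∧ 1 ≤ c ∧ 1 ≤ d ∧
    ListBallot 4 [1, b, c, d] → ListedFour [1, b, c, d] := by decide +kernel

set_option synthInstance.maxSize 1000 in
set_option synthInstance.maxHeartbeats 400000 in
theorem list_cases_five : ∀ b < 3, ∀ c < 4, ∀ d < 5, ∀ e < 6, 1 ≤ b ∧ 1 ≤ c ∧ 1 ≤ d ∧ 1 ≤ e ∧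
    ListBallot 5 [1, b, c, d, e] → ListedFive [1, b, c, d, e] := by decide +kernel

theorem exists_component_four {r s : ℕ → ℕ} {j : ℕ} (h : IsBallot 4 r) (h1 : 1 ≤ j)
    (h2 : j + 2 ≤ 4) (hk : Knuth j r s) :
    (∃ φ, WordComponent 4 (path3 3) φ ∧ ∃ a, r = φ a) ∨
    ∃ φ, WordComponent 4 (double2 3) φ ∧ ∃ a, r = φ a := by
  have p := fun k (hk : 1 ≤ k) (hk' : k ≤ 4) => h.pos hk hk'
  have q := h.le
  have e : r = word [1, r 2, r 3, r 4] := h.eq_word rfl fun k hk => by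
    interval_cases k
    · exact le_antisymm (q 1) (p 1 le_rfl (by omega))
    all_goals rfl
  have hb := h.ballot
  have ha := hk.active
  rw [e] at hb ha
  -- A single row or a single column has only one standard tableau, which admits no move.
  have hn : ∀ j < 4, 1 ≤ j → j + 2 ≤ 4 →
      ¬ Active j (word [1, 1, 1, 1]) ∧ ¬ Active j (word [1, 2, 3, 4]) := by
    unfold Active
    decide
  rcases list_cases_four (r 2) (Nat.lt_succ_of_le (q 2)) (r 3) (Nat.lt_succ_of_le (q 3)) (r 4)
    (Nat.lt_succ_of_le (q 4)) ⟨p 2 (by omega) (by omega), p 3 (by omega) (by omega),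
      p 4 (by omega) (by omega), fun a _ ha k _ => hb a k ha⟩ with
    hc | hc | ⟨a, hc⟩ | ⟨a, hc⟩ | ⟨a, hc⟩ <;> rw [hc] at e ha
  · exact absurd ha (hn j (by omega) h1 h2).1
  · exact absurd ha (hn j (by omega) h1 h2).2
  · exact Or.inl ⟨_, component31.wordComponent, a, e⟩
  · exact Or.inr ⟨_, component22.wordComponent, a, e⟩
  · exact Or.inl ⟨_, component211.wordComponent, a, e⟩

theorem exists_component_five {r s : ℕ → ℕ} {j : ℕ} (h : IsBallot 5 r) (h1 : 1 ≤ j)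
    (h2 : j + 2 ≤ 5) (hk : Knuth j r s) :
    (∃ φ, WordComponent 5 (path4 4) φ ∧ ∃ a, r = φ a) ∨
    (∃ φ, WordComponent 5 (doublePath5 4) φ ∧ ∃ a, r = φ a) ∨
    ∃ φ, WordComponent 5 (flower6 4) φ ∧ ∃ a, r = φ a := by
  have p := fun k (hk : 1 ≤ k) (hk' : k ≤ 5) => h.pos hk hk'
  have q := h.le
  have e : r = word [1, r 2, r 3, r 4, r 5] := h.eq_word rfl fun k hk => by
    interval_cases k
    · exact le_antisymm (q 1) (p 1 le_rfl (by omega))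
    all_goals rfl
  have hb := h.ballot
  have ha := hk.active
  rw [e] at hb ha
  have hn : ∀ j < 5, 1 ≤ j → j + 2 ≤ 5 →
      ¬ Active j (word [1, 1, 1, 1, 1]) ∧ ¬ Active j (word [1, 2, 3, 4, 5]) := by
    unfold Active
    decide
  rcases list_cases_five (r 2) (Nat.lt_succ_of_le (q 2)) (r 3) (Nat.lt_succ_of_le (q 3)) (r 4)
    (Nat.lt_succ_of_le (q 4)) (r 5) (Nat.lt_succ_of_le (q 5)) ⟨p 2 (by omega) (by omega),
      p 3 (by omega) (by omega), p 4 (by omega) (by omega), p 5 (by omega) (by omega),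
      fun a _ ha k _ => hb a k ha⟩ with
    hc | hc | ⟨a, hc⟩ | ⟨a, hc⟩ | ⟨a, hc⟩ | ⟨a, hc⟩ | ⟨a, hc⟩ <;> rw [hc] at e ha
  · exact absurd ha (hn j (by omega) h1 h2).1
  · exact absurd ha (hn j (by omega) h1 h2).2
  · exact Or.inl ⟨_, component41.wordComponent, a, e⟩
  · exact Or.inr (Or.inl ⟨_, component32.wordComponent, a, e⟩)
  · exact Or.inr (Or.inr ⟨_, component311.wordComponent, a, e⟩)
  · exact Or.inr (Or.inl ⟨_, component221.wordComponent, a, e⟩)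
  · exact Or.inl ⟨_, component2111.wordComponent, a, e⟩

/-! ### Restriction to consecutive colours and the model of `G(X)` -/

namespace Stem

theorem pull_e {C C' : Set ℕ} {V : Type u} {S : Stem C V} {s i : ℕ}
    {hC : ∀ j ∈ C', j + s ∈ C} (hi : i ∈ C') (x : V) : (S.pull s C' hC).e i x = S.e (i + s) x :=
  if_pos hi

theorem pull_f {C C' : Set ℕ} {V : Type u} {S : Stem C V} {s i : ℕ}
    {hC : ∀ j ∈ C', j + s ∈ C} (hi : i ∈ C') (x : V) : (S.pull s C' hC).f i x = S.f (i + s) x :=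
  if_pos hi

theorem pull_ffee {C C' : Set ℕ} {V : Type u} {S : Stem C V} {s i j : ℕ}
    {hC : ∀ j ∈ C', j + s ∈ C} (hi : i ∈ C') (hj : j ∈ C') {v w : V} :
    (S.pull s C' hC).FFEE i j v w ↔ S.FFEE (i + s) (j + s) v w := by
  constructor
  · rintro ⟨a, b, c, h1, h2, h3, h4⟩
    exact ⟨a, b, c, h1.2, h2.2, h3.2, h4.2⟩
  · rintro ⟨a, b, c, h1, h2, h3, h4⟩
    exact ⟨a, b, c, ⟨hi, h1⟩, ⟨hj, h2⟩, ⟨hi, h3⟩, ⟨hj, h4⟩⟩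

/-- Translation of a weight by `s`. -/
def shiftWeight (s : ℕ) (μ : ℕ → ℤ) (k : ℕ) : ℤ := if s < k then μ (k - s) else 0

theorem shiftWeight_simpleRoot {s i : ℕ} (hi : 1 ≤ i) :
    shiftWeight s (simpleRoot i) = simpleRoot (i + s) := by
  ext k
  simp only [shiftWeight, simpleRoot]
  split_ifs <;> omega

theorem Reach.of_pull {C : Set ℕ} {V : Type u} {S : Stem C V} {s m : ℕ}
    {hC : ∀ j ∈ colours m, j + s ∈ C} {v x : V} {μ : ℕ → ℤ}
    (h : (S.pull s (colours m) hC).Reach v x μ) : S.Reach v x (shiftWeight s μ) := by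
  induction h with
  | refl =>
    convert Reach.refl using 1
    ext k
    simp [shiftWeight]
  | @up _ _ μ _ _ h ih =>
    convert ih.up h.2 using 1
    rw [← shiftWeight_simpleRoot h.1.1]
    ext k
    simp only [shiftWeight, Pi.add_apply]
    split_ifs <;> simp
  | @down _ _ μ _ _ h ih =>
    convert ih.down h.2 using 1
    rw [← shiftWeight_simpleRoot h.1.1]
    ext k
    simp only [shiftWeight, Pi.sub_apply]
    split_ifs <;> simp

end Stem

theorem exists_knuthStep {j : ℕ} {r : ℕ → ℕ} (h1 : r j < r (j + 1))
    (h2 : r (j + 2) ≤ r (j + 1)) : ∃ r', KnuthStep j r r' := by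
  by_cases h : r j < r (j + 2)
  · refine ⟨fun k => if k = j then r (j + 1) else if k = j + 1 then r j else r k, ⟨h1, h2⟩,
      Or.inl ⟨h, ?_, ?_, ?_⟩, fun k g1 g2 _ => ?_⟩ <;> simp [*]
  · refine ⟨fun k => if k = j + 1 then r (j + 2) else if k = j + 2 then r (j + 1) else r k,
      ⟨h1, h2⟩, Or.inr ⟨by omega, ?_, ?_, ?_⟩, fun k _ g1 g2 => ?_⟩ <;> simp [*]

theorem exists_knuthStep' {j : ℕ} {r : ℕ → ℕ} (h1 : r (j + 1) ≤ r j)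
    (h2 : r (j + 1) < r (j + 2)) : ∃ r', KnuthStep j r' r := by
  by_cases h : r j < r (j + 2)
  · refine ⟨fun k => if k = j + 1 then r (j + 2) else if k = j + 2 then r (j + 1) else r k,
      ?_, Or.inr ⟨?_, ?_, ?_, ?_⟩, fun k _ g1 g2 => ?_⟩ <;> simp [*, h2.le]
  · refine ⟨fun k => if k = j then r (j + 1) else if k = j + 1 then r j else r k,
      ?_, Or.inl ⟨?_, ?_, ?_, ?_⟩, fun k g1 g2 _ => ?_⟩ <;> simp [*]
    all_goals omega

theorem exists_knuth {j : ℕ} {r : ℕ → ℕ} (h : Active j r) : ∃ r', Knuth j r r' := by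
  unfold Active at h
  by_cases h1 : r (j + 1) ≤ r j
  · obtain ⟨r', h'⟩ := exists_knuthStep' h1 (by omega)
    exact ⟨r', Or.inr h'⟩
  · obtain ⟨r', h'⟩ := exists_knuthStep (r := r) (j := j) (by omega) (by omega)
    exact ⟨r', Or.inl h'⟩

/-- The two moves involve disjoint triples of positions. -/
theorem Knuth.commute {i j : ℕ} {r s t : ℕ → ℕ} (hij : i + 3 ≤ j ∨ j + 3 ≤ i)
    (h : Knuth i r s) (h' : Knuth j s t) : ∃ x, Knuth j r x ∧ Knuth i x t := by
  have e : ∀ k, k ≠ i → k ≠ i + 1 → k ≠ i + 2 → s k = r k := fun k h1 h2 h3 =>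
    h.elim (fun h => h.2.2 k h1 h2 h3) fun h => (h.2.2 k h1 h2 h3).symm
  have e' : ∀ k, k ≠ j → k ≠ j + 1 → k ≠ j + 2 → t k = s k := fun k h1 h2 h3 =>
    h'.elim (fun h => h.2.2 k h1 h2 h3) fun h => (h.2.2 k h1 h2 h3).symm
  have key : ∀ {l : ℕ} {p q p' q' : ℕ → ℕ}, Knuth l p q →
      (∀ k, k = l ∨ k = l + 1 ∨ k = l + 2 → p' k = p k ∧ q' k = q k) →
      (∀ k, k ≠ l → k ≠ l + 1 → k ≠ l + 2 → q' k = p' k) → Knuth l p' q' := by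
    intro l p q p' q' h g g'
    have g0 := g l (by omega)
    have g1 := g (l + 1) (by omega)
    have g2 := g (l + 2) (by omega)
    rcases h with ⟨h1, h2, -⟩ | ⟨h1, h2, -⟩
    · exact Or.inl ⟨by omega, by omega, g'⟩
    · exact Or.inr ⟨by omega, by omega, fun k h1 h2 h3 => (g' k h1 h2 h3).symm⟩
  let x : ℕ → ℕ := fun k => if k = j ∨ k = j + 1 ∨ k = j + 2 then t k else r k
  refine ⟨x, key h' (fun k hk => ⟨?_, if_pos hk⟩) fun k h1 h2 h3 => if_neg (by omega),
    key h (fun k hk => ⟨if_neg (by omega), ?_⟩) fun k h1 h2 h3 => ?_⟩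
  · exact (e k (by omega) (by omega) (by omega)).symm
  · exact e' k (by omega) (by omega) (by omega)
  · by_cases hk : k = j ∨ k = j + 1 ∨ k = j + 2
    · exact (if_pos hk).symm
    · rw [e' k (by omega) (by omega) (by omega), e k h1 h2 h3]
      exact (if_neg hk).symm

/-- The words attached to the vertices of `G(X)` in the component of `v` for the colours
`s + 2, …, s + m - 1`. -/
structure GraphModel {n : ℕ} {V : Type u} (X : DirectedColoredGraph n V) (v : X.zeroOneVertices)
    (m s : ℕ) (lam : ℕ → ℕ) (P : X.zeroOneVertices → (ℕ → ℕ) → Prop) : Prop where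
  self : ∃ r, P v r
  ballot : ∀ {w r}, P w r → Ballot m lam r
  right_unique : ∀ {w r r'}, P w r → P w r' → r = r'
  left_unique : ∀ {w w' r}, P w r → P w' r → w = w'
  sign : ∀ {w r i}, P w r → 1 ≤ i → i < m →
    X.toSigned.sign w (i + s) = if r (i + 1) ≤ r i then 1 else -1
  word_of : ∀ {w w' r j}, P w r → 1 ≤ j → j + 2 ≤ m → X.toSigned.D (j + 1 + s) w w' →
    ∃ r', P w' r' ∧ Knuth j r r'
  vertex_of : ∀ {w r r' j}, P w r → 1 ≤ j → j + 2 ≤ m → Knuth j r r' →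
    ∃ w', P w' r' ∧ X.toSigned.D (j + 1 + s) w w'

theorem exists_graphModel {n : ℕ} {V : Type u} {X : DirectedColoredGraph n V} (hX : X.IsRegular)
    (hV : X.zeroWeightSpace = X.zeroOneVertices) (v : X.zeroOneVertices) {m s : ℕ}
    (hms : m + s ≤ n) : ∃ lam P, GraphModel X v m s lam P := by
  let S : Stem (colours n) V := hX.stem
  have hC : ∀ j ∈ colours m, j + s ∈ colours n := fun j hj => by
    have h1 := hj.1
    have h2 := hj.2
    exact ⟨by omega, by omega⟩
  let S' := S.pull s (colours m) hC
  have fe : ∀ x i, X.eps x i = S.f i x := fun x i => rfl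
  have de : ∀ x i, X.del x i = -(S.e i x : ℤ) := X.del_eq
  have hv : S.IsZero v := fun i hi => by
    have := (v.2 i hi.1 hi.2).1
    rw [fe, de] at this
    omega
  have hv' : S'.IsZero v := fun i hi => by
    rw [pull_e hi, pull_f hi]
    exact hv _ (hC i hi)
  -- Vanishing weight for the restricted colours alone would not place `x` in the zero weight space
  -- of `X`. A path of total weight zero does, because it also has total weight zero for all
  -- colours; hence the use of `Reach v x 0` in `ZeroOne` and `WordModel`.
  have mem : ∀ {x}, S'.Reach v x 0 → x ∈ X.zeroOneVertices := fun {x} hx => by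
    rw [← hV]
    have h0 : S.Reach v x 0 := by
      convert hx.of_pull using 1
      ext k
      simp [shiftWeight]
    intro i h1 h2
    rw [fe, de, (h0.isZero_iff hv).2 rfl i ⟨h1, h2⟩, neg_neg]
  have H : S'.ZeroOne v := fun x hx i hi => by
    have h1 := mem hx (i + s) (hC i hi).1 (hC i hi).2
    rw [fe, de] at h1
    rw [pull_e hi]
    omega
  obtain ⟨lam, P, M⟩ := exists_wordModel hv' H
  have fval : ∀ {w : V} {r i}, P w r → i ∈ colours m →
      X.eps w (i + s) = if r (i + 1) ≤ r i then 1 else 0 := fun {w r i} hw hi => by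
    have h1 := ((M.reach hw).isZero_iff hv').2 rfl i hi
    rw [M.e_eq hw hi, pull_f hi] at h1
    rw [fe, h1]
    split_ifs <;> rfl
  refine ⟨lam, fun w r => P w r, M.exists_word .refl, M.ballot, M.right_unique,
    fun h h' => Subtype.ext (M.left_unique h h'), fun {w r i} h h1 h2 => ?_,
    fun {w w' r j} h h1 h2 hD => ?_, fun {w r r' j} h h1 h2 hk => ?_⟩
  · show (if X.eps w (i + s) = 1 then 1 else -1) = _
    rw [fval h ⟨h1, h2⟩]
    split_ifs <;> simp_all
  all_goals
    have m0 : j ∈ colours m := ⟨h1, by omega⟩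
    have m1 : j + 1 ∈ colours m := ⟨by omega, by omega⟩
    have f0 := fval h m0
    have f1 := fval h m1
    have ej : j + 1 + s - 1 = j + s := by omega
  · rcases hD with ⟨d1, d2, d3⟩ | ⟨d1, d2, d3⟩ <;> rw [ej] at d2 d3
    · have g0 : ¬ r (j + 1) ≤ r j := fun hc => by rw [if_pos hc] at f0; omega
      have g1 : r (j + 2) ≤ r (j + 1) := by
        by_contra hc
        rw [if_neg hc] at f1
        omega
      obtain ⟨r', hr⟩ := exists_knuthStep (not_le.1 g0) g1
      obtain ⟨x, hx, hf⟩ := M.ffee h h1 h2 hr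
      obtain rfl : x = w' := ((pull_ffee m1 m0).1 hf).unique d3
      exact ⟨r', hx, Or.inl hr⟩
    · have g1 : ¬ r (j + 2) ≤ r (j + 1) := fun hc => by rw [if_pos hc] at f1; omega
      have g0 : r (j + 1) ≤ r j := by
        by_contra hc
        rw [if_neg hc] at f0
        omega
      obtain ⟨r', hr⟩ := exists_knuthStep' g0 (not_le.1 g1)
      obtain ⟨x, hx, hf⟩ := M.ffee' h h1 h2 hr
      obtain rfl : x = w' := ((pull_ffee m0 m1).1 hf).unique d3
      exact ⟨r', hx, Or.inr hr⟩
  · rcases hk with hk | hk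
    · obtain ⟨x, hx, hf⟩ := M.ffee h h1 h2 hk
      refine ⟨⟨x, mem (M.reach hx)⟩, hx, Or.inl ⟨?_, ?_, ?_⟩⟩
      · rw [f1, if_pos hk.1.2]
      · rw [ej, f0, if_neg (by have := hk.1.1; omega)]
      · rw [ej]; exact (pull_ffee m1 m0).1 hf
    · obtain ⟨x, hx, hf⟩ := M.ffee' h h1 h2 hk
      have hd : r (j + 1) ≤ r j ∧ ¬ r (j + 2) ≤ r (j + 1) := by
        obtain ⟨h1, h2, -⟩ := hk
        omega
      refine ⟨⟨x, mem (M.reach hx)⟩, hx, Or.inr ⟨?_, ?_, ?_⟩⟩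
      · rw [f1, if_neg hd.2]
      · rw [ej, f0, if_pos hd.1]
      · rw [ej]; exact (pull_ffee m0 m1).1 hf

namespace GraphModel

variable {n m s : ℕ} {V : Type u} {X : DirectedColoredGraph n V} {v : X.zeroOneVertices}
  {lam : ℕ → ℕ} {P : X.zeroOneVertices → (ℕ → ℕ) → Prop}

theorem componentIs (M : GraphModel X v m s lam P) {C : Set ℕ} {k : ℕ}
    {T T' : ℕ → Fin k → Fin k → Prop} {φ : Fin k → ℕ → ℕ}
    (hC : ∀ c, c ∈ C ↔ ∃ j, 1 ≤ j ∧ j + 2 ≤ m ∧ c = j + 1 + s)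
    (hT : ∀ j a b, 1 ≤ j → j + 2 ≤ m → (T' (j + 1 + s) a b ↔ T (j + 1) a b))
    (hφ : WordComponent m T φ) {a : Fin k} (ha : P v (φ a)) : X.toSigned.ComponentIs C v T' := by
  have key : ∀ b, ∃ w, P w (φ b) ∧ X.toSigned.Joined C v w := fun b => by
    have := hφ.conn a b
    induction this with
    | refl => exact ⟨v, ha, .refl⟩
    | tail _ h ih =>
      obtain ⟨w, hw, hvw⟩ := ih
      obtain ⟨j, h1, h2, h3⟩ := h
      obtain ⟨w', hw', hD⟩ := M.vertex_of hw h1 h2 ((hφ.knuth h1 h2).2 h3)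
      exact ⟨w', hw', hvw.tail ⟨_, (hC _).2 ⟨j, h1, h2, rfl⟩, hD⟩⟩
  choose ψ hψ hj using key
  refine ⟨ψ, fun b c hbc => hφ.inj (M.right_unique (hψ b) (hbc ▸ hψ c)), ?_, fun c hc b b' => ?_⟩
  · ext w
    constructor
    · rintro ⟨b, rfl⟩
      exact hj b
    · intro hw
      have : ∃ b, P w (φ b) := by
        induction hw with
        | refl => exact ⟨a, ha⟩
        | tail _ h ih =>
          obtain ⟨b, hb⟩ := ih
          obtain ⟨c, hc, hD⟩ := h
          obtain ⟨j, h1, h2, rfl⟩ := (hC c).1 hc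
          obtain ⟨r, hr, hk⟩ := M.word_of hb h1 h2 hD
          obtain ⟨b', rfl⟩ := hφ.closed h1 h2 hk
          exact ⟨b', hr⟩
      obtain ⟨b, hb⟩ := this
      exact ⟨b, M.left_unique (hψ b) hb⟩
  · obtain ⟨j, h1, h2, rfl⟩ := (hC c).1 hc
    rw [hT j b b' h1 h2, ← hφ.knuth h1 h2]
    constructor
    · intro hD
      obtain ⟨r, hr, hk⟩ := M.word_of (hψ b) h1 h2 hD
      rwa [M.right_unique (hψ b') hr]
    · intro hk
      obtain ⟨w, hw, hD⟩ := M.vertex_of (hψ b) h1 h2 hk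
      rwa [M.left_unique (hψ b') hw]

theorem joined (M : GraphModel X v m s lam P) {C : Set ℕ} {d : ℕ} (hd : 2 ≤ d)
    (hC : ∀ j, 1 ≤ j → j + d ≤ m → j + 1 + s ∈ C) {w : X.zeroOneVertices} {r r' : ℕ → ℕ}
    (hw : P w r) (h : WordJoined m d lam r r') : ∃ w', P w' r' ∧ X.toSigned.Joined C w w' := by
  induction h with
  | refl => exact ⟨w, hw, .refl⟩
  | tail _ h ih =>
    obtain ⟨x, hx, hwx⟩ := ih
    obtain ⟨-, -, j, h1, h2, h3⟩ := h
    obtain ⟨y, hy, hD⟩ := M.vertex_of hx h1 (by omega) h3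
    exact ⟨y, hy, hwx.tail ⟨_, hC j h1 h2, hD⟩⟩

end GraphModel

/-! ### The axioms of a dual equivalence graph -/

theorem ite_eq_neg_iff {p q : Prop} [Decidable p] [Decidable q] :
    ((if p then 1 else -1 : ℤˣ) = -(if q then 1 else -1)) ↔ ¬ (p ↔ q) := by
  split_ifs <;> simp_all

theorem ite_eq_iff_iff {p q : Prop} [Decidable p] [Decidable q] :
    ((if p then 1 else -1 : ℤˣ) = if q then 1 else -1) ↔ (p ↔ q) := by
  split_ifs <;> simp_all

section Shift

variable {s j : ℕ}

theorem shift_two : j + 1 + s = 4 + s - 2 ↔ j + 1 = 4 - 2 := by omega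
theorem shift_one : j + 1 + s = 4 + s - 1 ↔ j + 1 = 4 - 1 := by omega
theorem shift_zero : j + 1 + s = 4 + s ↔ j + 1 = 4 := by omega

theorem path4_shift {a b : Fin 4} :
    SignedColoredGraph.path4 (4 + s) (j + 1 + s) a b ↔
      SignedColoredGraph.path4 4 (j + 1) a b := by
  simp only [SignedColoredGraph.path4, shift_two, shift_one, shift_zero]

theorem doublePath5_shift {a b : Fin 5} :
    SignedColoredGraph.doublePath5 (4 + s) (j + 1 + s) a b ↔
      SignedColoredGraph.doublePath5 4 (j + 1) a b := by
  simp only [SignedColoredGraph.doublePath5, shift_two, shift_one, shift_zero]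

theorem flower6_shift {a b : Fin 6} :
    SignedColoredGraph.flower6 (4 + s) (j + 1 + s) a b ↔
      SignedColoredGraph.flower6 4 (j + 1) a b := by
  simp only [SignedColoredGraph.flower6, shift_two, shift_one, shift_zero]

end Shift

theorem Knuth.descent {j : ℕ} {r r' : ℕ → ℕ} (h : Knuth j r r') :
    ¬ (r (j + 1) ≤ r j ↔ r' (j + 1) ≤ r' j) ∧
    ¬ (r (j + 2) ≤ r (j + 1) ↔ r' (j + 2) ≤ r' (j + 1)) ∧
    ∀ k, k + 1 < j ∨ j + 2 < k → (r (k + 1) ≤ r k ↔ r' (k + 1) ≤ r' k) := by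
  refine ⟨?_, ?_, fun k hk => ?_⟩
  · rcases h with ⟨h1, h2, -⟩ | ⟨h1, h2, -⟩ <;> omega
  · rcases h with ⟨h1, h2, -⟩ | ⟨h1, h2, -⟩ <;> omega
  · rcases h with ⟨-, -, h⟩ | ⟨-, -, h⟩ <;>
      rw [h k (by omega) (by omega) (by omega), h (k + 1) (by omega) (by omega) (by omega)]

/-- The comparison at `j` can change only when the move exchanges the letters at `j + 1` and `j +
2`. The unmoved letter at `j` then separates those two, so `r` has a descent at exactly one of `j`
and `j + 1`. -/
theorem Knuth.descent_low {j : ℕ} {r r' : ℕ → ℕ} (h : Knuth (j + 1) r r')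
    (hd : ¬ (r (j + 1) ≤ r j ↔ r' (j + 1) ≤ r' j)) :
    ¬ (r (j + 1) ≤ r j ↔ r (j + 2) ≤ r (j + 1)) := by
  rcases h with ⟨h1, h2, h⟩ | ⟨h1, h2, h⟩ <;>
    have h3 := h j (by omega) (by omega) (by omega) <;>
    simp only [Nat.add_assoc, Nat.reduceAdd] at h1 h2 <;> omega

theorem Knuth.descent_high {j : ℕ} {r r' : ℕ → ℕ} (h : Knuth j r r')
    (hd : ¬ (r (j + 3) ≤ r (j + 2) ↔ r' (j + 3) ≤ r' (j + 2))) :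
    ¬ (r (j + 3) ≤ r (j + 2) ↔ r (j + 2) ≤ r (j + 1)) := by
  rcases h with ⟨h1, h2, h⟩ | ⟨h1, h2, h⟩ <;>
    have h3 := h (j + 3) (by omega) (by omega) (by omega) <;> omega

namespace GraphModel

variable {n : ℕ} {V : Type u} {X : DirectedColoredGraph n V} {v : X.zeroOneVertices}
  {lam : ℕ → ℕ} {P : X.zeroOneVertices → (ℕ → ℕ) → Prop}

theorem symm_of (M : GraphModel X v n 0 lam P) {j : ℕ} {w : X.zeroOneVertices} (h1 : 1 ≤ j)
    (h2 : j + 2 ≤ n) (hD : X.toSigned.D (j + 1) v w) : X.toSigned.D (j + 1) w v := by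
  obtain ⟨r, hr⟩ := M.self
  obtain ⟨r', hr', hk⟩ := M.word_of hr h1 h2 hD
  obtain ⟨v', hv', hD'⟩ := M.vertex_of hr' h1 h2 hk.symm
  rwa [M.left_unique hr hv']

theorem exists_iff (M : GraphModel X v n 0 lam P) {j : ℕ} (h1 : 1 ≤ j) (h2 : j + 2 ≤ n) :
    X.toSigned.sign v j = -X.toSigned.sign v (j + 1) ↔ ∃ w, X.toSigned.D (j + 1) v w := by
  obtain ⟨r, hr⟩ := M.self
  have e := M.sign (i := j) hr h1 (by omega)
  have e' := M.sign (i := j + 1) hr (by omega) (by omega)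
  rw [Nat.add_zero] at e e'
  rw [e, e', ite_eq_neg_iff]
  constructor
  · intro h
    obtain ⟨r', hk⟩ := exists_knuth h
    obtain ⟨w, -, hD⟩ := M.vertex_of hr h1 h2 hk
    exact ⟨w, hD⟩
  · rintro ⟨w, hD⟩
    obtain ⟨r', -, hk⟩ := M.word_of hr h1 h2 hD
    exact hk.active

theorem unique_of (M : GraphModel X v n 0 lam P) {j : ℕ} {w w' : X.zeroOneVertices} (h1 : 1 ≤ j)
    (h2 : j + 2 ≤ n) (h : X.toSigned.D (j + 1) v w) (h' : X.toSigned.D (j + 1) v w') :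
    w = w' := by
  obtain ⟨r, hr⟩ := M.self
  obtain ⟨s, hs, hk⟩ := M.word_of hr h1 h2 h
  obtain ⟨t, ht, hk'⟩ := M.word_of hr h1 h2 h'
  obtain rfl := hk.right_unique hk'
  exact M.left_unique hs ht

theorem commute (M : GraphModel X v n 0 lam P) {i j : ℕ} {x w : X.zeroOneVertices} (h1 : 1 ≤ i)
    (h2 : i + 2 ≤ n) (h1' : 1 ≤ j) (h2' : j + 2 ≤ n) (hij : i + 3 ≤ j ∨ j + 3 ≤ i)
    (h : X.toSigned.D (i + 1) v x) (h' : X.toSigned.D (j + 1) x w) :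
    ∃ y, X.toSigned.D (j + 1) v y ∧ X.toSigned.D (i + 1) y w := by
  obtain ⟨r, hr⟩ := M.self
  obtain ⟨s, hs, hk⟩ := M.word_of hr h1 h2 h
  obtain ⟨t, ht, hk'⟩ := M.word_of hs h1' h2' h'
  obtain ⟨q, hq, hq'⟩ := hk.commute hij hk'
  obtain ⟨y, hy, hD⟩ := M.vertex_of hr h1' h2' hq
  obtain ⟨w', hw', hD'⟩ := M.vertex_of hy h1 h2 hq'
  rw [M.left_unique ht hw']
  exact ⟨y, hD, hD'⟩

theorem few_moves {m : ℕ} (M : GraphModel X v (m + 1) 0 lam P) {w : X.zeroOneVertices}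
    (h : X.toSigned.Joined (Set.Icc 2 m) v w) :
    X.toSigned.Joined (Set.Ico 2 m) v w ∨
    ∃ a b, X.toSigned.Joined (Set.Ico 2 m) v a ∧ X.toSigned.D m a b ∧
      X.toSigned.Joined (Set.Ico 2 m) b w := by
  obtain ⟨r, hr⟩ := M.self
  obtain ⟨r', hr'⟩ : ∃ r', P w r' := by
    induction h with
    | refl => exact ⟨r, hr⟩
    | tail _ h ih =>
      obtain ⟨s, hs⟩ := ih
      obtain ⟨c, hc, hD⟩ := h
      obtain ⟨j, rfl⟩ : ∃ j, c = j + 1 := ⟨c - 1, by have := hc.1; omega⟩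
      obtain ⟨t, ht, -⟩ := M.word_of hs (Nat.succ_le_succ_iff.1 hc.1) (Nat.succ_le_succ hc.2) hD
      exact ⟨t, ht⟩
  have hC : ∀ j, 1 ≤ j → j + 3 ≤ m + 1 → j + 1 + 0 ∈ Set.Ico 2 m := fun j h1 h2 =>
    ⟨by omega, by omega⟩
  rcases fewMoves (M.ballot hr) (M.ballot hr') with h | ⟨a, b, j, h1, h2, h3, -, -, h6, h7⟩
  · obtain ⟨w', hw', hj⟩ := M.joined (by omega) hC hr h
    rw [M.left_unique hr' hw']
    exact Or.inl hj
  · obtain ⟨x, hx, hvx⟩ := M.joined (by omega) hC hr h3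
    obtain ⟨y, hy, hD⟩ := M.vertex_of hx h2 (by omega) h6
    obtain ⟨w', hw', hyw⟩ := M.joined (by omega) hC hy h7
    obtain rfl : j + 1 = m := by omega
    rw [M.left_unique hr' hw']
    exact Or.inr ⟨x, y, hvx, hD, hyw⟩

end GraphModel

theorem mainTheorem2 {n : ℕ} {V : Type*} (X : DirectedColoredGraph n V) (hX : X.IsRegular)
    (hV : X.zeroWeightSpace = X.zeroOneVertices) :
    X.toSigned.IsDualEquivalenceGraph := by
  have model := fun v => exists_graphModel (m := n) (s := 0) hX hV v le_rfl
  have index : ∀ i, 1 < i → i < n → ∃ j, i = j + 1 ∧ 1 ≤ j ∧ j + 2 ≤ n := fun i h1 h2 =>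
    ⟨i - 1, by omega, by omega, by omega⟩
  have index' : ∀ {i v w}, X.toSigned.D i v w → ∃ j, i = j + 1 ∧ 1 ≤ j ∧ j + 2 ≤ n :=
    fun h => index _ (X.toSigned.color_mem h).1 (X.toSigned.color_mem h).2
  refine ⟨fun i v w h => ?_, fun i v h1 h2 => ?_, fun i v w h => ?_, fun i v w h => ?_,
    fun i v h1 h2 h => ?_, fun i v w h1 h2 h => ?_, fun hn i v h1 h2 h => ?_,
    fun i j v u w hij h h' => ?_⟩
  · obtain ⟨j, rfl, h1, h2⟩ := index' h
    obtain ⟨lam, P, M⟩ := model v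
    exact M.symm_of h1 h2 h
  · obtain ⟨j, rfl, h1, h2⟩ := index i h1 h2
    obtain ⟨lam, P, M⟩ := model v
    exact ⟨M.exists_iff h1 h2, fun w w' => M.unique_of h1 h2⟩
  · obtain ⟨j, rfl, h1, h2⟩ := index' h
    obtain ⟨lam, P, M⟩ := model v
    obtain ⟨r, hr⟩ := M.self
    obtain ⟨r', hr', hk⟩ := M.word_of hr h1 h2 h
    have e := fun k (g1 : 1 ≤ k) (g2 : k < n) => M.sign (i := k) hr g1 g2
    have e' := fun k (g1 : 1 ≤ k) (g2 : k < n) => M.sign (i := k) hr' g1 g2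
    simp only [Nat.add_zero] at e e'
    obtain ⟨d1, d2, d3⟩ := hk.descent
    refine ⟨?_, ?_, fun k g1 g2 g3 => ?_⟩
    · rw [Nat.add_sub_cancel, e j h1 (by omega), e' j h1 (by omega), ite_eq_neg_iff]
      exact d1
    · rw [e (j + 1) (by omega) h2, e' (j + 1) (by omega) h2, ite_eq_neg_iff]
      exact d2
    · rw [e k g1 g2, e' k g1 g2, ite_eq_iff_iff]
      exact d3 k (by omega)
  · obtain ⟨j, rfl, h1, h2⟩ := index' h
    obtain ⟨lam, P, M⟩ := model v
    obtain ⟨r, hr⟩ := M.self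
    obtain ⟨r', hr', hk⟩ := M.word_of hr h1 h2 h
    have e := fun k (g1 : 1 ≤ k) (g2 : k < n) => M.sign (i := k) hr g1 g2
    have e' := fun k (g1 : 1 ≤ k) (g2 : k < n) => M.sign (i := k) hr' g1 g2
    simp only [Nat.add_zero] at e e'
    constructor
    · intro hj hs
      obtain ⟨k, rfl⟩ : ∃ k, j = k + 1 := ⟨j - 1, by omega⟩
      have e1 : k + 1 + 1 - 2 = k := by omega
      have e2 : k + 1 + 1 - 1 = k + 1 := by omega
      rw [e1, e k (by omega) (by omega), e' k (by omega) (by omega), ite_eq_neg_iff] at hs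
      rw [e1, e2, e k (by omega) (by omega), e (k + 1) (by omega) (by omega), ite_eq_neg_iff]
      exact hk.descent_low hs
    · intro hj hs
      rw [e (j + 1 + 1) (by omega) hj, e' (j + 1 + 1) (by omega) hj, ite_eq_neg_iff] at hs
      rw [e (j + 1 + 1) (by omega) hj, e (j + 1) (by omega) h2, ite_eq_neg_iff]
      exact hk.descent_high hs
  -- The colours `i - 2`, `i - 1`, `i` become 2, 3, 4 for the crystal restricted to the four colours
  -- `s + 1` to `s + 4`, whose words have length five.
  · obtain ⟨s, rfl⟩ : ∃ s, i = 4 + s := ⟨i - 4, by omega⟩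
    obtain ⟨lam, P, M⟩ := exists_graphModel (m := 5) (s := s) hX hV v (by omega)
    have hC : ∀ c, c ∈ ({4 + s - 2, 4 + s - 1, 4 + s} : Set ℕ) ↔
        ∃ j, 1 ≤ j ∧ j + 2 ≤ 5 ∧ c = j + 1 + s := fun c => by
      simp only [Set.mem_insert_iff, Set.mem_singleton_iff]
      exact ⟨fun h => ⟨c - s - 1, by omega, by omega, by omega⟩, by rintro ⟨j, h1, h2, rfl⟩; omega⟩
    obtain ⟨w, c, hc, hD⟩ := h
    obtain ⟨j, g1, g2, rfl⟩ := (hC c).1 hc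
    obtain ⟨r, hr⟩ := M.self
    obtain ⟨r', -, hk⟩ := M.word_of hr g1 g2 hD
    rcases exists_component_five (ballot_iff.1 (M.ballot hr)).1 g1 g2 hk with
      ⟨φ, hφ, a, rfl⟩ | ⟨φ, hφ, a, rfl⟩ | ⟨φ, hφ, a, rfl⟩
    · exact Or.inl (M.componentIs hC (fun _ _ _ _ _ => path4_shift) hφ hr)
    · exact Or.inr (Or.inl (M.componentIs hC (fun _ _ _ _ _ => doublePath5_shift) hφ hr))
    · exact Or.inr (Or.inr (M.componentIs hC (fun _ _ _ _ _ => flower6_shift) hφ hr))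
  -- With words of length `i + 1`, moves at the last position are precisely the edges of colour `i`.
  · obtain ⟨lam, P, M⟩ := exists_graphModel (m := i + 1) (s := 0) hX hV v h2
    exact M.few_moves h
  · subst hn
    obtain rfl : i = 3 := by omega
    obtain ⟨lam, P, M⟩ := model v
    have hC : ∀ c, c ∈ ({3 - 1, 3} : Set ℕ) ↔ ∃ j, 1 ≤ j ∧ j + 2 ≤ 4 ∧ c = j + 1 + 0 :=
      fun c => by
        simp only [Set.mem_insert_iff, Set.mem_singleton_iff]
        exact ⟨fun h => ⟨c - 1, by omega, by omega, by omega⟩, by rintro ⟨j, h1, h2, rfl⟩; omega⟩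
    obtain ⟨w, c, hc, hD⟩ := h
    obtain ⟨j, g1, g2, rfl⟩ := (hC c).1 hc
    obtain ⟨r, hr⟩ := M.self
    obtain ⟨r', -, hk⟩ := M.word_of hr g1 g2 hD
    rcases exists_component_four (ballot_iff.1 (M.ballot hr)).1 g1 g2 hk with
      ⟨φ, hφ, a, rfl⟩ | ⟨φ, hφ, a, rfl⟩
    · exact Or.inl (M.componentIs hC (fun _ _ _ _ _ => Iff.rfl) hφ hr)
    · exact Or.inr (M.componentIs hC (fun _ _ _ _ _ => Iff.rfl) hφ hr)
  · obtain ⟨k, rfl, h1, h2⟩ := index' h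
    obtain ⟨l, rfl, h1', h2'⟩ := index' h'
    obtain ⟨lam, P, M⟩ := model v
    refine M.commute h1 h2 h1' h2' ?_ h h'
    have := le_abs.1 hij
    omega
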